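/- **Setting.** All algebras are complex; inner products are positive definite and conjugate-linear in the first variable; a *pre-Hilbert space* is a complex vector space with such an inner product. A *$*$-representation* of a unital $*$-algebra $R$ on a pre-Hilbert space $H_0$ is a unital homomorphism $\pi:R\to\mathrm{End}_{\mathbb C}(H_0)$ with $\langle v,\pi(a)w\rangle=\langle\pi(a^*)v,w\rangle$. Let $U$ be a Hopf $*$-algebra, i.e. a Hopf algebra and unital $*$-algebra over $\mathbb C$ with $\Delta(x^*)=x_{(1)}^*\otimes x_{(2)}^*$; let $S$ be its antipode. Let $\mathscr F$ be a collection of $*$-representations $\hat\pi$ of $U$ on finite-dimensional Hilbert spaces, each $S^2$-compatible: there is an invertible positive $T$ with $\hat\pi(S^2(x))=T\hat\pi(x)T^{-1}$ for all $x\in U$. Let $I\subseteq U$ be a left coideal $*$-subalgebra, i.e. a unital $*$-subalgebra with $\Delta(I)\subseteq U\otimes I$; write $\Delta(x)=x_{(-1)}\otimes x_{(0)}$ for $x\in I$. * $A=A_{\mathscr F}\subseteq\mathrm{Lin}(U,\mathbb C)$ is the unital $*$-algebra generated by all matrix coefficients $x\mapsto\langle\xi,\hat\pi(x)\eta\rangle$,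 $\hat\pi\in\mathscr F$, for the product $(ab)(x)=a(x_{(1)})b(x_{(2)})$ and involution $a^*(x)=\overline{a(S(x)^*)}$. It carries the coproduct determined by $a_{(1)}(x)a_{(2)}(y)=a(xy)$ and the counit $a\mapsto a(1)$. * $\pi_C:A\to C$ is the quotient of $A$ by the kernel of $A\to\mathrm{Lin}(I,\mathbb C)$, $a\mapsto a|_I$; write $\tau(\pi_C(a),x)=a(x)$ for $x\in I$. $C$ carries the unique coalgebra structure and left $A$-module structure for which $\pi_C$ is a coalgebra map and $A$-linear, and the antilinear involution $\dagger$ with $\tau(c^\dagger,x)=\overline{\tau(c,x^*)}$. * $B=\{b\in A:\pi_C(b_{(1)})\otimes b_{(2)}=\pi_C(1)\otimes b\}$, with right $A$-coaction $B\to B\otimes A$, $b\mapsto b_{(0)}\otimes b_{(1)}$, given by the restriction of the coproduct of $A$. * $D(B,I)$ is the universal unital $*$-algebra generated by copies of $B$ and $I$ with relations $xb=b_{(1)}(x_{(-1)})\,b_{(0)}x_{(0)}$ for $x\in I,\ b\in B$. * $\mathscr I=\mathrm{Lin}(C,\mathbb C)$ is a unital $*$-algebra for $(xy)(c)=x(c_{(1)})y(c_{(2)})$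 and $x^*(c)=\overline{x(c^\dagger)}$, with right $A$-action $(x\triangleleft a)(c)=x(ac)$. Let $\mathcal I=\{x\in\mathscr I:\ \mathscr I x\mathscr I\text{ spans a finite-dimensional space}\}$. Let $\mathscr D(B,\mathscr I)$ be the universal unital $*$-algebra generated by copies of $B$ and $\mathscr I$ with relations $xb=b_{(0)}(x\triangleleft b_{(1)})$. The *reduced algebra* is its $*$-subalgebra $\mathcal D(B,\mathcal I)=B\mathcal I$, the linear span of the products $bx$ with $b\in B$, $x\in\mathcal I$ (in general non-unital). * A *unitary Doi–Koppinen module* is a pre-Hilbert space $H_0$ with a $*$-representation of $B$ and a coassociative counital coaction $\delta:H_0\to H_0\otimes C$, $v\mapsto v_{(0)}\otimes v_{(1)}$, such that $\langle v,w_{(0)}\rangle w_{(1)}=\langle v_{(0)},w\rangle v_{(1)}^\dagger$ and $\delta(bv)=b_{(0)}v_{(0)}\otimes b_{(1)}v_{(1)}$. It is *locally complete* if $\{v\in H_0:\delta(v)\in H_0\otimes D\}$ is complete for every finite-dimensional subcoalgebra $D\subseteq C$. * A $*$-representation $\pi$ of $U$ on a pre-Hilbert space is *of $\mathscr F$-type*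 if each cyclic subspace $\pi(U)\xi$ is finite-dimensional and all matrix coefficients of $\pi$ on it lie in $A$. A $*$-representation $\pi$ of $I$ is of $\mathscr F$-type if each $\pi(I)\xi$ is finite-dimensional and is isometrically isomorphic, as an $I$-representation, to an $I$-invariant subspace of an $\mathscr F$-type $*$-representation of $U$. A $*$-representation $\theta$ of $D(B,I)$ is of $\mathscr F$-type if $\theta|_I$ is. * A $*$-representation $\theta$ of $D(B,I)$ and a unitary Doi–Koppinen module structure on the same space $H_0$ are *associated* if they have the same $B$-action and $\theta(x)v=(\mathrm{id}\otimes\tau(-,x))\delta(v)$ for all $x\in I$, $v\in H_0$. The representation $\theta$ is *locally complete* if it has an associated unitary Doi–Koppinen module that is locally complete. (By (1) below, the associated module of an $\mathscr F$-type $\theta$ exists and is unique.) * A $*$-representation of $\mathcal D(B,\mathcal I)$ on a Hilbert space $K$ is a $*$-homomorphism $\pi:\mathcal D(B,\mathcal I)\to B(K)$ to the bounded operators; it is *non-degenerate* if the span of $\pi(\mathcal D(B,\mathcal I))K$ is dense in $K$. Write $\pi(\mathcal I)K$ for the linear span of all $\pi(x)v$ with $x\in\mathcal I$, $v\in K$.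 * If $\theta$ on $H_0$ has the associated module $(H_0,\delta)$, and $\pi$ is a $*$-representation of $\mathcal D(B,\mathcal I)$ on $K$, then an isometry $j:H_0\to K$ *intertwines* $\theta$ and $\pi$ if $\pi(bx)\,j(v)=j\big(\theta(b)(\mathrm{id}\otimes x)\delta(v)\big)$ for all $b\in B$, $x\in\mathcal I$, $v\in H_0$. **Statement.** Locally complete $\mathscr F$-type $*$-representations of $D(B,I)$ on pre-Hilbert spaces are in one-to-one correspondence with non-degenerate $*$-representations of $\mathcal D(B,\mathcal I)$ on Hilbert spaces. Precisely: 1. Every $\mathscr F$-type $*$-representation of $D(B,I)$ on a pre-Hilbert space has exactly one associated unitary Doi–Koppinen module. 2. For every locally complete $\mathscr F$-type $*$-representation $\theta$ of $D(B,I)$ on $H_0$ there is exactly one non-degenerate $*$-representation of $\mathcal D(B,\mathcal I)$ on the completion of $H_0$ for which the canonical embedding of $H_0$ is intertwining. 3. For every non-degenerate $*$-representation $\pi$ of $\mathcal D(B,\mathcal I)$ on a Hilbert space $K$, the subspace $\pi(\mathcal I)K$ is dense in $K$ and carries exactly one locally complete $\mathscr F$-type $*$-representation of $D(B,I)$ for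 which the inclusion $\pi(\mathcal I)K\subseteq K$ is intertwining. 4. These constructions are mutually inverse: if $j:H_0\to K$ is an intertwining isometry with dense range from a locally complete $\mathscr F$-type $*$-representation of $D(B,I)$ to a non-degenerate $*$-representation $\pi$ of $\mathcal D(B,\mathcal I)$, then $j(H_0)=\pi(\mathcal I)K$. 5. There is a bijection between unitary equivalence classes of locally complete $\mathscr F$-type $*$-representations of $D(B,I)$ and unitary equivalence classes of non-degenerate $*$-representations of $\mathcal D(B,\mathcal I)$ under which the classes of $\theta$ and $\pi$ correspond if and only if there is an intertwining isometry with dense range from $\theta$ to $\pi$. -/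

import Mathlib

open scoped TensorProduct InnerProductSpace ComplexConjugate
open TensorProduct Coalgebra HopfAlgebra WithConv

set_option linter.unusedSectionVars false
set_option linter.checkUnivs false

universe u v w z

noncomputable section

namespace DrinfeldCoideal


section TensorLemmas

variable {V P Q : Type*} [AddCommGroup V] [Module ℂ V] [AddCommGroup P] [Module ℂ P]
  [AddCommGroup Q] [Module ℂ Q]

theorem eq_zero_of_lTensor {X : Type*} (ev : X → P →ₗ[ℂ] ℂ)
    (hev : ∀ p : P, (∀ x, ev x p = 0) → p = 0) (t : V ⊗[ℂ] P)
    (ht : ∀ x, (ev x).lTensor V t = 0) : t = 0 := by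
  classical
  let b := Module.Basis.ofVectorSpace ℂ V
  apply (TensorProduct.equivFinsuppOfBasisLeft b).injective
  rw [map_zero]
  ext i
  rw [TensorProduct.equivFinsuppOfBasisLeft_apply, Finsupp.zero_apply]
  apply hev
  intro x
  have h : ∀ s : V ⊗[ℂ] P, ev x (TensorProduct.lid ℂ P ((b.coord i).rTensor P s)) =
      TensorProduct.lid ℂ ℂ ((b.coord i).rTensor ℂ ((ev x).lTensor V s)) := by
    intro s
    induction s with
    | zero => simp
    | tmul a c => simp
    | add a c ha hc => simp only [map_add, ha, hc]
  rw [h, ht x]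
  simp

theorem eq_zero_of_map {X Y : Type*} (ev : X → P →ₗ[ℂ] ℂ) (ev' : Y → Q →ₗ[ℂ] ℂ)
    (hev : ∀ p : P, (∀ x, ev x p = 0) → p = 0) (hev' : ∀ p : Q, (∀ x, ev' x p = 0) → p = 0)
    (t : P ⊗[ℂ] Q)
    (ht : ∀ x y, LinearMap.mul' ℂ ℂ (TensorProduct.map (ev x) (ev' y) t) = 0) : t = 0 := by
  refine eq_zero_of_lTensor ev' hev' t fun y => ?_
  apply (TensorProduct.rid ℂ P).injective
  rw [map_zero]
  apply hev
  intro x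
  rw [← ht x y]
  generalize t = s
  induction s with
  | zero => simp
  | tmul a c => simp [mul_comm]
  | add a c ha hc => simp only [map_add, ha, hc]

/-- A tensor in `V ⊗ P` all of whose slices lie in `W ⊆ V` comes from `W ⊗ P`. -/
theorem mem_range_of_lTensor {X : Type*} (ev : X → P →ₗ[ℂ] ℂ)
    (hev : ∀ p : P, (∀ x, ev x p = 0) → p = 0) (W : Submodule ℂ V) (t : V ⊗[ℂ] P)
    (ht : ∀ x, TensorProduct.rid ℂ V ((ev x).lTensor V t) ∈ W) :
    t ∈ LinearMap.range (W.subtype.rTensor P) := by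
  have hex := rTensor_exact P (f := W.subtype) (g := W.mkQ)
    (LinearMap.exact_subtype_mkQ W) (Submodule.mkQ_surjective W)
  rw [← LinearMap.exact_iff.mp hex]
  rw [LinearMap.mem_ker]
  refine eq_zero_of_lTensor ev hev _ fun x => ?_
  apply (TensorProduct.rid ℂ (V ⧸ W)).injective
  rw [map_zero]
  have h : ∀ s : V ⊗[ℂ] P, TensorProduct.rid ℂ (V ⧸ W) ((ev x).lTensor _ (W.mkQ.rTensor P s)) =
      W.mkQ (TensorProduct.rid ℂ V ((ev x).lTensor V s)) := by
    intro s
    induction s with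
    | zero => simp
    | tmul a c => simp
    | add a c ha hc => simp only [map_add, ha, hc]
  rw [h]
  simpa using ht x

end TensorLemmas

section Hopf

variable {U : Type u} [Ring U] [HopfAlgebra ℂ U]

/-- The antipode reverses the coproduct. -/
theorem comul_antipode (x : U) :
    comul (R := ℂ) (antipode ℂ x) =
      TensorProduct.map (antipode ℂ) (antipode ℂ) (TensorProduct.comm ℂ U U (comul x)) := by
  suffices h : toConv (TensorProduct.map (antipode ℂ) (antipode ℂ) ∘ₗ
      (TensorProduct.comm ℂ U U).toLinearMap ∘ₗ comul) =
      toConv (comul (R := ℂ) (A := U) ∘ₗ antipode ℂ) by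
    exact (LinearMap.congr_fun (congrArg ofConv h) x).symm
  refine left_inv_eq_right_inv (a := toConv (comul (R := ℂ) (A := U))) ?_
    (LinearMap.comul_right_inv)
  ext x
  let K : U → U ⊗[ℂ] (U ⊗[ℂ] U) →ₗ[ℂ] U ⊗[ℂ] U := fun p =>
    TensorProduct.map (LinearMap.mul' ℂ U) LinearMap.id ∘ₗ
      (TensorProduct.assoc ℂ U U U).symm.toLinearMap ∘ₗ
      TensorProduct.map (antipode ℂ)
        (TensorProduct.map LinearMap.id (LinearMap.mulLeft ℂ (antipode ℂ p)))
  have hK : ∀ p b c d : U, K p (b ⊗ₜ (c ⊗ₜ d)) = (antipode ℂ b * c) ⊗ₜ (antipode ℂ p * d) :=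
    fun p b c d => by simp [K]
  let K' : U →ₗ[ℂ] U ⊗[ℂ] U →ₗ[ℂ] U ⊗[ℂ] U :=
    { toFun := fun p => K p ∘ₗ comul.lTensor U
      map_add' := fun p p' => by
        ext b q
        simp only [TensorProduct.AlgebraTensorModule.curry_apply, LinearMap.restrictScalars_self,
          TensorProduct.curry_apply, LinearMap.comp_apply, LinearMap.lTensor_tmul,
          LinearMap.add_apply]
        generalize (comul (R := ℂ) q : U ⊗[ℂ] U) = s
        induction s with
        | zero => simp
        | tmul c d => simp [hK, add_mul, TensorProduct.tmul_add]
        | add c d hc hd =>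
          simp only [TensorProduct.tmul_add, map_add, hc, hd]
          abel
      map_smul' := fun z p => by
        ext b q
        simp only [TensorProduct.AlgebraTensorModule.curry_apply, LinearMap.restrictScalars_self,
          TensorProduct.curry_apply, LinearMap.comp_apply, LinearMap.lTensor_tmul,
          LinearMap.smul_apply, RingHom.id_apply]
        generalize (comul (R := ℂ) q : U ⊗[ℂ] U) = s
        induction s with
        | zero => simp
        | tmul c d => simp [hK]
        | add c d hc hd => simp only [TensorProduct.tmul_add, map_add, hc, hd, smul_add] }
  let G : U →ₗ[ℂ] U ⊗[ℂ] U := TensorProduct.map (antipode ℂ) (antipode ℂ) ∘ₗ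
      (TensorProduct.comm ℂ U U).toLinearMap ∘ₗ comul
  have h1 : ∀ t : U ⊗[ℂ] U,
      LinearMap.mul' ℂ (U ⊗[ℂ] U) (TensorProduct.map G comul t) =
        TensorProduct.lift K' (TensorProduct.assoc ℂ U U U (comul.rTensor U t)) := by
    intro t
    induction t with
    | zero => simp
    | add a c ha hc => simp only [map_add, ha, hc]
    | tmul p q =>
      simp only [TensorProduct.map_tmul, LinearMap.mul'_apply, LinearMap.rTensor_tmul, G,
        LinearMap.comp_apply, LinearEquiv.coe_coe]
      generalize (comul (R := ℂ) p : U ⊗[ℂ] U) = s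
      induction s with
      | zero => simp
      | add a c ha hc => simp only [map_add, add_mul, TensorProduct.add_tmul, ha, hc]
      | tmul a b =>
        simp only [TensorProduct.comm_tmul, TensorProduct.map_tmul, TensorProduct.assoc_tmul,
          TensorProduct.lift.tmul]
        change _ = K a (comul.lTensor U (b ⊗ₜ q))
        rw [LinearMap.lTensor_tmul]
        generalize (comul (R := ℂ) q : U ⊗[ℂ] U) = s
        induction s with
        | zero => simp
        | add a c ha hc => simp only [map_add, mul_add, TensorProduct.tmul_add, ha, hc]
        | tmul c d => simp [hK]
  have h2 : ∀ p q : U, K' p (comul q) = 1 ⊗ₜ (antipode ℂ p * q) := by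
    intro p q
    change K p (comul.lTensor U (comul q)) = _
    rw [← coassoc_apply]
    have h3 : ∀ t : U ⊗[ℂ] U, K p (TensorProduct.assoc ℂ U U U (comul.rTensor U t)) =
        (1 : U) ⊗ₜ (antipode ℂ p * TensorProduct.lid ℂ U (counit.rTensor U t)) := by
      intro t
      induction t with
      | zero => simp
      | add a c ha hc => simp only [map_add, mul_add, TensorProduct.tmul_add, ha, hc]
      | tmul a d =>
        have h4 : ∀ s : U ⊗[ℂ] U, K p (TensorProduct.assoc ℂ U U U (s ⊗ₜ d)) =
            (LinearMap.mul' ℂ U ((antipode ℂ).rTensor U s)) ⊗ₜ (antipode ℂ p * d) := by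
          intro s
          induction s with
          | zero => simp
          | add a c ha hc => simp only [map_add, TensorProduct.add_tmul, ha, hc]
          | tmul b c => simp [hK]
        rw [LinearMap.rTensor_tmul, h4, mul_antipode_rTensor_comul_apply]
        simp [Algebra.algebraMap_eq_smul_one, TensorProduct.smul_tmul]
    rw [h3, rTensor_counit_comul]
    simp
  have h5 : ∀ t : U ⊗[ℂ] U, TensorProduct.lift K' (comul.lTensor U t) =
      (1 : U) ⊗ₜ (LinearMap.mul' ℂ U ((antipode ℂ).rTensor U t)) := by
    intro t
    induction t with
    | zero => simp
    | add a c ha hc => simp only [map_add, TensorProduct.tmul_add, ha, hc]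
    | tmul a d => simp [h2]
  change LinearMap.mul' ℂ (U ⊗[ℂ] U) (TensorProduct.map G comul (comul x)) = _
  rw [h1, coassoc_apply, h5, mul_antipode_rTensor_comul_apply]
  simp [Algebra.algebraMap_eq_smul_one, Algebra.TensorProduct.one_def]

end Hopf

/-- A Hopf `*`-algebra: a complex Hopf algebra with a `*`-algebra structure for which the coproduct
is `*`-preserving, `Δ(x^*) = x₍₁₎^* ⊗ x₍₂₎^*`. -/
class HopfStarAlgebra (U : Type u) [Ring U] [StarRing U] [HopfAlgebra ℂ U] [StarModule ℂ U] :
    Prop where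
  comul_star : ∀ x : U, comul (R := ℂ) (star x) = star (comul (R := ℂ) x)

section HopfStar

variable {U : Type u} [Ring U] [StarRing U] [HopfAlgebra ℂ U] [StarModule ℂ U] [HopfStarAlgebra U]

theorem counit_star (x : U) : counit (R := ℂ) (star x) = conj (counit (R := ℂ) x) := by
  let e : U →ₗ[ℂ] ℂ :=
    { toFun := fun x => conj (counit (R := ℂ) (star x))
      map_add' := fun a b => by simp
      map_smul' := fun z a => by simp }
  have h : ∀ t : U ⊗[ℂ] U, TensorProduct.lid ℂ U (e.rTensor U t) =
      star (TensorProduct.lid ℂ U (counit.rTensor U (star t))) := by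
    intro t
    induction t with
    | zero => simp
    | tmul a b => simp [e]
    | add a b ha hb => simp only [map_add, star_add, ha, hb]
  have h1 : ∀ a : U, TensorProduct.lid ℂ U (e.rTensor U (comul a)) = a := by
    intro a
    rw [h, ← HopfStarAlgebra.comul_star, rTensor_counit_comul]
    simp
  have h2 : ∀ t : U ⊗[ℂ] U, counit (R := ℂ) (TensorProduct.lid ℂ U (e.rTensor U t)) =
      e (TensorProduct.rid ℂ U (counit.lTensor U t)) := by
    intro t
    induction t with
    | zero => simp
    | tmul a b => simp [mul_comm]
    | add a b ha hb => simp only [map_add, ha, hb]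
  have h3 := h2 (comul x)
  rw [h1, lTensor_counit_comul] at h3
  rw [h3]
  simp [e]

/-- `x₍₂₎ S(x₍₁₎^*)^* = ε(x)`. -/
theorem mul_star_antipode_star (x : U) :
    LinearMap.mul' ℂ U (TensorProduct.comm ℂ U U (star (TensorProduct.map (antipode ℂ)
      LinearMap.id (star (comul (R := ℂ) x))))) = algebraMap ℂ U (counit x) := by
  have h : ∀ t : U ⊗[ℂ] U, LinearMap.mul' ℂ U (TensorProduct.comm ℂ U U
      (star (TensorProduct.map (antipode ℂ) LinearMap.id t))) =
      star (LinearMap.mul' ℂ U ((antipode ℂ).rTensor U t)) := by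
    intro t
    induction t with
    | zero => simp
    | tmul a b => simp
    | add a b ha hb => simp only [map_add, star_add, ha, hb]
  rw [h, ← HopfStarAlgebra.comul_star, mul_antipode_rTensor_comul_apply, counit_star,
    Algebra.algebraMap_eq_smul_one, Algebra.algebraMap_eq_smul_one, star_smul]
  simp

/-- `S(S(x^*)^*) = x`. -/
theorem antipode_star_antipode_star (x : U) : antipode ℂ (star (antipode ℂ (star x))) = x := by
  let T : U →ₗ[ℂ] U :=
    { toFun := fun x => antipode ℂ (star (antipode ℂ (star x)))
      map_add' := fun a b => by simp
      map_smul' := fun z a => by simp }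
  suffices h : toConv (LinearMap.id : U →ₗ[ℂ] U) = toConv T from
    (LinearMap.congr_fun (congrArg ofConv h) x).symm
  refine left_inv_eq_right_inv (a := toConv (antipode ℂ (A := U))) LinearMap.id_mul_antipode ?_
  ext x
  have h : ∀ t : U ⊗[ℂ] U, LinearMap.mul' ℂ U (TensorProduct.map (antipode ℂ) T t) =
      antipode ℂ (star (LinearMap.mul' ℂ U ((antipode ℂ).lTensor U (star t)))) := by
    intro t
    induction t with
    | zero => simp
    | tmul a b => simp [T, antipode_mul_antidistrib]
    | add a b ha hb => simp only [map_add, star_add, ha, hb]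
  rw [LinearMap.convMul_apply, LinearMap.convOne_apply]
  change LinearMap.mul' ℂ U (TensorProduct.map (antipode ℂ) T (comul x)) = _
  rw [h, ← HopfStarAlgebra.comul_star, mul_antipode_lTensor_comul_apply, counit_star,
    Algebra.algebraMap_eq_smul_one, Algebra.algebraMap_eq_smul_one, star_smul]
  simp

/-- `S(S(x)^*)^* = x`. -/
theorem star_antipode_star_antipode (x : U) : star (antipode ℂ (star (antipode ℂ x))) = x := by
  have h := antipode_star_antipode_star (star x)
  rw [star_star] at h
  rw [h, star_star]

end HopfStar

/-- A `†`-structure on a complex coalgebra: an involutive, anti-linear, anti-comultiplicative map,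
`Δ(c^†) = c₍₂₎^† ⊗ c₍₁₎^†`. -/
class DagCoalgebra (X : Type u) [AddCommGroup X] [Module ℂ X] [Coalgebra ℂ X] where
  /-- the map `c ↦ c^†` -/
  dag : X →ₗ⋆[ℂ] X
  dag_dag : ∀ c, dag (dag c) = c
  comul_dag : ∀ c, comul (R := ℂ) (dag c) =
    TensorProduct.map dag dag (TensorProduct.comm ℂ X X (comul (R := ℂ) c))

open DagCoalgebra (dag)

/-- The canonical `†`-structure `x^† = S(x)^*` of a Hopf `*`-algebra. -/
instance hopfDag {U : Type u} [Ring U] [StarRing U] [HopfAlgebra ℂ U] [StarModule ℂ U]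
    [HopfStarAlgebra U] : DagCoalgebra U where
  dag :=
    { toFun := fun x => star (antipode ℂ x)
      map_add' := fun a b => by simp
      map_smul' := fun z a => by simp }
  dag_dag := star_antipode_star_antipode
  comul_dag := fun c => by
    change comul (R := ℂ) (star (antipode ℂ c)) = _
    rw [HopfStarAlgebra.comul_star, comul_antipode]
    generalize TensorProduct.comm ℂ U U (comul (R := ℂ) c) = t
    induction t with
    | zero => simp
    | tmul a b => simp
    | add a b ha hb => simp only [map_add, star_add, ha, hb]

theorem hopfDag_apply {U : Type u} [Ring U] [StarRing U] [HopfAlgebra ℂ U] [StarModule ℂ U]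
    [HopfStarAlgebra U] (x : U) : dag x = star (antipode ℂ x) := rfl

/-- The full linear dual `Lin(X, ℂ)` of a coalgebra `X`, with the convolution product
`(ω χ)(c) = ω(c₍₁₎) χ(c₍₂₎)` and unit the counit. -/
def FullDual (X : Type u) [AddCommGroup X] [Module ℂ X] : Type u := WithConv (X →ₗ[ℂ] ℂ)

namespace FullDual

variable {X : Type u} [AddCommGroup X] [Module ℂ X]

instance [Coalgebra ℂ X] : Ring (FullDual X) := inferInstanceAs (Ring (WithConv (X →ₗ[ℂ] ℂ)))

instance [Coalgebra ℂ X] : Algebra ℂ (FullDual X) :=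
  inferInstanceAs (Algebra ℂ (WithConv (X →ₗ[ℂ] ℂ)))

/-- The functional underlying an element of the full dual. -/
def toFun [Coalgebra ℂ X] : FullDual X ≃ₗ[ℂ] Module.Dual ℂ X :=
  (WithConv.linearEquiv ℂ (X →ₗ[ℂ] ℂ))

/-- The element of the full dual given by a functional. -/
def mk [Coalgebra ℂ X] (f : Module.Dual ℂ X) : FullDual X := toFun.symm f

variable [Coalgebra ℂ X]

@[simp] theorem toFun_mk (f : Module.Dual ℂ X) : toFun (mk f) = f := toFun.apply_symm_apply f

@[simp] theorem mk_toFun (f : FullDual X) : mk (toFun f) = f := toFun.symm_apply_apply f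

theorem ext {f g : FullDual X} (h : ∀ x, toFun f x = toFun g x) : f = g :=
  toFun.injective (LinearMap.ext h)

theorem mul_apply (f g : FullDual X) (x : X) :
    toFun (f * g) x = LinearMap.mul' ℂ ℂ (TensorProduct.map (toFun f) (toFun g) (comul x)) := rfl

theorem one_apply (x : X) : toFun (1 : FullDual X) x = counit (R := ℂ) x := rfl

/-- The `*`-structure of the full dual of a `†`-coalgebra: `ω^*(c) = conj (ω (c^†))`. -/
instance [DagCoalgebra X] : StarRing (FullDual X) where
  star f := mk
    { toFun := fun x => conj (toFun f (dag x))
      map_add' := fun a b => by simp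
      map_smul' := fun z a => by simp }
  star_involutive f := ext fun x => by simp [DagCoalgebra.dag_dag]
  star_mul f g := ext fun x => by
    rw [mul_apply, toFun_mk, toFun_mk, toFun_mk]
    simp only [LinearMap.coe_mk, AddHom.coe_mk]
    rw [mul_apply, DagCoalgebra.comul_dag]
    generalize (comul (R := ℂ) x : X ⊗[ℂ] X) = t
    induction t with
    | zero => simp
    | tmul a b => simp [mul_comm]
    | add a b ha hb => simp only [map_add, ha, hb]
  star_add f g := ext fun x => by simp

theorem star_apply [DagCoalgebra X] (f : FullDual X) (x : X) :
    toFun (star f) x = conj (toFun f (dag x)) := rfl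

instance [DagCoalgebra X] : StarModule ℂ (FullDual X) where
  star_smul z f := ext fun x => by simp [star_apply]

end FullDual

/-- A space `P` of functionals on an algebra `R` such that each `f ∈ P` satisfies
`f(xy) = ∑ gᵢ(x) hᵢ(y)` for some `gᵢ, hᵢ ∈ P`. -/
structure DualPairing (P : Type u) [AddCommGroup P] [Module ℂ P] (R : Type v) [Ring R]
    [Algebra ℂ R] where
  ev : R →ₗ[ℂ] P →ₗ[ℂ] ℂ
  sep : ∀ p : P, (∀ x, ev x p = 0) → p = 0
  fac : ∀ p : P, ∃ t : P ⊗[ℂ] P, ∀ x y,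
    LinearMap.mul' ℂ ℂ (TensorProduct.map (ev x) (ev y) t) = ev (x * y) p

namespace DualPairing

variable {P : Type u} [AddCommGroup P] [Module ℂ P] {R : Type v} [Ring R] [Algebra ℂ R]

theorem ext₂ (d : DualPairing P R) {s t : P ⊗[ℂ] P} (h : ∀ x y, LinearMap.mul' ℂ ℂ (TensorProduct.map (d.ev x) (d.ev y) s) =
    LinearMap.mul' ℂ ℂ (TensorProduct.map (d.ev x) (d.ev y) t)) : s = t := by
  rw [← sub_eq_zero]
  refine eq_zero_of_map (fun x => d.ev x) (fun x => d.ev x) d.sep d.sep _ fun x y => ?_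
  rw [map_sub, map_sub, h, sub_self]

variable (d : DualPairing P R)

/-- The coproduct dual to the product of `R`. -/
def comul : P →ₗ[ℂ] P ⊗[ℂ] P where
  toFun p := (d.fac p).choose
  map_add' p q := d.ext₂ fun x y => by
    refine ((d.fac (p + q)).choose_spec x y).trans ?_
    rw [map_add, map_add, map_add, (d.fac p).choose_spec, (d.fac q).choose_spec]
  map_smul' z p := d.ext₂ fun x y => by
    refine ((d.fac (z • p)).choose_spec x y).trans ?_
    rw [RingHom.id_apply, map_smul, map_smul, map_smul, (d.fac p).choose_spec]

theorem comul_spec (p : P) (x y : R) :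
    LinearMap.mul' ℂ ℂ (TensorProduct.map (d.ev x) (d.ev y) (d.comul p)) = d.ev (x * y) p :=
  (d.fac p).choose_spec x y

theorem lid_rTensor_comul (p : P) (x : R) (y : R) :
    d.ev y (TensorProduct.lid ℂ P ((d.ev x).rTensor P (d.comul p))) = d.ev (x * y) p := by
  rw [← d.comul_spec]
  generalize d.comul p = t
  induction t with
  | zero => simp
  | tmul a b => simp
  | add a b ha hb => simp only [map_add, ha, hb]

theorem rid_lTensor_comul (p : P) (x : R) (y : R) :
    d.ev x (TensorProduct.rid ℂ P ((d.ev y).lTensor P (d.comul p))) = d.ev (x * y) p := by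
  rw [← d.comul_spec]
  generalize d.comul p = t
  induction t with
  | zero => simp
  | tmul a b => simp [mul_comm]
  | add a b ha hb => simp only [map_add, ha, hb]

/-- The coalgebra `P` with `Δ(p)(x ⊗ y) = p(xy)` and `ε(p) = p(1)`. -/
abbrev coalgebra : Coalgebra ℂ P where
  comul := d.comul
  counit := d.ev 1
  coassoc := by
    ext p
    rw [← sub_eq_zero]
    refine eq_zero_of_map (fun x => d.ev x)
      (fun y : R × R => LinearMap.mul' ℂ ℂ ∘ₗ TensorProduct.map (d.ev y.1) (d.ev y.2)) d.sep
      (fun t ht => eq_zero_of_map (fun x => d.ev x) (fun x => d.ev x) d.sep d.sep t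
        (fun x y => ht (x, y))) _ ?_
    rintro x ⟨y, z⟩
    rw [map_sub, map_sub, sub_eq_zero]
    simp only [LinearMap.comp_apply, LinearEquiv.coe_coe]
    have h1 : ∀ t : P ⊗[ℂ] P, LinearMap.mul' ℂ ℂ (TensorProduct.map (d.ev x)
        (LinearMap.mul' ℂ ℂ ∘ₗ TensorProduct.map (d.ev y) (d.ev z))
        (TensorProduct.assoc ℂ P P P (d.comul.rTensor P t))) =
        LinearMap.mul' ℂ ℂ (TensorProduct.map (d.ev (x * y)) (d.ev z) t) := by
      intro t
      induction t with
      | zero => simp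
      | add a b ha hb => simp only [map_add, ha, hb]
      | tmul a b =>
        rw [LinearMap.rTensor_tmul, TensorProduct.map_tmul, LinearMap.mul'_apply, ← d.comul_spec]
        generalize d.comul a = s
        induction s with
        | zero => simp
        | add a b ha hb => simp only [map_add, TensorProduct.add_tmul, ha, hb, add_mul]
        | tmul a b => simp [mul_assoc]
    have h2 : ∀ t : P ⊗[ℂ] P, LinearMap.mul' ℂ ℂ (TensorProduct.map (d.ev x)
        (LinearMap.mul' ℂ ℂ ∘ₗ TensorProduct.map (d.ev y) (d.ev z)) (d.comul.lTensor P t)) =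
        LinearMap.mul' ℂ ℂ (TensorProduct.map (d.ev x) (d.ev (y * z)) t) := by
      intro t
      induction t with
      | zero => simp
      | add a b ha hb => simp only [map_add, ha, hb]
      | tmul a b => simp [d.comul_spec]
    rw [h1, h2, d.comul_spec, d.comul_spec, mul_assoc]
  rTensor_counit_comp_comul := by
    ext p
    apply (TensorProduct.lid ℂ P).injective
    rw [← sub_eq_zero]
    refine d.sep _ fun y => ?_
    rw [map_sub, LinearMap.comp_apply, d.lid_rTensor_comul]
    simp
  lTensor_counit_comp_comul := by
    ext p
    apply (TensorProduct.rid ℂ P).injective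
    rw [← sub_eq_zero]
    refine d.sep _ fun y => ?_
    rw [map_sub, LinearMap.comp_apply, d.rid_lTensor_comul]
    simp

end DualPairing

/-- A `*`-representation of a unital `*`-algebra `R` on a pre-Hilbert space `H`: a unital module
structure with `⟨v, π(a) w⟩ = ⟨π(a^*) v, w⟩`. -/
structure StarRep (R : Type u) [Ring R] [StarRing R] [Algebra ℂ R]
    (H : Type v) [NormedAddCommGroup H] [InnerProductSpace ℂ H] where
  hom : R →ₐ[ℂ] Module.End ℂ H
  inner_hom : ∀ (a : R) (v w : H), ⟪v, hom a w⟫_ℂ = ⟪hom (star a) v, w⟫_ℂ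

namespace StarRep

variable {R : Type u} [Ring R] [StarRing R] [Algebra ℂ R]
  {H : Type v} [NormedAddCommGroup H] [InnerProductSpace ℂ H]

instance : CoeFun (StarRep R H) (fun _ => R → Module.End ℂ H) := ⟨fun π => π.hom⟩

/-- The pullback of a `*`-representation along a unital `*`-homomorphism. -/
def comp (π : StarRep R H) {S : Type w} [Ring S] [StarRing S] [Algebra ℂ S]
    (f : S →⋆ₐ[ℂ] R) : StarRep S H where
  hom := π.hom.comp f.toAlgHom
  inner_hom a v w := by
    have h : f.toAlgHom (star a) = star (f.toAlgHom a) := map_star f a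
    simp only [AlgHom.comp_apply, h]
    exact π.inner_hom _ v w

/-- The cyclic submodule `π(R) ξ`. -/
def orbit (π : StarRep R H) (ξ : H) : Submodule ℂ H :=
  LinearMap.range ((LinearMap.applyₗ ξ) ∘ₗ π.hom.toLinearMap)

theorem mem_orbit (π : StarRep R H) (ξ : H) (a : R) {v : H} (hv : v ∈ π.orbit ξ) :
    π a v ∈ π.orbit ξ := by
  obtain ⟨b, rfl⟩ := hv
  exact ⟨a * b, by simp⟩

end StarRep

section Coefficients

variable {U : Type u} [Ring U] [StarRing U] [HopfAlgebra ℂ U] [StarModule ℂ U] [HopfStarAlgebra U]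

/-- The matrix coefficient `x ↦ ⟨ξ, π(x) η⟩`. -/
def coeff {H : Type v} [NormedAddCommGroup H] [InnerProductSpace ℂ H] (π : StarRep U H)
    (ξ η : H) : FullDual U :=
  FullDual.mk ((innerSL ℂ ξ).toLinearMap ∘ₗ LinearMap.applyₗ η ∘ₗ π.hom.toLinearMap)

theorem coeff_apply {H : Type v} [NormedAddCommGroup H] [InnerProductSpace ℂ H] (π : StarRep U H)
    (ξ η : H) (x : U) : (coeff π ξ η).toFun x = ⟪ξ, π x η⟫_ℂ := by
  simp [coeff]

/-- A `*`-representation on a finite-dimensional Hilbert space is `S²`-compatible if there is an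
invertible positive `T` with `π(S²(x)) = T π(x) T⁻¹`. -/
def IsSqAntipodeCompatible {H : Type v} [NormedAddCommGroup H] [InnerProductSpace ℂ H]
    (π : StarRep U H) : Prop :=
  ∃ T : (Module.End ℂ H)ˣ, (T : Module.End ℂ H).IsPositive ∧
    ∀ x : U, π (antipode ℂ (antipode ℂ x)) = T * π x * (↑T⁻¹ : Module.End ℂ H)

end Coefficients

/-- A collection of `S²`-compatible finite-dimensional unital `*`-representations of `U`. -/
structure RepFamily (U : Type u) [Ring U] [StarRing U] [HopfAlgebra ℂ U] [StarModule ℂ U]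
    [HopfStarAlgebra U] where
  index : Type v
  space : index → Type w
  [normed : ∀ i, NormedAddCommGroup (space i)]
  [inner : ∀ i, InnerProductSpace ℂ (space i)]
  [fin : ∀ i, FiniteDimensional ℂ (space i)]
  rep : ∀ i, StarRep U (space i)
  compat : ∀ i, IsSqAntipodeCompatible (rep i)

attribute [instance] RepFamily.normed RepFamily.inner RepFamily.fin

section CoeffAlgebra

variable {U : Type u} [Ring U] [StarRing U] [HopfAlgebra ℂ U] [StarModule ℂ U] [HopfStarAlgebra U]

/-- The unital `*`-algebra `A` generated in the full dual of `U` by the matrix coefficients of the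
family. -/
def coeffAlgebra (F : RepFamily.{u, v, w} U) : StarSubalgebra ℂ (FullDual U) :=
  StarAlgebra.adjoin ℂ {f | ∃ (i : F.index) (ξ η : F.space i), f = coeff (F.rep i) ξ η}

variable (F : RepFamily.{u, v, w} U)

/-- The evaluation of elements of `A` at elements of `U`. -/
def evA : U →ₗ[ℂ] coeffAlgebra F →ₗ[ℂ] ℂ :=
  (FullDual.toFun.toLinearMap ∘ₗ (coeffAlgebra F).toSubalgebra.toSubmodule.subtype :
    coeffAlgebra F →ₗ[ℂ] Module.Dual ℂ U).flip

theorem evA_apply (x : U) (a : coeffAlgebra F) : evA F x a = (a : FullDual U).toFun x := rfl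

theorem dag_mul (x y : U) : dag (x * y) = dag x * dag y := by
  simp [hopfDag_apply, antipode_mul_antidistrib]

theorem evA_tensor_mul (x y : U) (t s : coeffAlgebra F ⊗[ℂ] coeffAlgebra F) :
    LinearMap.mul' ℂ ℂ (TensorProduct.map (evA F x) (evA F y) (t * s)) =
      ∑ i ∈ (ℛ ℂ x).index, ∑ j ∈ (ℛ ℂ y).index,
        (LinearMap.mul' ℂ ℂ (TensorProduct.map (evA F ((ℛ ℂ x).left i))
          (evA F ((ℛ ℂ y).left j)) t)) *
        (LinearMap.mul' ℂ ℂ (TensorProduct.map (evA F ((ℛ ℂ x).right i))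
          (evA F ((ℛ ℂ y).right j)) s)) := by
  have hmul : ∀ (a c : coeffAlgebra F) (z : U), evA F z (a * c) =
      ∑ i ∈ (ℛ ℂ z).index, evA F ((ℛ ℂ z).left i) a * evA F ((ℛ ℂ z).right i) c := by
    intro a c z
    rw [evA_apply, MulMemClass.coe_mul, FullDual.mul_apply, ← (ℛ ℂ z).eq]
    simp [evA_apply]
  induction t with
  | zero => simp
  | add a b ha hb => simp only [add_mul, map_add, ha, hb, Finset.sum_add_distrib]
  | tmul a b =>
    induction s with
    | zero => simp
    | add c d hc hd => simp only [mul_add, map_add, hc, hd, Finset.sum_add_distrib]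
    | tmul c d =>
      simp only [Algebra.TensorProduct.tmul_mul_tmul, TensorProduct.map_tmul,
        LinearMap.mul'_apply, hmul, Finset.sum_mul_sum]
      exact Finset.sum_congr rfl fun i _ => Finset.sum_congr rfl fun j _ => by ring

theorem mul_apply_mul (f g : FullDual U) (x y : U) : (f * g).toFun (x * y) =
    ∑ i ∈ (ℛ ℂ x).index, ∑ j ∈ (ℛ ℂ y).index,
      f.toFun ((ℛ ℂ x).left i * (ℛ ℂ y).left j) * g.toFun ((ℛ ℂ x).right i * (ℛ ℂ y).right j) := by
  rw [FullDual.mul_apply, Bialgebra.comul_mul]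
  conv_lhs => rw [← (ℛ ℂ x).eq, ← (ℛ ℂ y).eq, Finset.sum_mul_sum]
  simp

theorem coeffAlgebra_fac (f : FullDual U) (hf : f ∈ coeffAlgebra F) :
    ∃ t : coeffAlgebra F ⊗[ℂ] coeffAlgebra F, ∀ x y,
      LinearMap.mul' ℂ ℂ (TensorProduct.map (evA F x) (evA F y) t) = f.toFun (x * y) := by
  induction hf using StarAlgebra.adjoin_induction with
  | mem f hf =>
    obtain ⟨i, ξ, η, rfl⟩ := hf
    let b := stdOrthonormalBasis ℂ (F.space i)
    have hm : ∀ v w, coeff (F.rep i) v w ∈ coeffAlgebra F := fun v w =>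
      StarAlgebra.subset_adjoin ℂ _ ⟨i, v, w, rfl⟩
    refine ⟨∑ k, (⟨_, hm ξ (b k)⟩ : coeffAlgebra F) ⊗ₜ[ℂ] (⟨_, hm (b k) η⟩ : coeffAlgebra F),
      fun x y => ?_⟩
    simp only [map_sum, TensorProduct.map_tmul, LinearMap.mul'_apply, evA_apply, coeff_apply]
    rw [map_mul, Module.End.mul_apply, (F.rep i).inner_hom x]
    rw [← b.sum_inner_mul_inner]
    simp [(F.rep i).inner_hom x]
  | algebraMap r =>
    refine ⟨r • (1 ⊗ₜ 1), fun x y => ?_⟩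
    simp [evA_apply, FullDual.one_apply, Algebra.algebraMap_eq_smul_one]
  | add f g hf hg h1 h2 =>
    obtain ⟨t, ht⟩ := h1
    obtain ⟨s, hs⟩ := h2
    exact ⟨t + s, fun x y => by simp [ht, hs]⟩
  | mul f g hf hg h1 h2 =>
    obtain ⟨t, ht⟩ := h1
    obtain ⟨s, hs⟩ := h2
    refine ⟨t * s, fun x y => ?_⟩
    rw [evA_tensor_mul, mul_apply_mul]
    simp only [ht, hs]
  | star f hf h1 =>
    obtain ⟨t, ht⟩ := h1
    refine ⟨star t, fun x y => ?_⟩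
    rw [FullDual.star_apply, dag_mul, ← ht]
    clear ht
    induction t with
    | zero => simp
    | add a b ha hb => simp only [star_add, map_add, ha, hb]
    | tmul a b => simp [evA_apply, FullDual.star_apply]

/-- The pairing between `A` and `U`. -/
def pairingA : DualPairing (coeffAlgebra F) U where
  ev := evA F
  sep := fun _ h => Subtype.ext (FullDual.ext h)
  fac := fun a => coeffAlgebra_fac F a.1 a.2

/-- The coalgebra structure of `A`, dual to the algebra structure of `U`. -/
instance : Coalgebra ℂ (coeffAlgebra F) := (pairingA F).coalgebra

/-- `τ(Δ(a), x ⊗ y) = τ(a, xy)`. -/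
theorem comulA_spec (a : coeffAlgebra F) (x y : U) :
    LinearMap.mul' ℂ ℂ (TensorProduct.map (evA F x) (evA F y) (comul a)) = evA F (x * y) a :=
  (pairingA F).comul_spec a x y

/-- The coproduct of `A` is multiplicative. -/
theorem comulA_mul (a b : coeffAlgebra F) :
    comul (R := ℂ) (a * b) = comul (R := ℂ) a * comul (R := ℂ) b := by
  refine (pairingA F).ext₂ fun x y => ?_
  refine (comulA_spec F _ x y).trans (Eq.trans ?_ (evA_tensor_mul F x y _ _).symm)
  rw [evA_apply, MulMemClass.coe_mul, mul_apply_mul]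
  simp only [comulA_spec]
  rfl

/-- The functional `x ↦ conj (f (x^*))`. -/
def dagFun (f : FullDual U) : FullDual U := FullDual.mk
  { toFun := fun x => conj (f.toFun (star x))
    map_add' := fun a b => by simp
    map_smul' := fun z a => by simp }

theorem dagFun_apply (f : FullDual U) (x : U) : (dagFun f).toFun x = conj (f.toFun (star x)) := by
  simp [dagFun]

theorem dagFun_mul (f g : FullDual U) : dagFun (f * g) = dagFun f * dagFun g := by
  refine FullDual.ext fun x => ?_
  rw [dagFun_apply, FullDual.mul_apply, FullDual.mul_apply, HopfStarAlgebra.comul_star]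
  generalize (comul (R := ℂ) x : U ⊗[ℂ] U) = t
  induction t with
  | zero => simp
  | add a b ha hb => simp only [star_add, map_add, ha, hb]
  | tmul a b => simp [dagFun_apply]

theorem dagFun_mem_aux (f : FullDual U) (hf : f ∈ coeffAlgebra F) :
    dagFun f ∈ coeffAlgebra F ∧ dagFun (star f) ∈ coeffAlgebra F := by
  induction hf using StarAlgebra.adjoin_induction with
  | mem f hf =>
    obtain ⟨i, ξ, η, rfl⟩ := hf
    have hm : ∀ v w, coeff (F.rep i) v w ∈ coeffAlgebra F := fun v w =>
      StarAlgebra.subset_adjoin ℂ _ ⟨i, v, w, rfl⟩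
    obtain ⟨T, -, hT⟩ := F.compat i
    constructor
    · convert hm η ξ using 1
      refine FullDual.ext fun x => ?_
      rw [dagFun_apply, coeff_apply, coeff_apply, inner_conj_symm, (F.rep i).inner_hom x]
    · have h1 : dagFun (star (coeff (F.rep i) ξ η)) = star (coeff (F.rep i)
          ((T : Module.End ℂ (F.space i)) η)
          (LinearMap.adjoint (↑T⁻¹ : Module.End ℂ (F.space i)) ξ)) := by
        refine FullDual.ext fun x => ?_
        have h2 := hT (star (antipode ℂ (star x)))
        rw [antipode_star_antipode_star] at h2
        have h3 : F.rep i (star (antipode ℂ (star x))) =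
            (↑T⁻¹ : Module.End ℂ (F.space i)) * F.rep i (antipode ℂ x) * T := by
          rw [h2]
          simp [mul_assoc]
        rw [dagFun_apply, FullDual.star_apply, FullDual.star_apply, coeff_apply, coeff_apply,
          Complex.conj_conj, inner_conj_symm, hopfDag_apply, hopfDag_apply, h3,
          ← (F.rep i).inner_hom, LinearMap.adjoint_inner_left]
        rfl
      rw [h1]
      exact star_mem (hm _ _)
  | algebraMap r =>
    have h1 : ∀ r : ℂ, dagFun (algebraMap ℂ (FullDual U) r) = algebraMap ℂ _ (conj r) := by
      intro r
      refine FullDual.ext fun x => ?_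
      simp [dagFun_apply, FullDual.one_apply, Algebra.algebraMap_eq_smul_one, counit_star]
    rw [← algebraMap_star_comm, h1, h1]
    exact ⟨algebraMap_mem _ _, algebraMap_mem _ _⟩
  | add f g hf hg h1 h2 =>
    have h3 : ∀ f g : FullDual U, dagFun (f + g) = dagFun f + dagFun g := by
      intro f g
      refine FullDual.ext fun x => ?_
      simp [dagFun_apply]
    rw [star_add, h3, h3]
    exact ⟨add_mem h1.1 h2.1, add_mem h1.2 h2.2⟩
  | mul f g hf hg h1 h2 =>
    rw [star_mul, dagFun_mul, dagFun_mul]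
    exact ⟨mul_mem h1.1 h2.1, mul_mem h2.2 h1.2⟩
  | star f hf h1 =>
    rw [star_star]
    exact ⟨h1.2, h1.1⟩

theorem dagFun_mem {f : FullDual U} (hf : f ∈ coeffAlgebra F) : dagFun f ∈ coeffAlgebra F :=
  (dagFun_mem_aux F f hf).1

end CoeffAlgebra

/-- The inclusion of a `*`-subalgebra as a linear map. -/
def inclLin {R : Type u} [Ring R] [StarRing R] [Algebra ℂ R] [StarModule ℂ R]
    (S : StarSubalgebra ℂ R) : S →ₗ[ℂ] R where
  toFun x := x
  map_add' _ _ := rfl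
  map_smul' _ _ := rfl

@[simp] theorem inclLin_apply {R : Type u} [Ring R] [StarRing R] [Algebra ℂ R] [StarModule ℂ R]
    (S : StarSubalgebra ℂ R) (x : S) : inclLin S x = x := rfl

/-- A left coideal `*`-subalgebra of `U`: a unital `*`-subalgebra `I` with `Δ(I) ⊆ U ⊗ I`. -/
structure LeftCoideal (U : Type u) [Ring U] [StarRing U] [HopfAlgebra ℂ U] [StarModule ℂ U] where
  carrier : StarSubalgebra ℂ U
  comul_mem : ∀ x ∈ carrier, comul (R := ℂ) x ∈
    LinearMap.range ((inclLin carrier).lTensor U)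

/-- The linear map `M → P` obtained by factoring `f : M → N` through an injection `j : P → N`. -/
def factor {M N P : Type*} [AddCommGroup M] [Module ℂ M] [AddCommGroup N] [Module ℂ N]
    [AddCommGroup P] [Module ℂ P] (j : P →ₗ[ℂ] N) (hj : Function.Injective j) (f : M →ₗ[ℂ] N)
    (hf : ∀ m, f m ∈ LinearMap.range j) : M →ₗ[ℂ] P :=
  (LinearEquiv.ofInjective j hj).symm.toLinearMap ∘ₗ f.codRestrict _ hf

theorem factor_spec {M N P : Type*} [AddCommGroup M] [Module ℂ M] [AddCommGroup N] [Module ℂ N]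
    [AddCommGroup P] [Module ℂ P] (j : P →ₗ[ℂ] N) (hj : Function.Injective j) (f : M →ₗ[ℂ] N)
    (hf : ∀ m, f m ∈ LinearMap.range j) (m : M) : j (factor j hj f hf m) = f m := by
  have h : (LinearEquiv.ofInjective j hj (factor j hj f hf m) : N) = f m := by
    simp [factor]
  simpa using h

section Datum

variable {U : Type u} [Ring U] [StarRing U] [HopfAlgebra ℂ U] [StarModule ℂ U] [HopfStarAlgebra U]

/-- The coaction `I → U ⊗ I`, `x ↦ x₍₋₁₎ ⊗ x₍₀₎`, the restriction of the coproduct of `U`. -/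
def coactI (I : LeftCoideal U) : I.carrier →ₗ[ℂ] U ⊗[ℂ] I.carrier :=
  factor ((inclLin I.carrier).lTensor U)
    (Module.Flat.lTensor_preserves_injective_linearMap _ Subtype.val_injective)
    (comul ∘ₗ (inclLin I.carrier)) (fun x => I.comul_mem x.1 x.2)

theorem coactI_spec (I : LeftCoideal U) (x : I.carrier) :
    (inclLin I.carrier).lTensor U (coactI I x) = comul (R := ℂ) (x : U) :=
  factor_spec _ _ (comul ∘ₗ (inclLin I.carrier)) _ x

/-- The right action `x ◁ a = τ(a, x₍₋₁₎) x₍₀₎` of functionals `a` on `U` on the coideal `I`. -/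
def actI (I : LeftCoideal U) : I.carrier →ₗ[ℂ] FullDual U →ₗ[ℂ] I.carrier where
  toFun x :=
    { toFun := fun a => TensorProduct.lid ℂ I.carrier (a.toFun.rTensor I.carrier (coactI I x))
      map_add' := fun a b => by simp [LinearMap.rTensor_add]
      map_smul' := fun z a => by simp [LinearMap.rTensor_smul] }
  map_add' x y := by ext a; simp
  map_smul' z x := by ext a; simp

theorem actI_apply (I : LeftCoideal U) (x : I.carrier) (a : FullDual U) :
    actI I x a = TensorProduct.lid ℂ I.carrier (a.toFun.rTensor I.carrier (coactI I x)) := rfl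

/-- `(a b)(x) = b(x ◁ a)` for `x ∈ I`. -/
theorem mul_apply_coideal (I : LeftCoideal U) (a b : FullDual U) (x : I.carrier) :
    (a * b).toFun (x : U) = b.toFun (actI I x a : I.carrier) := by
  rw [FullDual.mul_apply, ← coactI_spec, actI_apply]
  generalize coactI I x = t
  induction t with
  | zero => simp
  | add a b ha hb => simp only [map_add, ha, hb, AddMemClass.coe_add]
  | tmul a b => simp

variable (F : RepFamily.{u, v, w} U) (I : LeftCoideal U)

/-- The map `A → Lin(I, ℂ)`, `a ↦ τ(a, -)|_I`. -/
def restrictI : coeffAlgebra F →ₗ[ℂ] Module.Dual ℂ I.carrier where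
  toFun a := (a : FullDual U).toFun ∘ₗ (inclLin I.carrier)
  map_add' a b := by ext x; simp
  map_smul' z a := by ext x; simp

/-- The quotient coalgebra `C` of `A`: the coimage of `A → Lin(I, ℂ)`, realized as the image of
this map. -/
def quotC : Submodule ℂ (Module.Dual ℂ I.carrier) := LinearMap.range (restrictI F I)

/-- The quotient map `π_C : A → C`. -/
def projC : coeffAlgebra F →ₗ[ℂ] quotC F I := (restrictI F I).rangeRestrict

theorem projC_surjective : Function.Surjective (projC F I) := LinearMap.surjective_rangeRestrict _

theorem projC_apply (a : coeffAlgebra F) (x : I.carrier) :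
    (projC F I a : Module.Dual ℂ I.carrier) x = (a : FullDual U).toFun (x : U) := rfl

/-- The pairing `τ` between `C` and `I`. -/
def evC : I.carrier →ₗ[ℂ] quotC F I →ₗ[ℂ] ℂ := (quotC F I).subtype.flip

theorem evC_apply (x : I.carrier) (c : quotC F I) :
    evC F I x c = (c : Module.Dual ℂ I.carrier) x := rfl

theorem evC_projC (x : I.carrier) (a : coeffAlgebra F) :
    evC F I x (projC F I a) = evA F (x : U) a := rfl

/-- The pairing between `C` and `I`, as a dual pairing. -/
def pairingC : DualPairing (quotC F I) I.carrier where
  ev := evC F I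
  sep := fun c h => Subtype.ext (LinearMap.ext h)
  fac := fun c => by
    obtain ⟨a, rfl⟩ := projC_surjective F I c
    refine ⟨TensorProduct.map (projC F I) (projC F I) (comul a), fun x y => ?_⟩
    rw [evC_projC, MulMemClass.coe_mul, ← comulA_spec]
    generalize (comul (R := ℂ) a : coeffAlgebra F ⊗[ℂ] coeffAlgebra F) = t
    induction t with
    | zero => simp
    | add a b ha hb => simp only [map_add, ha, hb]
    | tmul a b => simp [evC_projC]

/-- The coalgebra structure of `C`, dual to the algebra structure of `I`. -/
instance : Coalgebra ℂ (quotC F I) := (pairingC F I).coalgebra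

theorem comulC_spec (c : quotC F I) (x y : I.carrier) :
    LinearMap.mul' ℂ ℂ (TensorProduct.map (evC F I x) (evC F I y) (comul c)) = evC F I (x * y) c :=
  (pairingC F I).comul_spec c x y

/-- `π_C` is a morphism of coalgebras. -/
theorem comul_projC (a : coeffAlgebra F) : comul (R := ℂ) (projC F I a) =
    TensorProduct.map (projC F I) (projC F I) (comul a) := by
  refine (pairingC F I).ext₂ fun x y => ?_
  refine (comulC_spec F I _ x y).trans ?_
  rw [evC_projC, MulMemClass.coe_mul, ← comulA_spec]
  generalize (comul (R := ℂ) a : coeffAlgebra F ⊗[ℂ] coeffAlgebra F) = t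
  induction t with
  | zero => simp
  | add a b ha hb => simp only [map_add, ha, hb]
  | tmul a b => simp only [TensorProduct.map_tmul]; rfl

/-- The antipode of `A`, `τ(S_A(a), x) = τ(a, S_U(x))`. -/
def antipodeA : coeffAlgebra F →ₗ[ℂ] coeffAlgebra F where
  toFun a := ⟨FullDual.mk ((a : FullDual U).toFun ∘ₗ antipode ℂ), by
    have h : FullDual.mk ((a : FullDual U).toFun ∘ₗ antipode ℂ) = star (dagFun a.1) := by
      refine FullDual.ext fun x => ?_
      simp [FullDual.star_apply, dagFun_apply, hopfDag_apply]
    rw [h]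
    exact star_mem (dagFun_mem F a.2)⟩
  map_add' a b := Subtype.ext (FullDual.ext fun x => by simp)
  map_smul' z a := Subtype.ext (FullDual.ext fun x => by simp)

/-- The map `c ↦ c^†` on `C`, given by `c^†(x) = conj (c(x^*))`. -/
def dagMapC : quotC F I →ₗ⋆[ℂ] quotC F I where
  toFun c := ⟨
    { toFun := fun x => conj (c.1 (star x))
      map_add' := fun a b => by simp
      map_smul' := fun z a => by simp }, by
    obtain ⟨a, rfl⟩ := projC_surjective F I c
    refine ⟨⟨dagFun a.1, dagFun_mem F a.2⟩, ?_⟩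
    ext x
    exact dagFun_apply _ _⟩
  map_add' c d := Subtype.ext (LinearMap.ext fun x => by simp)
  map_smul' z c := Subtype.ext (LinearMap.ext fun x => by simp)

theorem evC_dagMapC (c : quotC F I) (x : I.carrier) :
    evC F I x (dagMapC F I c) = conj (evC F I (star x) c) := rfl

/-- The `†`-structure on `C`; the map `π_C` is `†`-preserving for `a^† = S_A(a)^*`, see
`projC_dag`. -/
instance dagC : DagCoalgebra (quotC F I) where
  dag := dagMapC F I
  dag_dag := fun c => Subtype.ext (LinearMap.ext fun x => by
    rw [← evC_apply, evC_dagMapC, evC_dagMapC, star_star, Complex.conj_conj, evC_apply])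
  comul_dag := fun c => by
    refine (pairingC F I).ext₂ fun x y => ?_
    refine (comulC_spec F I _ x y).trans ?_
    rw [evC_dagMapC, star_mul, ← comulC_spec]
    change _ = LinearMap.mul' ℂ ℂ (TensorProduct.map (evC F I x) (evC F I y) _)
    generalize (comul (R := ℂ) c : quotC F I ⊗[ℂ] quotC F I) = t
    induction t with
    | zero => simp
    | add a b ha hb => simp only [map_add, ha, hb]
    | tmul a b =>
      simp only [TensorProduct.map_tmul, TensorProduct.comm_tmul, LinearMap.mul'_apply, map_mul,
        evC_dagMapC]
      rw [mul_comm]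

theorem dagC_apply (c : quotC F I) (x : I.carrier) :
    (dag c : quotC F I).1 x = conj (c.1 (star x)) := rfl

theorem projC_dag (a : coeffAlgebra F) :
    projC F I (star (antipodeA F a)) = dag (projC F I a) := by
  refine Subtype.ext (LinearMap.ext fun x => ?_)
  rw [dagC_apply, projC_apply, projC_apply]
  change conj ((a : FullDual U).toFun (antipode ℂ (star (antipode ℂ (x : U))))) = _
  congr 2
  have h := antipode_star_antipode_star (star (x : U))
  rwa [star_star] at h

/-- The left `A`-module structure of `C`, `τ(a c, x) = τ(c, x ◁ a)`. -/
def actC : coeffAlgebra F →ₗ[ℂ] quotC F I →ₗ[ℂ] quotC F I where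
  toFun a :=
    { toFun := fun c => ⟨c.1 ∘ₗ (actI I).flip a.1, by
        obtain ⟨b, rfl⟩ := projC_surjective F I c
        refine ⟨a * b, ?_⟩
        ext x
        exact mul_apply_coideal I a.1 b.1 x⟩
      map_add' := fun c d => Subtype.ext (LinearMap.ext fun x => by simp)
      map_smul' := fun z c => Subtype.ext (LinearMap.ext fun x => by simp) }
  map_add' a b := by
    ext c x
    simp
  map_smul' z a := by
    ext c x
    simp

/-- `π_C` is `A`-linear. -/
theorem actC_projC (a b : coeffAlgebra F) : actC F I a (projC F I b) = projC F I (a * b) :=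
  Subtype.ext (LinearMap.ext fun x => (mul_apply_coideal I a.1 b.1 x).symm)

/-- `b ∈ {}^C A`, i.e. `π_C(b₍₁₎) ⊗ b₍₂₎ = π_C(1) ⊗ b`, iff `b(xy) = ε(x) b(y)` for
`x ∈ I`, `y ∈ U`. -/
theorem coinvariant_iff (b : coeffAlgebra F) :
    (projC F I).rTensor (coeffAlgebra F) (comul b) = projC F I 1 ⊗ₜ[ℂ] b ↔
      ∀ (x : I.carrier) (y : U), (b : FullDual U).toFun ((x : U) * y) =
        counit (R := ℂ) (x : U) * (b : FullDual U).toFun y := by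
  have h1 : ∀ (x : I.carrier) (y : U), LinearMap.mul' ℂ ℂ (TensorProduct.map (evC F I x) (evA F y)
      ((projC F I).rTensor (coeffAlgebra F) (comul b))) = (b : FullDual U).toFun ((x : U) * y) := by
    intro x y
    rw [← evA_apply, ← comulA_spec]
    generalize (comul (R := ℂ) b : coeffAlgebra F ⊗[ℂ] coeffAlgebra F) = t
    induction t with
    | zero => simp
    | add a b ha hb => simp only [map_add, ha, hb]
    | tmul a b => simp [evC_projC]
  have h2 : ∀ (x : I.carrier) (y : U), LinearMap.mul' ℂ ℂ (TensorProduct.map (evC F I x) (evA F y)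
      (projC F I 1 ⊗ₜ[ℂ] b)) = counit (R := ℂ) (x : U) * (b : FullDual U).toFun y := by
    intro x y
    rw [TensorProduct.map_tmul, evC_projC, LinearMap.mul'_apply]
    rfl
  constructor
  · intro h x y
    rw [← h1, h, h2]
  · intro h
    rw [← sub_eq_zero]
    refine eq_zero_of_map (fun x => evC F I x) (fun x => evA F x) (pairingC F I).sep
      (pairingA F).sep _ fun x y => ?_
    rw [map_sub, map_sub, h1, h2, h, sub_self]

/-- The coideal `*`-subalgebra `B = {}^C A = {b ∈ A ∣ π_C(b₍₁₎) ⊗ b₍₂₎ = π_C(1) ⊗ b}`. -/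
def algB : StarSubalgebra ℂ (coeffAlgebra F) where
  carrier := {b | (projC F I).rTensor (coeffAlgebra F) (comul b) = projC F I 1 ⊗ₜ[ℂ] b}
  mul_mem' := by
    intro a b ha hb
    rw [Set.mem_ofPred_eq, coinvariant_iff] at *
    intro x y
    rw [MulMemClass.coe_mul, FullDual.mul_apply, FullDual.mul_apply, Bialgebra.comul_mul]
    have h1 : ∀ (t : U ⊗[ℂ] I.carrier) (s : U ⊗[ℂ] U),
        LinearMap.mul' ℂ ℂ (TensorProduct.map (a : FullDual U).toFun (b : FullDual U).toFun
          ((inclLin I.carrier).lTensor U t * s)) =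
        LinearMap.mul' ℂ ℂ (TensorProduct.map (a : FullDual U).toFun (b : FullDual U).toFun
          ((TensorProduct.rid ℂ U (counit.lTensor U
            ((inclLin I.carrier).lTensor U t)) ⊗ₜ 1) * s)) := by
      intro t s
      induction t with
      | zero => simp
      | add t t' ht ht' => simp only [map_add, add_mul, TensorProduct.add_tmul, ht, ht']
      | tmul u z =>
        induction s with
        | zero => simp
        | add s s' hs hs' => simp only [map_add, mul_add, hs, hs']
        | tmul p q =>
          have h := hb z q
          simp only [LinearMap.lTensor_tmul, Algebra.TensorProduct.tmul_mul_tmul,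
            TensorProduct.map_tmul, LinearMap.mul'_apply, TensorProduct.rid_tmul, one_mul,
            smul_mul_assoc, map_smul, smul_eq_mul]
          change _ * (b : FullDual U).toFun ((z : U) * q) = counit (R := ℂ) (z : U) * _ * _
          rw [h]
          ring
    have h2 : ∀ s : U ⊗[ℂ] U,
        LinearMap.mul' ℂ ℂ (TensorProduct.map (a : FullDual U).toFun (b : FullDual U).toFun
          (((x : U) ⊗ₜ 1) * s)) = counit (R := ℂ) (x : U) *
        LinearMap.mul' ℂ ℂ (TensorProduct.map (a : FullDual U).toFun (b : FullDual U).toFun s) := by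
      intro s
      induction s with
      | zero => simp
      | add s s' hs hs' => simp only [map_add, mul_add, hs, hs']
      | tmul p q => simp [ha, mul_assoc]
    rw [← coactI_spec, h1, coactI_spec, lTensor_counit_comul, TensorProduct.rid_tmul, one_smul, h2]
  add_mem' := by
    intro a b ha hb
    rw [Set.mem_ofPred_eq] at *
    rw [map_add, map_add, ha, hb, TensorProduct.tmul_add]
  algebraMap_mem' := by
    intro r
    rw [Set.mem_ofPred_eq, coinvariant_iff]
    intro x y
    simp [Algebra.algebraMap_eq_smul_one, FullDual.one_apply]
    ring
  star_mem' := by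
    intro a ha
    rw [Set.mem_ofPred_eq, coinvariant_iff] at *
    intro x y
    have h1 : ∀ (w : U) (t : U ⊗[ℂ] I.carrier),
        (a : FullDual U).toFun (LinearMap.mul' ℂ U (TensorProduct.comm ℂ U U
          (star (TensorProduct.map (antipode ℂ) LinearMap.id
            (star ((inclLin I.carrier).lTensor U t))))) * w) =
        (a : FullDual U).toFun (dag (star (TensorProduct.rid ℂ U (counit.lTensor U
            ((inclLin I.carrier).lTensor U t)))) * w) := by
      intro w t
      induction t with
      | zero => simp
      | add t t' ht ht' => simp only [map_add, star_add, add_mul, ht, ht']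
      | tmul u z =>
        have h := ha z (dag (star u) * w)
        simp only [LinearMap.lTensor_tmul, TensorProduct.star_tmul, TensorProduct.map_tmul,
          TensorProduct.comm_tmul, LinearMap.mul'_apply, LinearMap.id_apply, star_star,
          TensorProduct.rid_tmul, star_smul, map_smulₛₗ, smul_mul_assoc, smul_eq_mul]
        rw [mul_assoc]
        refine h.trans ?_
        simp
    have h2 := h1 (dag y) (coactI I (star x))
    rw [coactI_spec, mul_star_antipode_star, lTensor_counit_comul] at h2
    have h3 : ((star x : I.carrier) : U) = star (x : U) := rfl
    rw [TensorProduct.rid_tmul, one_smul, h3, star_star, counit_star] at h2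
    change (star (a : FullDual U)).toFun ((x : U) * y) = _ * (star (a : FullDual U)).toFun y
    rw [FullDual.star_apply, FullDual.star_apply, dag_mul, ← h2]
    simp [Algebra.algebraMap_eq_smul_one]

theorem coactB_mem (b : algB F I) : (comul (R := ℂ) ∘ₗ inclLin (algB F I)) b ∈
    LinearMap.range ((inclLin (algB F I)).rTensor (coeffAlgebra F)) := by
  have hW : LinearMap.range ((algB F I).toSubalgebra.toSubmodule.subtype.rTensor
      (coeffAlgebra F)) = LinearMap.range ((inclLin (algB F I)).rTensor (coeffAlgebra F)) := rfl
  rw [← hW]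
  refine mem_range_of_lTensor (fun x => evA F x) (pairingA F).sep _ _ fun u => ?_
  have hb := (coinvariant_iff F I b.1).mp b.2
  refine (coinvariant_iff F I _).mpr fun x y => ?_
  have h : ∀ z : U, ((TensorProduct.rid ℂ (coeffAlgebra F) ((evA F u).lTensor _
      (comul (R := ℂ) b.1)) : coeffAlgebra F) : FullDual U).toFun z =
      ((b : coeffAlgebra F) : FullDual U).toFun (z * u) := fun z =>
    (pairingA F).rid_lTensor_comul b.1 z u
  refine (h _).trans ?_
  rw [mul_assoc, hb]
  exact congrArg _ (h y).symm

theorem rTensor_inclLin_injective : Function.Injective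
    ((inclLin (algB F I)).rTensor (coeffAlgebra F)) :=
  Module.Flat.rTensor_preserves_injective_linearMap (inclLin (algB F I)) Subtype.val_injective

/-- The right coaction `δ_B : B → B ⊗ A`, the restriction of the coproduct of `A`. -/
def coactB : algB F I →ₗ[ℂ] algB F I ⊗[ℂ] coeffAlgebra F :=
  factor ((inclLin (algB F I)).rTensor (coeffAlgebra F)) (rTensor_inclLin_injective F I)
    (comul (R := ℂ) ∘ₗ inclLin (algB F I)) (coactB_mem F I)

theorem coactB_spec (b : algB F I) :
    (inclLin (algB F I)).rTensor (coeffAlgebra F) (coactB F I b) =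
      comul (R := ℂ) (b : coeffAlgebra F) :=
  factor_spec ((inclLin (algB F I)).rTensor (coeffAlgebra F)) (rTensor_inclLin_injective F I)
    (comul (R := ℂ) ∘ₗ inclLin (algB F I)) (coactB_mem F I) b

end Datum

/-- The opposite of a complex algebra with the conjugate complex structure, so that a `*`-structure
is a linear map into it. -/
def ConjOp (R : Type u) : Type u := Rᵐᵒᵖ

instance (R : Type u) [Ring R] : Ring (ConjOp R) := inferInstanceAs (Ring Rᵐᵒᵖ)

instance (R : Type u) [Ring R] [Algebra ℂ R] : Algebra ℂ (ConjOp R) :=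
  RingHom.toAlgebra' ((algebraMap ℂ Rᵐᵒᵖ).comp (starRingEnd ℂ))
    fun z x => Algebra.commutes (A := Rᵐᵒᵖ) (conj z) x

/-- A homomorphism of algebras, viewed between the conjugate opposite algebras. -/
def ConjOp.map {R : Type u} {S : Type v} [Ring R] [Algebra ℂ R] [Ring S] [Algebra ℂ S]
    (f : R →ₐ[ℂ] S) : ConjOp R →ₐ[ℂ] ConjOp S :=
  { (f : R →+* S).op with
    commutes' := fun z => congrArg MulOpposite.op (f.commutes (conj z)) }

/-- The free unital algebra generated by the underlying sets of `B` and `J`. -/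
def FreeStar (B : Type u) (J : Type v) : Type (max u v) := FreeAlgebra ℂ (B ⊕ J)

namespace FreeStar

variable {B : Type u} {J : Type v}

instance : Ring (FreeStar B J) := inferInstanceAs (Ring (FreeAlgebra ℂ (B ⊕ J)))

instance : Algebra ℂ (FreeStar B J) := inferInstanceAs (Algebra ℂ (FreeAlgebra ℂ (B ⊕ J)))

/-- The generator belonging to an element of `B`. -/
def left (b : B) : FreeStar B J := FreeAlgebra.ι ℂ (Sum.inl b)

/-- The generator belonging to an element of `J`. -/
def right (x : J) : FreeStar B J := FreeAlgebra.ι ℂ (Sum.inr x)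

variable [Ring B] [StarRing B] [Ring J] [StarRing J]

/-- The `*`-structure on the free algebra, as a linear homomorphism. -/
def starHom : FreeStar B J →ₐ[ℂ] ConjOp (FreeStar B J) :=
  FreeAlgebra.lift ℂ fun s => MulOpposite.op (FreeAlgebra.ι ℂ (Sum.map star star s) : FreeStar B J)

/-- The `*`-structure on the free algebra extending those of `B` and `J` on generators. -/
def starFun (a : FreeStar B J) : FreeStar B J := MulOpposite.unop (starHom a)

theorem starFun_ι (s : B ⊕ J) : starFun (FreeAlgebra.ι ℂ s : FreeStar B J) =
    FreeAlgebra.ι ℂ (Sum.map star star s) := by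
  unfold starFun starHom
  erw [FreeAlgebra.lift_ι_apply]
  rfl

theorem starFun_add (a b : FreeStar B J) : starFun (a + b) = starFun a + starFun b := by
  unfold starFun
  rw [map_add]
  rfl

theorem starFun_mul (a b : FreeStar B J) : starFun (a * b) = starFun b * starFun a := by
  unfold starFun
  rw [map_mul]
  rfl

theorem starFun_algebraMap (z : ℂ) :
    starFun (algebraMap ℂ (FreeStar B J) z) = algebraMap ℂ (FreeStar B J) (conj z) := by
  unfold starFun
  rw [AlgHom.commutes]
  rfl

theorem starFun_starFun (a : FreeStar B J) : starFun (starFun a) = a := by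
  refine FreeAlgebra.induction ℂ (B ⊕ J) (motive := fun a => starFun (starFun (a : FreeStar B J)) = a)
    ?_ ?_ ?_ ?_ a
  · intro z
    refine (congrArg starFun (starFun_algebraMap z)).trans ?_
    rw [starFun_algebraMap, Complex.conj_conj]
    rfl
  · intro s
    rw [starFun_ι, starFun_ι]
    cases s <;> simp <;> rfl
  · intro a b ha hb
    refine (congrArg starFun (starFun_mul a b)).trans ?_
    rw [starFun_mul, ha, hb]
    rfl
  · intro a b ha hb
    refine (congrArg starFun (starFun_add a b)).trans ?_
    rw [starFun_add, ha, hb]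
    rfl

instance : StarRing (FreeStar B J) where
  star := starFun
  star_involutive := starFun_starFun
  star_mul := starFun_mul
  star_add := starFun_add

theorem star_left (b : B) : star (left b : FreeStar B J) = left (star b) := starFun_ι _

theorem star_right (x : J) : star (right x : FreeStar B J) = right (star x) := starFun_ι _

instance : StarModule ℂ (FreeStar B J) where
  star_smul z a := by
    rw [Algebra.smul_def, Algebra.smul_def]
    refine (starFun_mul _ _).trans ?_
    rw [starFun_algebraMap]
    exact (Algebra.commutes _ _).symm

end FreeStar

section Double

variable (B : Type u) (J : Type v) [Ring B] [StarRing B] [Algebra ℂ B]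
  [Ring J] [StarRing J] [Algebra ℂ J]

open FreeStar in
/-- The defining relations of the double: the generators form copies of the unital algebras `B` and
`J`, subject to the interchange relation `x b = ∑ bᵢ xᵢ` whenever `Φ x b = ∑ bᵢ ⊗ xᵢ`; the relations
are closed under `*`. -/
inductive DoubleRel (Φ : J → B → B ⊗[ℂ] J) : FreeStar B J → FreeStar B J → Prop
  | left_add (b b' : B) : DoubleRel Φ (left (b + b')) (left b + left b')
  | left_smul (z : ℂ) (b : B) : DoubleRel Φ (left (z • b)) (z • left b)
  | left_mul (b b' : B) : DoubleRel Φ (left (b * b')) (left b * left b')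
  | left_one : DoubleRel Φ (left 1) 1
  | right_add (x x' : J) : DoubleRel Φ (right (x + x')) (right x + right x')
  | right_smul (z : ℂ) (x : J) : DoubleRel Φ (right (z • x)) (z • right x)
  | right_mul (x x' : J) : DoubleRel Φ (right (x * x')) (right x * right x')
  | right_one : DoubleRel Φ (right 1) 1
  | interchange (x : J) (b : B) (n : ℕ) (b' : Fin n → B) (x' : Fin n → J)
      (h : Φ x b = ∑ i, b' i ⊗ₜ[ℂ] x' i) :
      DoubleRel Φ (right x * left b) (∑ i, left (b' i) * right (x' i))
  | star (a a' : FreeStar B J) (h : DoubleRel Φ a a') : DoubleRel Φ (star a) (star a')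

variable {B J} (Φ : J → B → B ⊗[ℂ] J)

/-- The universal unital `*`-algebra generated by copies of `B` and `J` with interchange relations
`x b = Φ(x, b)`. -/
def Double (Φ : J → B → B ⊗[ℂ] J) : Type (max u v) := RingQuot (DoubleRel B J Φ)

namespace Double

instance : Ring (Double Φ) := inferInstanceAs (Ring (RingQuot (DoubleRel B J Φ)))

instance : Algebra ℂ (Double Φ) := inferInstanceAs (Algebra ℂ (RingQuot (DoubleRel B J Φ)))

/-- The quotient map from the free algebra. -/
def mk : FreeStar B J →ₐ[ℂ] Double Φ := RingQuot.mkAlgHom ℂ (DoubleRel B J Φ)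

theorem mk_surjective : Function.Surjective (mk Φ) := RingQuot.mkAlgHom_surjective _ _

theorem mk_rel {a b : FreeStar B J} (h : DoubleRel B J Φ a b) : mk Φ a = mk Φ b :=
  RingQuot.mkAlgHom_rel ℂ h

/-- The `*`-structure on the double, as a linear homomorphism. -/
def starHom : Double Φ →ₐ[ℂ] ConjOp (Double Φ) :=
  RingQuot.liftAlgHom ℂ ⟨(ConjOp.map (mk Φ)).comp FreeStar.starHom, fun _ _ h =>
    congrArg MulOpposite.op (mk_rel Φ (.star _ _ h))⟩

/-- The `*`-structure on the double. -/
def starFun (a : Double Φ) : Double Φ := MulOpposite.unop (starHom Φ a)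

theorem starFun_mk (a : FreeStar B J) : starFun Φ (mk Φ a) = mk Φ (star a) := by
  unfold starFun starHom mk
  erw [RingQuot.liftAlgHom_mkAlgHom_apply]
  rfl

instance : StarRing (Double Φ) where
  star := starFun Φ
  star_involutive a := by
    obtain ⟨a, rfl⟩ := mk_surjective Φ a
    rw [starFun_mk, starFun_mk, star_star]
  star_mul a b := by
    obtain ⟨a, rfl⟩ := mk_surjective Φ a
    obtain ⟨b, rfl⟩ := mk_surjective Φ b
    rw [← map_mul, starFun_mk, starFun_mk, starFun_mk, star_mul, map_mul]
  star_add a b := by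
    obtain ⟨a, rfl⟩ := mk_surjective Φ a
    obtain ⟨b, rfl⟩ := mk_surjective Φ b
    rw [← map_add, starFun_mk, starFun_mk, starFun_mk, star_add, map_add]

theorem star_mk (a : FreeStar B J) : star (mk Φ a) = mk Φ (star a) := starFun_mk Φ a

instance : StarModule ℂ (Double Φ) where
  star_smul z a := by
    obtain ⟨a, rfl⟩ := mk_surjective Φ a
    rw [← map_smul, star_mk, star_mk, star_smul, map_smul]

variable [StarModule ℂ B] [StarModule ℂ J]

/-- The copy of `B`. -/
def inclB : B →⋆ₐ[ℂ] Double Φ where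
  toFun b := mk Φ (FreeStar.left b)
  map_one' := (mk_rel Φ .left_one).trans (map_one _)
  map_mul' a b := (mk_rel Φ (.left_mul a b)).trans (map_mul _ _ _)
  map_zero' := by
    have h := mk_rel Φ (.left_smul 0 0)
    rwa [zero_smul, zero_smul, map_zero] at h
  map_add' a b := (mk_rel Φ (.left_add a b)).trans (map_add _ _ _)
  commutes' z := by
    rw [Algebra.algebraMap_eq_smul_one, mk_rel Φ (.left_smul z 1), map_smul, mk_rel Φ .left_one,
      map_one, Algebra.algebraMap_eq_smul_one]
  map_star' b := by rw [star_mk, FreeStar.star_left]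

/-- The copy of `J`. -/
def inclJ : J →⋆ₐ[ℂ] Double Φ where
  toFun b := mk Φ (FreeStar.right b)
  map_one' := (mk_rel Φ .right_one).trans (map_one _)
  map_mul' a b := (mk_rel Φ (.right_mul a b)).trans (map_mul _ _ _)
  map_zero' := by
    have h := mk_rel Φ (.right_smul 0 0)
    rwa [zero_smul, zero_smul, map_zero] at h
  map_add' a b := (mk_rel Φ (.right_add a b)).trans (map_add _ _ _)
  commutes' z := by
    rw [Algebra.algebraMap_eq_smul_one, mk_rel Φ (.right_smul z 1), map_smul, mk_rel Φ .right_one,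
      map_one, Algebra.algebraMap_eq_smul_one]
  map_star' b := by rw [star_mk, FreeStar.star_right]

/-- The multiplication map `B ⊗ J → Double`, `b ⊗ x ↦ b x`. -/
def mulMap : B ⊗[ℂ] J →ₗ[ℂ] Double Φ :=
  LinearMap.mul' ℂ _ ∘ₗ TensorProduct.map (inclB Φ).toAlgHom.toLinearMap
    (inclJ Φ).toAlgHom.toLinearMap

theorem mulMap_tmul (b : B) (x : J) : mulMap Φ (b ⊗ₜ x) = inclB Φ b * inclJ Φ x := rfl

theorem interchange (x : J) (b : B) : inclJ Φ x * inclB Φ b = mulMap Φ (Φ x b) := by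
  obtain ⟨n, b', x', h⟩ : ∃ (n : ℕ) (b' : Fin n → B) (x' : Fin n → J),
      Φ x b = ∑ i, b' i ⊗ₜ[ℂ] x' i := by
    obtain ⟨S, hS⟩ := TensorProduct.exists_finset (Φ x b)
    refine ⟨S.card, fun i => (S.equivFin.symm i).1.1, fun i => (S.equivFin.symm i).1.2, ?_⟩
    rw [hS, ← Finset.sum_coe_sort]
    exact (Equiv.sum_comp S.equivFin.symm (fun p : S => p.1.1 ⊗ₜ[ℂ] p.1.2)).symm
  have h1 := mk_rel Φ (.interchange x b n b' x' h)
  rw [map_mul, map_sum] at h1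
  refine h1.trans ?_
  rw [h, map_sum]
  exact Finset.sum_congr rfl fun i _ => map_mul _ _ _

end Double

end Double

section Reduced

/-- The restricted dual of a `†`-coalgebra `X`: the space of those `x` in the full dual `X°` for
which `X° x X°` is finite-dimensional. -/
def restrictedDual (X : Type u) [AddCommGroup X] [Module ℂ X] [Coalgebra ℂ X] : Set (FullDual X) :=
  {x | FiniteDimensional ℂ (Submodule.span ℂ {w | ∃ y z : FullDual X, w = y * x * z})}

variable {X : Type u} [AddCommGroup X] [Module ℂ X] [Coalgebra ℂ X]

theorem mem_restrictedDual (x : FullDual X) : x ∈ restrictedDual X ↔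
    ∃ K : Submodule ℂ (FullDual X), FiniteDimensional ℂ K ∧ ∀ y z, y * x * z ∈ K := by
  constructor
  · intro h
    exact ⟨_, h, fun y z => Submodule.subset_span ⟨y, z, rfl⟩⟩
  · rintro ⟨K, hK, h⟩
    refine Submodule.finiteDimensional_of_le (S₂ := K) (Submodule.span_le.mpr ?_)
    rintro w ⟨y, z, rfl⟩
    exact h y z

theorem restrictedDual_zero : (0 : FullDual X) ∈ restrictedDual X :=
  (mem_restrictedDual _).mpr ⟨⊥, inferInstance, fun y z => by simp⟩

theorem restrictedDual_add {x x' : FullDual X} (h : x ∈ restrictedDual X)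
    (h' : x' ∈ restrictedDual X) : x + x' ∈ restrictedDual X := by
  obtain ⟨K, hK, h⟩ := (mem_restrictedDual _).mp h
  obtain ⟨K', hK', h'⟩ := (mem_restrictedDual _).mp h'
  refine (mem_restrictedDual _).mpr ⟨K ⊔ K', inferInstance, fun y z => ?_⟩
  rw [mul_add, add_mul]
  exact Submodule.add_mem_sup (h y z) (h' y z)

theorem restrictedDual_mul_left {x : FullDual X} (y : FullDual X) (h : x ∈ restrictedDual X) :
    y * x ∈ restrictedDual X := by
  obtain ⟨K, hK, h⟩ := (mem_restrictedDual _).mp h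
  refine (mem_restrictedDual _).mpr ⟨K, hK, fun a b => ?_⟩
  rw [← mul_assoc]
  exact h _ _

theorem restrictedDual_mul_right {x : FullDual X} (y : FullDual X) (h : x ∈ restrictedDual X) :
    x * y ∈ restrictedDual X := by
  obtain ⟨K, hK, h⟩ := (mem_restrictedDual _).mp h
  refine (mem_restrictedDual _).mpr ⟨K, hK, fun a b => ?_⟩
  rw [← mul_assoc, mul_assoc _ y b]
  exact h _ _

theorem restrictedDual_smul {x : FullDual X} (z : ℂ) (h : x ∈ restrictedDual X) :
    z • x ∈ restrictedDual X := by
  rw [Algebra.smul_def]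
  exact restrictedDual_mul_left _ h

theorem restrictedDual_star [DagCoalgebra X] {x : FullDual X} (h : x ∈ restrictedDual X) :
    star x ∈ restrictedDual X := by
  obtain ⟨K, hK, h⟩ := (mem_restrictedDual _).mp h
  refine (mem_restrictedDual _).mpr
    ⟨K.map ((starLinearEquiv ℂ (A := FullDual X)) : FullDual X →ₗ⋆[ℂ] FullDual X), ?_, fun y z => ?_⟩
  · infer_instance
  · refine ⟨star z * x * star y, h _ _, ?_⟩
    simp [mul_assoc]

end Reduced

section ActStable

/-! Stability of the restricted dual of a quotient `p : A → X` of a Hopf algebra under the right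
action of `A` on the full dual. -/

variable {A : Type u} [Ring A] [Algebra ℂ A] [Coalgebra ℂ A]
  {X : Type v} [AddCommGroup X] [Module ℂ X] [Coalgebra ℂ X]

theorem ext_of_surj (p : A →ₗ[ℂ] X)
    (hps : Function.Surjective p)
    {x y : FullDual X} (h : ∀ a, x.toFun (p a) = y.toFun (p a)) : x = y :=
  FullDual.ext fun c => by
    obtain ⟨a, rfl⟩ := hps c
    exact h a

theorem act_one (p : A →ₗ[ℂ] X)
    (hps : Function.Surjective p)
    (act : FullDual X →ₗ[ℂ] A →ₗ[ℂ] FullDual X)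
    (hact : ∀ x a b, (act x a).toFun (p b) = x.toFun (p (a * b)))
    (x : FullDual X) : act x 1 = x :=
  ext_of_surj p hps fun b => by rw [hact, one_mul]

theorem act_act (p : A →ₗ[ℂ] X)
    (hps : Function.Surjective p)
    (act : FullDual X →ₗ[ℂ] A →ₗ[ℂ] FullDual X)
    (hact : ∀ x a b, (act x a).toFun (p b) = x.toFun (p (a * b)))
    (x : FullDual X) (a b : A) : act (act x a) b = act x (a * b) :=
  ext_of_surj p hps fun c => by rw [hact, hact, hact, mul_assoc]

theorem mul_act (hmul : ∀ a b : A, comul (R := ℂ) (a * b) = comul (R := ℂ) a * comul (R := ℂ) b)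
    (p : A →ₗ[ℂ] X)
    (hps : Function.Surjective p)
    (hp : ∀ a, comul (R := ℂ) (p a) = TensorProduct.map p p (comul a))
    (act : FullDual X →ₗ[ℂ] A →ₗ[ℂ] FullDual X)
    (hact : ∀ x a b, (act x a).toFun (p b) = x.toFun (p (a * b)))
    (x y : FullDual X) (a : A) :
    act (x * y) a = LinearMap.mul' ℂ _ (TensorProduct.map (act x) (act y) (comul a)) := by
  refine ext_of_surj p hps fun b => ?_
  rw [hact, FullDual.mul_apply, hp, hmul]
  have h : ∀ t : A ⊗[ℂ] A,
      LinearMap.mul' ℂ ℂ (TensorProduct.map x.toFun y.toFun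
        (TensorProduct.map p p (t * comul b))) =
      (LinearMap.mul' ℂ (FullDual X) (TensorProduct.map (act x) (act y) t)).toFun (p b) := by
    intro t
    induction t with
    | zero => simp
    | add s t hs ht => simp only [add_mul, map_add, hs, ht, LinearMap.add_apply]
    | tmul c d =>
      rw [TensorProduct.map_tmul, LinearMap.mul'_apply, FullDual.mul_apply, hp]
      generalize (comul (R := ℂ) b : A ⊗[ℂ] A) = s
      induction s with
      | zero => simp
      | add s t hs ht => simp only [mul_add, map_add, hs, ht]
      | tmul c d =>
        simp only [Algebra.TensorProduct.tmul_mul_tmul, TensorProduct.map_tmul,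
          LinearMap.mul'_apply, hact]
  exact h _

theorem mul_act_left (hmul : ∀ a b : A, comul (R := ℂ) (a * b) = comul (R := ℂ) a * comul (R := ℂ) b)
    (p : A →ₗ[ℂ] X)
    (hps : Function.Surjective p)
    (hp : ∀ a, comul (R := ℂ) (p a) = TensorProduct.map p p (comul a))
    (act : FullDual X →ₗ[ℂ] A →ₗ[ℂ] FullDual X)
    (hact : ∀ x a b, (act x a).toFun (p b) = x.toFun (p (a * b)))
    (S : A →ₗ[ℂ] A)
    (hS : ∀ a, LinearMap.mul' ℂ A (S.rTensor A (comul a)) = counit (R := ℂ) a • 1)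
    (y x : FullDual X) (a : A) :
    (TensorProduct.lift (act ∘ₗ (LinearMap.mulRight ℂ x) ∘ₗ (act y) ∘ₗ S)) (comul (R := ℂ) a) =
      y * act x a := by
  let M : A ⊗[ℂ] (A ⊗[ℂ] A) →ₗ[ℂ] FullDual X :=
    LinearMap.mul' ℂ _ ∘ₗ TensorProduct.map (act y ∘ₗ LinearMap.mul' ℂ _ ∘ₗ
      S.rTensor _) (act x) ∘ₗ (TensorProduct.assoc ℂ _ _ _).symm.toLinearMap
  have h1 : ∀ t, (TensorProduct.lift (act ∘ₗ (LinearMap.mulRight ℂ x) ∘ₗ (act y) ∘ₗ S)) t =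
      M (comul.lTensor _ t) := by
    intro t
    induction t with
    | zero => simp
    | add s t hs ht => simp only [map_add, hs, ht]
    | tmul c d =>
      rw [TensorProduct.lift.tmul, LinearMap.lTensor_tmul]
      change act (act y (S c) * x) d = _
      rw [mul_act hmul p hps hp act hact]
      generalize (comul (R := ℂ) d : A ⊗[ℂ] A) = s
      induction s with
      | zero => simp
      | add s t hs ht => simp only [map_add, TensorProduct.tmul_add, hs, ht]
      | tmul c d =>
        rw [TensorProduct.map_tmul, LinearMap.mul'_apply, act_act p hps act hact]
        rfl
  have h2 : ∀ t, M (TensorProduct.assoc ℂ _ _ _ (comul.rTensor _ t)) =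
      y * act x (TensorProduct.lid ℂ _ (counit.rTensor _ t)) := by
    intro t
    induction t with
    | zero => simp
    | add s t hs ht => simp only [map_add, mul_add, hs, ht]
    | tmul c d =>
      simp only [M, LinearMap.comp_apply, LinearEquiv.coe_coe, LinearEquiv.symm_apply_apply,
        LinearMap.rTensor_tmul, TensorProduct.map_tmul, LinearMap.mul'_apply]
      rw [hS, map_smul, act_one p hps act hact, TensorProduct.lid_tmul, map_smul, mul_smul_comm,
        smul_mul_assoc]
  rw [h1, ← coassoc_apply, h2, rTensor_counit_comul, TensorProduct.lid_tmul, one_smul]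

theorem mul_act_right (hmul : ∀ a b : A, comul (R := ℂ) (a * b) = comul (R := ℂ) a * comul (R := ℂ) b)
    (p : A →ₗ[ℂ] X)
    (hps : Function.Surjective p)
    (hp : ∀ a, comul (R := ℂ) (p a) = TensorProduct.map p p (comul a))
    (act : FullDual X →ₗ[ℂ] A →ₗ[ℂ] FullDual X)
    (hact : ∀ x a b, (act x a).toFun (p b) = x.toFun (p (a * b)))
    (S' : A →ₗ[ℂ] A)
    (hS' : ∀ a, LinearMap.mul' ℂ A (S'.rTensor A (TensorProduct.comm ℂ A A (comul a))) =
      counit (R := ℂ) a • 1)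
    (x z : FullDual X) (a : A) :
    (TensorProduct.lift (act ∘ₗ (LinearMap.mulLeft ℂ x) ∘ₗ (act z) ∘ₗ S'))
      (TensorProduct.comm ℂ _ _ (comul (R := ℂ) a)) = act x a * z := by
  let M : A ⊗[ℂ] (A ⊗[ℂ] A) →ₗ[ℂ] FullDual X :=
    LinearMap.mul' ℂ _ ∘ₗ TensorProduct.map (act x) (act z ∘ₗ LinearMap.mul' ℂ _ ∘ₗ
      S'.rTensor _ ∘ₗ (TensorProduct.comm ℂ _ _).toLinearMap)
  have h1 : ∀ t, (TensorProduct.lift (act ∘ₗ (LinearMap.mulLeft ℂ x) ∘ₗ (act z) ∘ₗ S'))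
      (TensorProduct.comm ℂ _ _ t) = M (TensorProduct.assoc ℂ _ _ _ (comul.rTensor _ t)) := by
    intro t
    induction t with
    | zero => simp
    | add s t hs ht => simp only [map_add, hs, ht]
    | tmul c d =>
      rw [TensorProduct.comm_tmul, TensorProduct.lift.tmul, LinearMap.rTensor_tmul]
      change act (x * act z (S' d)) c = _
      rw [mul_act hmul p hps hp act hact]
      generalize (comul (R := ℂ) c : A ⊗[ℂ] A) = s
      induction s with
      | zero => simp
      | add s t hs ht => simp only [map_add, TensorProduct.add_tmul, hs, ht]
      | tmul c d =>
        rw [TensorProduct.map_tmul, LinearMap.mul'_apply, act_act p hps act hact]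
        rfl
  have h2 : ∀ t, M (comul.lTensor _ t) =
      act x (TensorProduct.rid ℂ _ (counit.lTensor _ t)) * z := by
    intro t
    induction t with
    | zero => simp
    | add s t hs ht => simp only [map_add, add_mul, hs, ht]
    | tmul c d =>
      simp only [M, LinearMap.comp_apply, LinearEquiv.coe_coe,
        LinearMap.lTensor_tmul, TensorProduct.map_tmul, LinearMap.mul'_apply]
      rw [hS', map_smul, act_one p hps act hact, TensorProduct.rid_tmul, map_smul, mul_smul_comm,
        smul_mul_assoc]
  rw [h1, coassoc_apply, h2, lTensor_counit_comul, TensorProduct.rid_tmul, one_smul]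

theorem restrictedDual_act (hmul : ∀ a b : A, comul (R := ℂ) (a * b) = comul (R := ℂ) a * comul (R := ℂ) b)
    (p : A →ₗ[ℂ] X)
    (hps : Function.Surjective p)
    (hp : ∀ a, comul (R := ℂ) (p a) = TensorProduct.map p p (comul a))
    (act : FullDual X →ₗ[ℂ] A →ₗ[ℂ] FullDual X)
    (hact : ∀ x a b, (act x a).toFun (p b) = x.toFun (p (a * b)))
    (S : A →ₗ[ℂ] A)
    (S' : A →ₗ[ℂ] A)
    (hS : ∀ a, LinearMap.mul' ℂ A (S.rTensor A (comul a)) = counit (R := ℂ) a • 1)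
    (hS' : ∀ a, LinearMap.mul' ℂ A (S'.rTensor A (TensorProduct.comm ℂ A A (comul a))) =
      counit (R := ℂ) a • 1)
    {x : FullDual X} (hx : x ∈ restrictedDual X) (a : A) :
    act x a ∈ restrictedDual X := by
  obtain ⟨K, hK, h⟩ := (mem_restrictedDual _).mp hx
  obtain ⟨T, hT⟩ := TensorProduct.exists_finset (comul (R := ℂ) a)
  choose T' hT' using fun b : A => TensorProduct.exists_finset (comul (R := ℂ) b)
  refine (mem_restrictedDual _).mpr
    ⟨⨆ i : T, ⨆ j : T' i.1.1, K.map (act.flip j.1.2), inferInstance, fun y z => ?_⟩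
  rw [mul_assoc, ← mul_act_right hmul p hps hp act hact S' hS', hT, map_sum, map_sum,
    Finset.mul_sum]
  refine Submodule.sum_mem _ fun i hi => ?_
  refine Submodule.mem_iSup_of_mem ⟨i, hi⟩ ?_
  rw [TensorProduct.comm_tmul, TensorProduct.lift.tmul]
  change y * act (x * act z (S' i.2)) i.1 ∈ _
  rw [← mul_act_left hmul p hps hp act hact S hS, hT' i.1, map_sum]
  refine Submodule.sum_mem _ fun j hj => ?_
  refine Submodule.mem_iSup_of_mem ⟨j, hj⟩ ?_
  rw [TensorProduct.lift.tmul]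
  refine ⟨_, h (act y (S j.1)) (act z (S' i.2)), ?_⟩
  rw [mul_assoc]
  rfl

end ActStable

section ReducedDouble

variable {B : Type u} {J : Type v} [Ring B] [StarRing B] [Algebra ℂ B] [StarModule ℂ B]
  [Ring J] [StarRing J] [Algebra ℂ J] [StarModule ℂ J] (Φ : J → B → B ⊗[ℂ] J) (N : Set J)

/-- The linear span of the products `b x` with `b ∈ B` and `x ∈ N` in the double. -/
def prodSpan : Submodule ℂ (Double Φ) :=
  Submodule.span ℂ {d | ∃ (b : B) (x : J), x ∈ N ∧ d = Double.inclB Φ b * Double.inclJ Φ x}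

variable {N}

theorem mul_mem_prodSpan (b : B) {x : J} (hx : x ∈ N) :
    Double.inclB Φ b * Double.inclJ Φ x ∈ prodSpan Φ N :=
  Submodule.subset_span ⟨b, x, hx, rfl⟩

theorem mulMap_lTensor_mem {A : Type w} [AddCommGroup A] [Module ℂ A] (f : A →ₗ[ℂ] J)
    (hf : ∀ a, f a ∈ N) (t : B ⊗[ℂ] A) : Double.mulMap Φ (f.lTensor B t) ∈ prodSpan Φ N := by
  induction t with
  | zero => rw [map_zero, map_zero]; exact zero_mem _
  | add s t hs ht => rw [map_add, map_add]; exact add_mem hs ht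
  | tmul b a =>
    rw [LinearMap.lTensor_tmul, Double.mulMap_tmul]
    exact mul_mem_prodSpan _ _ (hf a)

theorem inclB_mul_mem (b : B) {d : Double Φ} (hd : d ∈ prodSpan Φ N) :
    Double.inclB Φ b * d ∈ prodSpan Φ N := by
  unfold prodSpan at hd
  induction hd using Submodule.span_induction with
  | zero => rw [mul_zero]; exact zero_mem _
  | add d e _ _ hd he => rw [mul_add]; exact add_mem hd he
  | smul z d _ hd => rw [mul_smul_comm]; exact Submodule.smul_mem _ _ hd
  | mem d hd =>
    obtain ⟨b', x, hx, rfl⟩ := hd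
    rw [← mul_assoc, ← map_mul]
    exact mul_mem_prodSpan Φ _ hx

theorem mul_inclJ_mem (hN : ∀ x ∈ N, ∀ y, x * y ∈ N)
    (y : J) {d : Double Φ} (hd : d ∈ prodSpan Φ N) :
    d * Double.inclJ Φ y ∈ prodSpan Φ N := by
  unfold prodSpan at hd
  induction hd using Submodule.span_induction with
  | zero => rw [zero_mul]; exact zero_mem _
  | add d e _ _ hd he => rw [add_mul]; exact add_mem hd he
  | smul z d _ hd => rw [smul_mul_assoc]; exact Submodule.smul_mem _ _ hd
  | mem d hd =>
    obtain ⟨b', x, hx, rfl⟩ := hd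
    rw [mul_assoc, ← map_mul]
    exact mul_mem_prodSpan Φ _ (hN x hx y)

theorem mul_mem_of_prodSpan (hN : ∀ x ∈ N, ∀ y, x * y ∈ N)
    (hΦ : ∀ x ∈ N, ∀ b, Double.mulMap Φ (Φ x b) ∈ prodSpan Φ N)
    {d e : Double Φ} (hd : d ∈ prodSpan Φ N) (he : e ∈ prodSpan Φ N) :
    d * e ∈ prodSpan Φ N := by
  unfold prodSpan at hd
  induction hd using Submodule.span_induction with
  | zero => rw [zero_mul]; exact zero_mem _
  | add d d' _ _ hd hd' => rw [add_mul]; exact add_mem hd hd'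
  | smul z d _ hd => rw [smul_mul_assoc]; exact Submodule.smul_mem _ _ hd
  | mem d hd =>
    obtain ⟨b, x, hx, rfl⟩ := hd
    unfold prodSpan at he
    induction he using Submodule.span_induction with
    | zero => rw [mul_zero]; exact zero_mem _
    | add d e _ _ hd he => rw [mul_add]; exact add_mem hd he
    | smul z d _ hd => rw [mul_smul_comm]; exact Submodule.smul_mem _ _ hd
    | mem e he =>
      obtain ⟨b', x', hx', rfl⟩ := he
      rw [mul_assoc, ← mul_assoc (Double.inclJ Φ x), Double.interchange]
      exact inclB_mul_mem Φ b (mul_inclJ_mem Φ hN x' (hΦ x hx b'))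

theorem star_mem_of_prodSpan (hstar : ∀ x ∈ N, star x ∈ N)
    (hΦ : ∀ x ∈ N, ∀ b, Double.mulMap Φ (Φ x b) ∈ prodSpan Φ N)
    {d : Double Φ} (hd : d ∈ prodSpan Φ N) :
    star d ∈ prodSpan Φ N := by
  unfold prodSpan at hd
  induction hd using Submodule.span_induction with
  | zero => rw [star_zero]; exact zero_mem _
  | add d d' _ _ hd hd' => rw [star_add]; exact add_mem hd hd'
  | smul z d _ hd => rw [star_smul]; exact Submodule.smul_mem _ _ hd
  | mem d hd =>
    obtain ⟨b, x, hx, rfl⟩ := hd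
    rw [star_mul, ← map_star, ← map_star, Double.interchange]
    exact hΦ _ (hstar x hx) _

/-- The span of the products `b x` with `b ∈ B` and `x ∈ N`, as a `*`-subalgebra. -/
def prodSubalgebra (hN : ∀ x ∈ N, ∀ y, x * y ∈ N)
    (hstar : ∀ x ∈ N, star x ∈ N)
    (hΦ : ∀ x ∈ N, ∀ b, Double.mulMap Φ (Φ x b) ∈ prodSpan Φ N) :
    NonUnitalStarSubalgebra ℂ (Double Φ) where
  __ := prodSpan Φ N
  mul_mem' := fun hd he => mul_mem_of_prodSpan Φ hN hΦ hd he
  star_mem' := fun hd => star_mem_of_prodSpan Φ hstar hΦ hd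

end ReducedDouble

section DoubleBI

variable {U : Type u} [Ring U] [StarRing U] [HopfAlgebra ℂ U] [StarModule ℂ U] [HopfStarAlgebra U]
variable (F : RepFamily.{u, v, w} U) (I : LeftCoideal U)

/-- The interchange map `(x, b) ↦ τ(b₍₁₎, x₍₋₁₎) b₍₀₎ ⊗ x₍₀₎`. -/
def interchangeI (x : I.carrier) (b : algB F I) : algB F I ⊗[ℂ] I.carrier :=
  ((actI I x) ∘ₗ inclLin (coeffAlgebra F)).lTensor (algB F I) (coactB F I b)

/-- The universal `*`-algebra `D(B, I)` generated by copies of `B` and `I` with interchange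
relations `x b = τ(b₍₁₎, x₍₋₁₎) b₍₀₎ x₍₀₎`. -/
abbrev DBI : Type u := Double (interchangeI F I)

/-- The copy of `B` in `D(B, I)`. -/
abbrev inB : algB F I →⋆ₐ[ℂ] DBI F I := Double.inclB _

/-- The copy of `I` in `D(B, I)`. -/
abbrev inI : I.carrier →⋆ₐ[ℂ] DBI F I := Double.inclJ _

/-- The right action `x ◁ a` of `A` on the full dual of `C`, `τ(c, x ◁ a) = τ(a c, x)`. -/
def actDual : FullDual (quotC F I) →ₗ[ℂ] coeffAlgebra F →ₗ[ℂ] FullDual (quotC F I) where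
  toFun x :=
    { toFun := fun a => FullDual.mk (x.toFun ∘ₗ actC F I a)
      map_add' := fun a b => FullDual.ext fun c => by simp
      map_smul' := fun z a => FullDual.ext fun c => by simp }
  map_add' x y := by
    ext a
    exact FullDual.ext fun c => by simp
  map_smul' z x := by
    ext a
    exact FullDual.ext fun c => by simp

theorem actDual_apply (x : FullDual (quotC F I)) (a : coeffAlgebra F) (c : quotC F I) :
    (actDual F I x a).toFun c = x.toFun (actC F I a c) := by
  simp [actDual]

theorem actDual_projC (x : FullDual (quotC F I)) (a b : coeffAlgebra F) :
    (actDual F I x a).toFun (projC F I b) = x.toFun (projC F I (a * b)) := by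
  rw [actDual_apply, actC_projC]

/-- The inverse of the antipode of `A`. -/
def antipodeInvA : coeffAlgebra F →ₗ[ℂ] coeffAlgebra F where
  toFun a := ⟨dagFun (star a.1), dagFun_mem F (star_mem a.2)⟩
  map_add' a b := Subtype.ext (FullDual.ext fun x => by simp [dagFun_apply])
  map_smul' z a := Subtype.ext (FullDual.ext fun x => by simp [dagFun_apply])

theorem evA_mul (u : U) (a b : coeffAlgebra F) : evA F u (a * b) =
    ∑ i ∈ (ℛ ℂ u).index, evA F ((ℛ ℂ u).left i) a * evA F ((ℛ ℂ u).right i) b := by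
  rw [evA_apply, MulMemClass.coe_mul, FullDual.mul_apply, ← (ℛ ℂ u).eq]
  simp [evA_apply]

/-- `S_A(a₍₁₎) a₍₂₎ = ε(a)`. -/
theorem antipodeA_mul (a : coeffAlgebra F) :
    LinearMap.mul' ℂ _ ((antipodeA F).rTensor _ (comul (R := ℂ) a)) =
      counit (R := ℂ) a • (1 : coeffAlgebra F) := by
  rw [← sub_eq_zero]
  refine (pairingA F).sep _ fun u => ?_
  rw [map_sub, sub_eq_zero]
  change evA F u _ = evA F u _
  have h : ∀ t : coeffAlgebra F ⊗[ℂ] coeffAlgebra F,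
      evA F u (LinearMap.mul' ℂ _ ((antipodeA F).rTensor _ t)) = ∑ i ∈ (ℛ ℂ u).index,
        LinearMap.mul' ℂ ℂ (TensorProduct.map (evA F (antipode ℂ ((ℛ ℂ u).left i)))
          (evA F ((ℛ ℂ u).right i)) t) := by
    intro t
    induction t with
    | zero => simp
    | add s t hs ht => simp only [map_add, hs, ht, Finset.sum_add_distrib]
    | tmul p q =>
      rw [LinearMap.rTensor_tmul, LinearMap.mul'_apply, evA_mul]
      rfl
  rw [h]
  simp only [comulA_spec]
  have h2 : ∑ i ∈ (ℛ ℂ u).index,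
      evA F (antipode ℂ ((ℛ ℂ u).left i) * (ℛ ℂ u).right i) a =
      evA F (∑ i ∈ (ℛ ℂ u).index, antipode ℂ ((ℛ ℂ u).left i) * (ℛ ℂ u).right i) a := by
    rw [map_sum, LinearMap.sum_apply]
  rw [h2, sum_antipode_mul_eq_smul, map_smul, map_smul, LinearMap.smul_apply]
  change counit (R := ℂ) u * evA F 1 a = evA F 1 a * counit (R := ℂ) u
  exact mul_comm _ _

/-- `S_A⁻¹(a₍₂₎) a₍₁₎ = ε(a)`. -/
theorem antipodeInvA_mul (a : coeffAlgebra F) :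
    LinearMap.mul' ℂ _ ((antipodeInvA F).rTensor _ (TensorProduct.comm ℂ _ _ (comul (R := ℂ) a))) =
      counit (R := ℂ) a • (1 : coeffAlgebra F) := by
  rw [← sub_eq_zero]
  refine (pairingA F).sep _ fun u => ?_
  rw [map_sub, sub_eq_zero]
  change evA F u _ = evA F u _
  have h : ∀ t : coeffAlgebra F ⊗[ℂ] coeffAlgebra F,
      evA F u (LinearMap.mul' ℂ _ ((antipodeInvA F).rTensor _ (TensorProduct.comm ℂ _ _ t))) =
        ∑ i ∈ (ℛ ℂ u).index, LinearMap.mul' ℂ ℂ (TensorProduct.map (evA F ((ℛ ℂ u).right i))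
          (evA F (dag (star ((ℛ ℂ u).left i)))) t) := by
    intro t
    induction t with
    | zero => simp
    | add s t hs ht => simp only [map_add, hs, ht, Finset.sum_add_distrib]
    | tmul p q =>
      rw [TensorProduct.comm_tmul, LinearMap.rTensor_tmul, LinearMap.mul'_apply, evA_mul]
      refine Finset.sum_congr rfl fun i _ => ?_
      rw [TensorProduct.map_tmul, LinearMap.mul'_apply, mul_comm]
      congr 1
      refine (dagFun_apply _ _).trans ?_
      rw [FullDual.star_apply, Complex.conj_conj]
      rfl
  rw [h]
  simp only [comulA_spec]
  have h2 : ∑ i ∈ (ℛ ℂ u).index,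
      evA F ((ℛ ℂ u).right i * dag (star ((ℛ ℂ u).left i))) a =
      evA F (∑ i ∈ (ℛ ℂ u).index, (ℛ ℂ u).right i * dag (star ((ℛ ℂ u).left i))) a := by
    rw [map_sum, LinearMap.sum_apply]
  have h3 : ∑ i ∈ (ℛ ℂ u).index, (ℛ ℂ u).right i * dag (star ((ℛ ℂ u).left i)) =
      counit (R := ℂ) u • (1 : U) := by
    rw [← Algebra.algebraMap_eq_smul_one, ← mul_star_antipode_star]
    conv_rhs => rw [← (ℛ ℂ u).eq]
    simp [hopfDag_apply, star_sum]
  rw [h2, h3, map_smul, map_smul, LinearMap.smul_apply]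
  change counit (R := ℂ) u * evA F 1 a = evA F 1 a * counit (R := ℂ) u
  exact mul_comm _ _

theorem restrictedDual_actDual {x : FullDual (quotC F I)} (hx : x ∈ restrictedDual (quotC F I))
    (a : coeffAlgebra F) : actDual F I x a ∈ restrictedDual (quotC F I) :=
  restrictedDual_act (comulA_mul F) (projC F I) (projC_surjective F I) (comul_projC F I)
    (actDual F I) (actDual_projC F I) (antipodeA F) (antipodeInvA F) (antipodeA_mul F)
    (antipodeInvA_mul F) hx a

/-- The interchange map `(x, b) ↦ b₍₀₎ ⊗ (x ◁ b₍₁₎)`. -/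
def fullInterchange (x : FullDual (quotC F I)) (b : algB F I) :
    algB F I ⊗[ℂ] FullDual (quotC F I) :=
  (actDual F I x).lTensor (algB F I) (coactB F I b)

/-- The unital `*`-algebra `𝒟(B, C°)` generated by `B` and the full dual `C°` of `C` with
interchange relations `x b = b₍₀₎ (x ◁ b₍₁₎)`. -/
abbrev FullDBI : Type u := Double (fullInterchange F I)

/-- The copy of `B` in the full double. -/
abbrev fullB : algB F I →⋆ₐ[ℂ] FullDBI F I := Double.inclB _

/-- The copy of the full dual of `C` in the full double. -/
abbrev fullJ : FullDual (quotC F I) →⋆ₐ[ℂ] FullDBI F I := Double.inclJ _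

theorem mulMap_act_mem {x : FullDual (quotC F I)} (hx : x ∈ restrictedDual (quotC F I))
    (b : algB F I) : Double.mulMap (fullInterchange F I) (fullInterchange F I x b) ∈
      prodSpan (fullInterchange F I) (restrictedDual (quotC F I)) :=
  mulMap_lTensor_mem (fullInterchange F I) (actDual F I x)
    (fun a => restrictedDual_actDual F I hx a) (coactB F I b)

/-- The reduced double `𝒟(B, 𝓘) = B 𝓘`, with `𝓘` the restricted dual of `C`: the linear span of
the products `b x`, as a (in general non-unital) `*`-subalgebra of the full double. -/
def reducedDouble : NonUnitalStarSubalgebra ℂ (FullDBI F I) :=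
  prodSubalgebra (fullInterchange F I) (N := restrictedDual (quotC F I))
    (fun _ hx y => restrictedDual_mul_right y hx) (fun _ hx => restrictedDual_star hx)
    (fun _ hx b => mulMap_act_mem F I hx b)

/-- The underlying type of the reduced double. -/
def RedDouble : Type u := reducedDouble F I

instance : NonUnitalRing (RedDouble F I) := inferInstanceAs (NonUnitalRing (reducedDouble F I))

instance : StarRing (RedDouble F I) := inferInstanceAs (StarRing (reducedDouble F I))

instance : Module ℂ (RedDouble F I) := inferInstanceAs (Module ℂ (reducedDouble F I))

instance : IsScalarTower ℂ (RedDouble F I) (RedDouble F I) :=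
  inferInstanceAs (IsScalarTower ℂ (reducedDouble F I) (reducedDouble F I))

instance : SMulCommClass ℂ (RedDouble F I) (RedDouble F I) :=
  inferInstanceAs (SMulCommClass ℂ (reducedDouble F I) (reducedDouble F I))

instance : StarModule ℂ (RedDouble F I) :=
  inferInstanceAs (StarModule ℂ (reducedDouble F I))

/-- The element `b x` of the reduced double. -/
def redMul (b : algB F I) (x : FullDual (quotC F I)) (hx : x ∈ restrictedDual (quotC F I)) :
    RedDouble F I := ⟨fullB F I b * fullJ F I x, mul_mem_prodSpan _ b hx⟩

end DoubleBI

/-- A unitary right comodule structure over a `†`-coalgebra `X` on a pre-Hilbert space `H`: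
a coassociative and counital coaction with
`⟨v, w₍₀₎⟩ w₍₁₎ = ⟨v₍₀₎, w⟩ v₍₁₎^†` for all `v, w`. -/
structure UnitaryComodule (X : Type u) [AddCommGroup X] [Module ℂ X] [Coalgebra ℂ X]
    [DagCoalgebra X] (H : Type v) [NormedAddCommGroup H] [InnerProductSpace ℂ H] where
  coact : H →ₗ[ℂ] H ⊗[ℂ] X
  coassoc : ∀ v, TensorProduct.assoc ℂ H X X (coact.rTensor X (coact v)) =
    (comul (R := ℂ)).lTensor H (coact v)
  counit_coact : ∀ v, TensorProduct.rid ℂ H ((counit (R := ℂ)).lTensor H (coact v)) = v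
  unitary : ∀ v w, TensorProduct.lid ℂ X ((innerₛₗ ℂ v).rTensor X (coact w)) =
    TensorProduct.lid ℂ X (TensorProduct.map ((innerₛₗ ℂ).flip w) dag (coact v))

/-- A unitary comodule is locally complete if for each finite-dimensional subcoalgebra `D ⊆ X` the
space of all `v` with `δ(v) ∈ H ⊗ D` is complete. -/
def UnitaryComodule.IsLocallyComplete {X : Type u} [AddCommGroup X] [Module ℂ X] [Coalgebra ℂ X]
    [DagCoalgebra X] {H : Type v} [NormedAddCommGroup H] [InnerProductSpace ℂ H]
    (M : UnitaryComodule X H) : Prop :=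
  ∀ D : Submodule ℂ X, FiniteDimensional ℂ D →
    (∀ c ∈ D, comul (R := ℂ) c ∈ LinearMap.range (TensorProduct.map D.subtype D.subtype)) →
    IsComplete {v : H | M.coact v ∈ LinearMap.range (D.subtype.lTensor H)}

section Modules

variable {U : Type u} [Ring U] [StarRing U] [HopfAlgebra ℂ U] [StarModule ℂ U] [HopfStarAlgebra U]
variable (F : RepFamily.{u, v, w} U) (I : LeftCoideal U)

/-- A unitary Doi-Koppinen module structure for `(A, B, C)` on a pre-Hilbert space `H`: a unitary
right `C`-comodule and a `*`-representation of `B` with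
`δ(b v) = b₍₀₎ v₍₀₎ ⊗ b₍₁₎ v₍₁₎`. -/
structure UnitaryDKModule (H : Type z) [NormedAddCommGroup H] [InnerProductSpace ℂ H] where
  comod : UnitaryComodule (quotC F I) H
  rep : StarRep (algB F I) H
  coact_rep : ∀ (b : algB F I) (v : H), comod.coact (rep b v) =
    TensorProduct.map₂ rep.hom.toLinearMap (actC F I) (coactB F I b) (comod.coact v)

variable {F I}

/-- A `*`-representation of `U` on a pre-Hilbert space is of `𝓕`-type if each cyclic submodule
`π(U) ξ` is finite-dimensional and has all its matrix coefficients in `A`. -/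
def IsFTypeU (F : RepFamily.{u, v, w} U) {G : Type z} [NormedAddCommGroup G]
    [InnerProductSpace ℂ G] (π : StarRep U G) : Prop :=
  ∀ ξ : G, FiniteDimensional ℂ (π.orbit ξ) ∧
    ∀ v ∈ π.orbit ξ, ∀ w ∈ π.orbit ξ, coeff π v w ∈ coeffAlgebra F

/-- A `*`-representation of `I` on a pre-Hilbert space is of `𝓕`-type if each cyclic submodule
`π(I) ξ` is finite-dimensional and is isomorphic to an `I`-subrepresentation of an `𝓕`-type
`*`-representation of `U`. -/
def IsFTypeI (F : RepFamily.{u, v, w} U) {I : LeftCoideal U} {H : Type z} [NormedAddCommGroup H]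
    [InnerProductSpace ℂ H] (π : StarRep I.carrier H) : Prop :=
  ∀ ξ : H, FiniteDimensional ℂ (π.orbit ξ) ∧
    ∃ (G : Type z) (_ : NormedAddCommGroup G) (_ : InnerProductSpace ℂ G) (ϑ : StarRep U G)
      (j : π.orbit ξ →ₗᵢ[ℂ] G), IsFTypeU F ϑ ∧
      ∀ (x : I.carrier) (v : π.orbit ξ), j ⟨π x v, π.mem_orbit ξ x v.2⟩ = ϑ (x : U) (j v)

variable {H : Type z} [NormedAddCommGroup H] [InnerProductSpace ℂ H]

/-- A `*`-representation of `D(B, I)` is of `𝓕`-type if the underlying representation of `I` is. -/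
def IsFType (θ : StarRep (DBI F I) H) : Prop := IsFTypeI F (θ.comp (inI F I))

/-- A `*`-representation of `D(B, I)` and a unitary Doi-Koppinen module on the same space are
associated if they have the same action of `B` and `θ(x) v = (id ⊗ τ(-, x)) δ(v)` for `x ∈ I`. -/
def IsAssociated (θ : StarRep (DBI F I) H) (M : UnitaryDKModule F I H) : Prop :=
  (∀ (b : algB F I) (v : H), M.rep b v = θ (inB F I b) v) ∧
    ∀ (x : I.carrier) (v : H), θ (inI F I x) v =
      TensorProduct.rid ℂ H ((evC F I x).lTensor H (M.comod.coact v))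

/-- A `*`-representation of `D(B, I)` is locally complete if its associated unitary Doi-Koppinen
module is. -/
def IsLocallyComplete (θ : StarRep (DBI F I) H) : Prop :=
  ∃ M : UnitaryDKModule F I H, IsAssociated θ M ∧ M.comod.IsLocallyComplete

variable {K : Type z} [NormedAddCommGroup K] [InnerProductSpace ℂ K] [CompleteSpace K]

/-- A `*`-representation of the reduced double on a Hilbert space is non-degenerate if
`π(𝒟(B, 𝓘)) K` spans a dense subspace of `K`. -/
def IsNondegenerate (π : RedDouble F I →⋆ₙₐ[ℂ] (K →L[ℂ] K)) : Prop :=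
  Dense (Submodule.span ℂ {w : K | ∃ (d : RedDouble F I) (v : K), w = π d v} : Set K)

/-- The subspace `π(𝓘) K`. -/
def core (π : RedDouble F I →⋆ₙₐ[ℂ] (K →L[ℂ] K)) : Submodule ℂ K :=
  Submodule.span ℂ {w : K | ∃ (x : FullDual (quotC F I)) (hx : x ∈ restrictedDual (quotC F I))
    (v : K), w = π (redMul F I 1 x hx) v}

/-- The isometry `j : H → K` intertwines the `*`-representation `θ` of `D(B, I)` on `H` and the
`*`-representation `π` of the reduced double on `K`: for the Doi-Koppinen module
associated to `θ`, with coaction `δ`, one has `π(b x) j(v) = j(θ(b) (id ⊗ x) δ(v))`. -/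
def Intertwines (θ : StarRep (DBI F I) H) (π : RedDouble F I →⋆ₙₐ[ℂ] (K →L[ℂ] K))
    (j : H →ₗᵢ[ℂ] K) : Prop :=
  ∃ M : UnitaryDKModule F I H, IsAssociated θ M ∧
    ∀ (b : algB F I) (x : FullDual (quotC F I)) (hx : x ∈ restrictedDual (quotC F I)) (v : H),
      π (redMul F I b x hx) (j v) =
        j (θ (inB F I b) (TensorProduct.rid ℂ H (x.toFun.lTensor H (M.comod.coact v))))

variable (F I)

/-- A locally complete `𝓕`-type `*`-representation of `D(B, I)` on a pre-Hilbert space. -/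
structure LocCompleteRep where
  space : Type z
  [normed : NormedAddCommGroup space]
  [inner : InnerProductSpace ℂ space]
  rep : StarRep (DBI F I) space
  isFType : IsFType rep
  isLocallyComplete : IsLocallyComplete rep

/-- A non-degenerate `*`-representation of the reduced double on a Hilbert space. -/
structure NondegRep where
  space : Type z
  [normed : NormedAddCommGroup space]
  [inner : InnerProductSpace ℂ space]
  [complete : CompleteSpace space]
  rep : RedDouble F I →⋆ₙₐ[ℂ] (space →L[ℂ] space)
  nondegenerate : IsNondegenerate rep

attribute [instance] LocCompleteRep.normed LocCompleteRep.inner NondegRep.normed NondegRep.inner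
  NondegRep.complete

/-- Unitary equivalence of `*`-representations of `D(B, I)`. -/
instance LocCompleteRep.setoid : Setoid (LocCompleteRep.{u, v, w, z} F I) where
  r V V' := ∃ e : V.space ≃ₗᵢ[ℂ] V'.space, ∀ d v, e (V.rep d v) = V'.rep d (e v)
  iseqv :=
    { refl := fun V => ⟨LinearIsometryEquiv.refl ℂ _, fun d v => rfl⟩
      symm := fun {V V'} ⟨e, he⟩ => ⟨e.symm, fun d v => by
        apply e.injective
        rw [he, e.apply_symm_apply, e.apply_symm_apply]⟩
      trans := fun {V V' V''} ⟨e, he⟩ ⟨e', he'⟩ => ⟨e.trans e', fun d v =>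
        (congrArg e' (he d v)).trans (he' d (e v))⟩ }

/-- Unitary equivalence of `*`-representations of the reduced double. -/
instance NondegRep.setoid : Setoid (NondegRep.{u, v, w, z} F I) where
  r W W' := ∃ e : W.space ≃ₗᵢ[ℂ] W'.space, ∀ d v, e (W.rep d v) = W'.rep d (e v)
  iseqv :=
    { refl := fun W => ⟨LinearIsometryEquiv.refl ℂ _, fun d v => rfl⟩
      symm := fun {W W'} ⟨e, he⟩ => ⟨e.symm, fun d v => by
        apply e.injective
        rw [he, e.apply_symm_apply, e.apply_symm_apply]⟩
      trans := fun {W W' W''} ⟨e, he⟩ ⟨e', he'⟩ => ⟨e.trans e', fun d v =>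
        (congrArg e' (he d v)).trans (he' d (e v))⟩ }

end Modules

end DrinfeldCoideal

end

open DrinfeldCoideal

/-! A `C`-comodule is a module over the full dual of `C` by `x v = v₍₀₎ x(v₍₁₎)`. Conversely, an
action of the full dual comes from a coaction as soon as each orbit map `x ↦ x v` only depends on
the restriction of `x` to some finite-dimensional subspace of `C`. Since `I` separates the points of
`C`, the action of `I` alone determines the coaction, and the interchange relation of `D(B, I)` is
the Doi–Koppinen condition seen through the slices `id ⊗ τ(-, x)`. This gives the associated module
and its uniqueness.

The core of the argument is a supply of central projections in `𝓘`. Conjugating the contragredient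
of an `S²`-compatible representation by the square root of `T` gives a `*`-representation, so `A` is
spanned by the entries of finite-dimensional `*`-representations of `U` (`coeffAlgebra_le_span`).
Therefore `C` is a semisimple `I`-module (`exists_equivariant_projection`). If `D ⊆ C` is the
subcoalgebra of coefficients of one such representation and `P` is an equivariant projection of `C`
onto `D`, then `p = ε ∘ P` satisfies `p z = z ∘ P`; it is a central self-adjoint idempotent lying in
`𝓘` (`exists_isSupport`). These `p` are local units for `𝓘`, for the reduced double and for each
vector of a comodule.

From `D(B, I)` to the reduced double one needs bounded operators. For `x ∈ 𝓘`, a nonzero polynomial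
annihilates `x^* x`, which bounds its eigenvalues on all cyclic subspaces at once
(`StarRep.isBdd_of_finiteDimensional`). For `b ∈ B`, `b` is a combination of elements `bᵢ ∈ B` with
`∑ bᵢ bᵢ^*` a scalar (`isBdd_algB`). The action then extends to the completion.

In the other direction the reduced double is a two-sided ideal in the full double, so each `z` of
the full double acts on the core by `π(d)(z v) = π(d z) v` (`coreRep`). Restricting to `D(B, I)`
gives a representation with coefficients in `C`; a polar decomposition embeds its cyclic subspaces
isometrically into representations of `U`, so it is of `𝓕`-type (`isFTypeI_of_slice`).

The two passages are inverse because a vector `π(x) k` of the core is fixed by some `π(p)`.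
Approximating it from the dense subspace and applying `π(p)` stays inside one complete subspace
belonging to a subcoalgebra, so the limit was in the subspace already (`Intertwines.range_eq_core`).
-/

noncomputable section

namespace DrinfeldCoideal

open DagCoalgebra

/-! ### `A` is spanned by entries of finite-dimensional `*`-representations -/

section MatrixReps

variable {U : Type u} [Ring U] [StarRing U] [HopfAlgebra ℂ U] [StarModule ℂ U] [HopfStarAlgebra U]

open scoped Classical in
/-- The functionals `u i j` are the entries of a matrix `*`-representation of `U`. -/
structure IsMatrixRep {ι : Type z} [Fintype ι] (u : ι → ι → FullDual U) : Prop where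
  mul : ∀ i j x y, (u i j).toFun (x * y) = ∑ k, (u i k).toFun x * (u k j).toFun y
  one : ∀ i j, (u i j).toFun 1 = if i = j then 1 else 0
  star : ∀ i j x, (u i j).toFun (star x) = conj ((u j i).toFun x)

theorem IsMatrixRep.counit : IsMatrixRep (U := U) (ι := PUnit.{z+1}) (fun _ _ => 1) where
  mul _ _ x y := by simp [FullDual.one_apply]
  one _ _ := by simp [FullDual.one_apply]
  star _ _ x := by simp [FullDual.one_apply, counit_star]

/-- The convolution product evaluates through `Δ`, so products of entries are the entries of the
tensor product of the two representations. It respects `*` because `Δ` does. -/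
theorem IsMatrixRep.kronecker {ι κ : Type z} [Fintype ι] [Fintype κ] {u : ι → ι → FullDual U}
    {v : κ → κ → FullDual U} (hu : IsMatrixRep u) (hv : IsMatrixRep v) :
    IsMatrixRep (ι := ι × κ) (fun p q => u p.1 q.1 * v p.2 q.2) where
  mul i j x y := by
    rw [mul_apply_mul]
    simp only [hu.mul, hv.mul, Finset.sum_mul_sum, Fintype.sum_prod_type]
    have h : ∀ (f g : FullDual U) (x : U), (f * g).toFun x =
        ∑ i ∈ (ℛ ℂ x).index, f.toFun ((ℛ ℂ x).left i) * g.toFun ((ℛ ℂ x).right i) := by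
      intro f g x
      rw [FullDual.mul_apply]
      conv_lhs => rw [← (ℛ ℂ x).eq]
      simp
    simp only [h, Finset.sum_mul_sum]
    have h2 : ∀ {α β : Type u} (A : Finset α) (B : Finset β) (f : α → β → ι → κ → ℂ),
        ∑ a ∈ A, ∑ b ∈ B, ∑ k, ∑ l, f a b k l = ∑ k, ∑ l, ∑ a ∈ A, ∑ b ∈ B, f a b k l := by
      intro α β A B f
      have h3 : ∀ {γ : Type u} (D : Finset γ) (g : γ → ι → κ → ℂ),
          ∑ b ∈ D, ∑ k, ∑ l, g b k l = ∑ k, ∑ l, ∑ b ∈ D, g b k l := fun D g => by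
        rw [Finset.sum_comm]
        exact Finset.sum_congr rfl fun k _ => Finset.sum_comm
      simp only [h3]
    rw [h2]
    refine Finset.sum_congr rfl fun k _ => Finset.sum_congr rfl fun l _ => ?_
    exact Finset.sum_congr rfl fun a _ => Finset.sum_congr rfl fun b _ => by ring
  one i j := by
    rw [FullDual.mul_apply, Bialgebra.comul_one, Algebra.TensorProduct.one_def]
    simp only [TensorProduct.map_tmul, LinearMap.mul'_apply, hu.one, hv.one, Prod.ext_iff]
    by_cases h1 : i.1 = j.1 <;> by_cases h2 : i.2 = j.2 <;> simp [h1, h2, Prod.ext_iff]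
  star i j x := by
    rw [FullDual.mul_apply, FullDual.mul_apply, HopfStarAlgebra.comul_star]
    generalize (comul (R := ℂ) x : U ⊗[ℂ] U) = t
    induction t with
    | zero => simp
    | add a b ha hb => simp only [star_add, map_add, ha, hb]
    | tmul a b => simp [hu.star, hv.star]

theorem isMatrixRep_coeff {H : Type w} [NormedAddCommGroup H] [InnerProductSpace ℂ H]
    [FiniteDimensional ℂ H] (π : StarRep U H) {ι : Type z} [Fintype ι]
    (b : OrthonormalBasis ι ℂ H) : IsMatrixRep (fun i j => coeff π (b i) (b j)) where
  mul i j x y := by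
    simp only [coeff_apply]
    rw [map_mul, Module.End.mul_apply, π.inner_hom x, ← b.sum_inner_mul_inner]
    simp [π.inner_hom x]
  one i j := by
    classical
    simp only [coeff_apply]
    rw [map_one, Module.End.one_apply, orthonormal_iff_ite.mp b.orthonormal]
  star i j x := by
    simp only [coeff_apply]
    rw [π.inner_hom, star_star, inner_conj_symm]

variable (F : RepFamily.{u, v, w} U)

/-- The functionals which are entries of matrix `*`-representations of `U` with entries in `A`. -/
def matrixEntries : Set (FullDual U) :=
  {f | ∃ (ι : Type z) (_ : Fintype ι) (u : ι → ι → FullDual U) (i j : ι), IsMatrixRep u ∧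
    (∀ k l, u k l ∈ coeffAlgebra F) ∧ f = u i j}

/-- A positive invertible operator on a finite-dimensional Hilbert space has an invertible symmetric
square root, which commutes with everything which commutes with the operator. -/
theorem exists_sqrt {H : Type w} [NormedAddCommGroup H] [InnerProductSpace ℂ H]
    [FiniteDimensional ℂ H] (T : (Module.End ℂ H)ˣ) (hT : (T : Module.End ℂ H).IsPositive) :
    ∃ s : (Module.End ℂ H)ˣ, (s : Module.End ℂ H).IsSymmetric ∧ s * s = T ∧
      ∀ X : Module.End ℂ H, Commute X T → Commute X s := by
  have : CompleteSpace H := FiniteDimensional.complete ℂ H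
  let e := Module.End.toContinuousLinearMap (𝕜 := ℂ) H
  have he : 0 ≤ e T := (ContinuousLinearMap.nonneg_iff_isPositive _).mpr
    ((LinearMap.isPositive_toContinuousLinearMap_iff _).mpr hT)
  have hu : IsUnit (CFC.sqrt (e T)) := (CFC.isUnit_sqrt_iff _ he).mpr (T.isUnit.map e)
  have hs : IsUnit (e.symm (CFC.sqrt (e T))) := hu.map e.symm
  refine ⟨hs.unit, ?_, ?_, ?_⟩
  · exact ((ContinuousLinearMap.nonneg_iff_isPositive _).mp (CFC.sqrt_nonneg (e T))).isSymmetric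
  · ext1
    rw [Units.val_mul, IsUnit.unit_spec, ← map_mul, CFC.sqrt_mul_sqrt_self _ he]
    exact e.symm_apply_apply _
  · intro X hX
    -- The square root is given by the continuous functional calculus of `T`, which preserves
    -- commutation.
    have h1 : Commute (CFC.sqrt (e T)) (e X) := by
      rw [CFC.sqrt_eq_cfc]
      exact (hX.symm.map e).cfc_nnreal _
    have h2 := (h1.map e.symm).symm
    rwa [show e.symm (e X) = X from e.symm_apply_apply X] at h2

/-- The contragredient of an `S²`-compatible representation is equivalent to a
`*`-representation. -/
theorem exists_isMatrixRep_star {H : Type w} [NormedAddCommGroup H] [InnerProductSpace ℂ H]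
    [FiniteDimensional ℂ H] (π : StarRep U H) (hπ : IsSqAntipodeCompatible π)
    {ι : Type z} [Fintype ι] [DecidableEq ι] (b : OrthonormalBasis ι ℂ H) :
    ∃ (u : ι → ι → FullDual U) (c d : Matrix ι ι ℂ), IsMatrixRep u ∧
      (∀ i j, u i j = ∑ k, ∑ l, (d j k * c l i) • star (coeff π (b l) (b k))) ∧
      ∀ i j, star (coeff π (b i) (b j)) = ∑ k, ∑ l, (c j k * d l i) • u l k := by
  obtain ⟨T, hT, hπ⟩ := hπ
  obtain ⟨s, hs, hsT, -⟩ := exists_sqrt T hT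
  have hs' : (↑s⁻¹ : Module.End ℂ H).IsSymmetric := by
    intro x y
    have h := hs ((↑s⁻¹ : Module.End ℂ H) x) ((↑s⁻¹ : Module.End ℂ H) y)
    rw [← Module.End.mul_apply, ← Module.End.mul_apply, Units.mul_inv] at h
    exact h.symm
  -- The map `x ↦ π(S(x))` is antimultiplicative and need not respect adjoints. Conjugation by the
  -- root of `T` repairs the second defect, and the transposed indices in `u` repair the first.
  let X : U → Module.End ℂ H := fun x => ↑s⁻¹ * π (antipode ℂ x) * s
  let u : ι → ι → FullDual U := fun i j => FullDual.mk
    { toFun := fun x => ⟪b j, X x (b i)⟫_ℂ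
      map_add' := fun x y => by simp [X, mul_add, add_mul]
      map_smul' := fun z x => by simp [X] }
  have hu : ∀ i j x, (u i j).toFun x = ⟪b j, X x (b i)⟫_ℂ := fun i j x => by
    simp only [u, FullDual.toFun_mk]
    rfl
  have hX : ∀ (P Q R : Module.End ℂ H) i j, ⟪b j, (P * Q * R) (b i)⟫_ℂ =
      ∑ k, ∑ l, ⟪b j, P (b k)⟫_ℂ * ⟪b l, R (b i)⟫_ℂ * ⟪b k, Q (b l)⟫_ℂ := by
    intro P Q R i j
    rw [Finset.sum_comm]
    conv_lhs => rw [Module.End.mul_apply, ← b.sum_repr' (R (b i)), map_sum, inner_sum]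
    refine Finset.sum_congr rfl fun l _ => ?_
    rw [map_smul, inner_smul_right, Module.End.mul_apply]
    conv_lhs => rw [← b.sum_repr' (Q (b l)), map_sum, inner_sum, Finset.mul_sum]
    exact Finset.sum_congr rfl fun k _ => by rw [map_smul, inner_smul_right]; ring
  have hstar : ∀ i j x, (star (coeff π (b i) (b j))).toFun x = ⟪b j, π (antipode ℂ x) (b i)⟫_ℂ := by
    intro i j x
    rw [FullDual.star_apply, coeff_apply, inner_conj_symm, hopfDag_apply, ← π.inner_hom]
  refine ⟨u, fun i j => ⟪b i, (s : Module.End ℂ H) (b j)⟫_ℂ,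
    fun i j => ⟪b i, (↑s⁻¹ : Module.End ℂ H) (b j)⟫_ℂ, ⟨?_, ?_, ?_⟩, ?_, ?_⟩
  · intro i j x y
    have h : X (x * y) = X y * X x := by
      simp only [X, antipode_mul_antidistrib, map_mul]
      simp only [mul_assoc, Units.mul_inv_cancel_left]
    simp only [hu, h]
    rw [Module.End.mul_apply]
    conv_lhs => rw [← b.sum_repr' (X x (b i)), map_sum, inner_sum]
    exact Finset.sum_congr rfl fun k _ => by rw [map_smul, inner_smul_right]
  · intro i j
    rw [hu]
    simp [X, orthonormal_iff_ite.mp b.orthonormal, eq_comm]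
  · intro i j x
    -- From `S(S(x)^*) = x^*`, compatibility gives `π(S(x^*)) = T π(S(x)^*) T⁻¹`. One factor `s` is
    -- absorbed on each side, and the result is the adjoint of `X x` because `s` is symmetric.
    have h : X (star x) = s * π (star (antipode ℂ x)) * ↑s⁻¹ := by
      have h1 := hπ (star (antipode ℂ x))
      have h2 := antipode_star_antipode_star (star x)
      rw [star_star] at h2
      rw [h2, ← hsT] at h1
      simp only [X, h1]
      simp [mul_assoc]
    rw [hu, hu, h, inner_conj_symm, Module.End.mul_apply, Module.End.mul_apply, ← hs,
      π.inner_hom, star_star, ← hs']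
    rfl
  · intro i j
    refine FullDual.ext fun x => ?_
    simp only [map_sum, map_smul, LinearMap.sum_apply, LinearMap.smul_apply, hstar, smul_eq_mul,
      hu, X, hX]
  · intro i j
    refine FullDual.ext fun x => ?_
    have h : π (antipode ℂ x) = s * X x * ↑s⁻¹ := by
      simp [X, mul_assoc]
    simp only [map_sum, map_smul, LinearMap.sum_apply, LinearMap.smul_apply, hstar, smul_eq_mul,
      hu]
    rw [h, hX]

/-- The span of the entries contains the generating coefficients, contains their stars by the
square-root argument, and is closed under products by tensoring. This replaces arbitrary elements of
`A` by coefficients of honest Hilbert space representations. -/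
theorem coeffAlgebra_le_span : (coeffAlgebra F).toSubalgebra.toSubmodule ≤
    Submodule.span ℂ (matrixEntries.{u, v, w, z} F) := by
  set N := Submodule.span ℂ (matrixEntries.{u, v, w, z} F)
  have hone : (1 : FullDual U) ∈ N := Submodule.subset_span
    ⟨PUnit, inferInstance, fun _ _ => 1, ⟨⟩, ⟨⟩, .counit, fun _ _ => one_mem _, rfl⟩
  have hmul : ∀ f ∈ N, ∀ g ∈ N, f * g ∈ N := by
    intro f hf g hg
    have := Submodule.mul_mem_mul hf hg
    rw [Submodule.span_mul_span] at this
    refine Submodule.span_mono ?_ this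
    rintro _ ⟨_, ⟨ι, _, u, i, j, hu, hu', rfl⟩, _, ⟨κ, _, v, k, l, hv, hv', rfl⟩, rfl⟩
    exact ⟨ι × κ, inferInstance, _, (i, k), (j, l), hu.kronecker hv,
      fun p q => mul_mem (hu' _ _) (hv' _ _), rfl⟩
  have hgen : ∀ (i : F.index) (ξ η : F.space i), coeff (F.rep i) ξ η ∈ N ∧
      star (coeff (F.rep i) ξ η) ∈ N := by
    intro i ξ η
    -- `Equiv.ulift` only moves the index set into the universe required by `matrixEntries`.
    let b := (stdOrthonormalBasis ℂ (F.space i)).reindex Equiv.ulift.{z}.symm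
    have hA : ∀ v w, coeff (F.rep i) v w ∈ coeffAlgebra F := fun v w =>
      StarAlgebra.subset_adjoin ℂ _ ⟨i, v, w, rfl⟩
    have hb : ∀ k l, coeff (F.rep i) (b k) (b l) ∈ N := fun k l => Submodule.subset_span
      ⟨_, inferInstance, _, k, l, isMatrixRep_coeff (F.rep i) b, fun _ _ => hA _ _, rfl⟩
    have hb' : ∀ k l, star (coeff (F.rep i) (b k) (b l)) ∈ N := by
      intro k l
      obtain ⟨u, c, d, hu, hu', h⟩ := exists_isMatrixRep_star (F.rep i) (F.compat i) b
      rw [h]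
      refine sum_mem fun m _ => sum_mem fun n _ => Submodule.smul_mem _ _ (Submodule.subset_span
        ⟨_, inferInstance, _, n, m, hu, fun p q => ?_, rfl⟩)
      rw [hu']
      exact sum_mem fun m _ => sum_mem fun n _ => SMulMemClass.smul_mem _ (star_mem (hA _ _))
    have h1 : coeff (F.rep i) ξ η = ∑ k, ∑ l, (⟪ξ, b k⟫_ℂ * ⟪b l, η⟫_ℂ) •
        coeff (F.rep i) (b k) (b l) := by
      refine FullDual.ext fun x => ?_
      simp only [map_sum, map_smul, LinearMap.sum_apply, LinearMap.smul_apply, coeff_apply,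
        smul_eq_mul]
      rw [Finset.sum_comm]
      have h2 : ∀ l, ∑ k, ⟪ξ, b k⟫_ℂ * ⟪b l, η⟫_ℂ * ⟪b k, F.rep i x (b l)⟫_ℂ =
          ⟪b l, η⟫_ℂ * ⟪ξ, F.rep i x (b l)⟫_ℂ := by
        intro l
        rw [← b.sum_inner_mul_inner ξ, Finset.mul_sum]
        exact Finset.sum_congr rfl fun k _ => by ring
      simp only [h2]
      conv_lhs => rw [← b.sum_repr' η, map_sum, inner_sum]
      exact Finset.sum_congr rfl fun l _ => by rw [map_smul, inner_smul_right]
    rw [h1]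
    simp only [star_sum, star_smul]
    exact ⟨sum_mem fun m _ => sum_mem fun n _ => Submodule.smul_mem _ _ (hb _ _),
      sum_mem fun m _ => sum_mem fun n _ => Submodule.smul_mem _ _ (hb' _ _)⟩
  intro f hf
  change f ∈ StarAlgebra.adjoin ℂ _ at hf
  -- The `*`-algebra generated by a set is the algebra generated by the set and its stars, so
  -- closure of the span under `*` need not be checked.
  rw [← StarSubalgebra.mem_toSubalgebra, StarAlgebra.adjoin_toSubalgebra] at hf
  induction hf using Algebra.adjoin_induction with
  | mem f hf =>
    rcases hf with ⟨i, ξ, η, rfl⟩ | ⟨i, ξ, η, h⟩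
    · exact (hgen i ξ η).1
    · rw [← star_star f, h]
      exact (hgen i ξ η).2
  | algebraMap r =>
    rw [Algebra.algebraMap_eq_smul_one]
    exact N.smul_mem _ hone
  | add f g _ _ hf hg => exact N.add_mem hf hg
  | mul f g _ _ hf hg => exact hmul f hf g hg

end MatrixReps

/-! ### Direct sums: several elements of `A` as coefficients of one representation -/

section DirectSums

variable {U : Type u} [Ring U] [StarRing U] [HopfAlgebra ℂ U] [StarModule ℂ U] [HopfStarAlgebra U]

theorem IsMatrixRep.sum {ι κ : Type z} [Fintype ι] [Fintype κ] {u : ι → ι → FullDual U}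
    {v : κ → κ → FullDual U} (hu : IsMatrixRep u) (hv : IsMatrixRep v) :
    IsMatrixRep (ι := ι ⊕ κ) (fun p q => Sum.elim (fun i => Sum.elim (u i) (fun _ => 0) q)
      (fun k => Sum.elim (fun _ => 0) (v k) q) p) where
  mul i j x y := by
    rcases i with i | i <;> rcases j with j | j <;> simp [hu.mul, hv.mul]
  one i j := by
    rcases i with i | i <;> rcases j with j | j
    · by_cases h : i = j
      · subst h; simp [hu.one]
      · simp [hu.one, h]
    · simp
    · simp
    · by_cases h : i = j
      · subst h; simp [hv.one]
      · simp [hv.one, h]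
  star i j x := by
    rcases i with i | i <;> rcases j with j | j <;> simp [hu.star, hv.star]

/-- The `*`-representation on the standard Hilbert space given by a matrix representation. -/
def IsMatrixRep.rep {ι : Type z} [Fintype ι] {u : ι → ι → FullDual U} (hu : IsMatrixRep u) :
    StarRep U (EuclideanSpace ℂ ι) := by
  classical
  exact
  { hom :=
      (LinearMap.toMatrixOrthonormal (EuclideanSpace.basisFun ι ℂ)).symm.toAlgEquiv.toAlgHom.comp
      (AlgHom.ofLinearMap
        { toFun := fun x => Matrix.of fun i j => (u i j).toFun x
          map_add' := fun x y => by ext i j; simp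
          map_smul' := fun c x => by ext i j; simp }
        (by ext i j; simp [hu.one, Matrix.one_apply])
        (fun x y => by ext i j; simp [hu.mul, Matrix.mul_apply]))
    inner_hom := fun x v w => by
      rw [← LinearMap.adjoint_inner_left]
      congr 2
      rw [← LinearMap.star_eq_adjoint]
      simp only [AlgHom.comp_apply]
      refine (map_star
        (LinearMap.toMatrixOrthonormal (EuclideanSpace.basisFun ι ℂ)).symm _).symm.trans ?_
      refine congrArg (LinearMap.toMatrixOrthonormal (EuclideanSpace.basisFun ι ℂ)).symm ?_
      ext i j
      simp [hu.star] }

theorem IsMatrixRep.coeff_rep {ι : Type z} [Fintype ι] {u : ι → ι → FullDual U}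
    (hu : IsMatrixRep u) (ξ η : EuclideanSpace ℂ ι) :
    coeff hu.rep ξ η = ∑ i, ∑ j, (conj (ξ i) * η j) • u i j := by
  classical
  refine FullDual.ext fun x => ?_
  rw [coeff_apply]
  have h : ∀ i, (hu.rep x η) i = ∑ j, (u i j).toFun x * η j := by
    intro i
    have h1 : LinearMap.toMatrixOrthonormal (EuclideanSpace.basisFun ι ℂ) (hu.rep x) =
      Matrix.of fun i j => (u i j).toFun x :=
      (LinearMap.toMatrixOrthonormal (EuclideanSpace.basisFun ι ℂ)).apply_symm_apply _
    have h2 : ∀ i j, (hu.rep x (EuclideanSpace.basisFun ι ℂ j)) i = (u i j).toFun x := by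
      intro i j
      have := congrFun (congrFun h1 i) j
      rw [LinearMap.toMatrixOrthonormal_apply_apply] at this
      simpa [EuclideanSpace.inner_single_left] using this
    conv_lhs => rw [← (EuclideanSpace.basisFun ι ℂ).sum_repr η, map_sum]
    simp only [map_smul, WithLp.ofLp_sum, Finset.sum_apply, PiLp.smul_apply, h2, smul_eq_mul]
    exact Finset.sum_congr rfl fun j _ => by simp [mul_comm]
  simp only [PiLp.inner_apply, h, map_sum, map_smul, LinearMap.sum_apply, LinearMap.smul_apply,
    smul_eq_mul, RCLike.inner_apply, Finset.sum_mul]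
  exact Finset.sum_congr rfl fun j _ => Finset.sum_congr rfl fun k _ => by ring

variable (F : RepFamily.{u, v, w} U)

/-- Take the direct sum of the representations concerned. The column vector `ζ` collects one unit
vector per added block, the `l`-th one for an entry `v k l`, so each entry is read off from one row
against the same `ζ`. Sharing `ζ` is what keeps linear combinations of such functionals single
coefficients. -/
theorem exists_isMatrixRep_of_finite (t : Finset (FullDual U))
    (ht : ↑t ⊆ matrixEntries.{u, v, w, z} F) :
    ∃ (ι : Type z) (_ : Fintype ι) (u : ι → ι → FullDual U) (ζ : ι → ℂ), IsMatrixRep u ∧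
    (∀ k l, u k l ∈ coeffAlgebra F) ∧ ∀ f ∈ t, ∃ i, f = ∑ j, ζ j • u i j := by
  classical
  induction t using Finset.induction_on with
  | empty => exact ⟨PUnit, inferInstance, _, 0, .counit, fun _ _ => one_mem _, by simp⟩
  | insert f t _ h =>
    rw [Finset.coe_insert, Set.insert_subset_iff] at ht
    obtain ⟨ι, _, u, ζ, hu, hA, h⟩ := h ht.2
    obtain ⟨κ, _, v, k, l, hv, hA', rfl⟩ := ht.1
    refine ⟨ι ⊕ κ, inferInstance, _, Sum.elim ζ (Pi.single l 1), hu.sum hv, ?_, ?_⟩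
    · rintro (p | p) (q | q)
      · exact hA _ _
      · exact zero_mem _
      · exact zero_mem _
      · exact hA' _ _
    · intro g hg
      rcases Finset.mem_insert.mp hg with rfl | hg
      · refine ⟨Sum.inr k, ?_⟩
        simp [Pi.single_apply]
      · obtain ⟨i, rfl⟩ := h g hg
        exact ⟨Sum.inl i, by simp⟩

/-- Finitely many elements of `A` are matrix coefficients of one finite-dimensional
`*`-representation of `U`, with a common second vector. -/
theorem exists_rep_of_finite (t : Set (coeffAlgebra F)) (ht : t.Finite) :
    ∃ (G : Type z) (_ : NormedAddCommGroup G) (_ : InnerProductSpace ℂ G)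
      (_ : FiniteDimensional ℂ G) (ϑ : StarRep U G) (ζ : G),
      (∀ ξ η, coeff ϑ ξ η ∈ coeffAlgebra F) ∧ ∀ a ∈ t, ∃ ξ, (a : FullDual U) = coeff ϑ ξ ζ := by
  classical
  have h : ∀ a : coeffAlgebra F, ∃ s : Finset (FullDual U), ↑s ⊆ matrixEntries.{u, v, w, z} F ∧
      (a : FullDual U) ∈ Submodule.span ℂ (s : Set (FullDual U)) := fun a =>
    Submodule.mem_span_finite_of_mem_span (coeffAlgebra_le_span F a.2)
  choose s hs has using h
  obtain ⟨ι, _, u, ζ, hu, hA, h⟩ := exists_isMatrixRep_of_finite F (ht.toFinset.biUnion s)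
    (fun f hf => by
      obtain ⟨a, -, hf⟩ := Finset.mem_biUnion.mp hf
      exact hs a hf)
  refine ⟨EuclideanSpace ℂ ι, inferInstance, inferInstance, inferInstance, hu.rep,
    WithLp.toLp 2 ζ, fun ξ η => ?_, fun a ha => ?_⟩
  · rw [hu.coeff_rep]
    exact sum_mem fun m _ => sum_mem fun n _ => SMulMemClass.smul_mem _ (hA _ _)
  -- For fixed `ζ`, the coefficients `coeff hu.rep ξ ζ` depend conjugate-linearly on `ξ` and so
  -- already form a subspace.
  · have : ∀ f ∈ Submodule.span ℂ (s a : Set (FullDual U)), ∃ ξ,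
        f = coeff hu.rep ξ (WithLp.toLp 2 ζ) := by
      intro f hf
      induction hf using Submodule.span_induction with
      | mem f hf =>
        obtain ⟨i, rfl⟩ := h f (Finset.mem_biUnion.mpr ⟨a, ht.mem_toFinset.mpr ha, hf⟩)
        refine ⟨EuclideanSpace.single i 1, ?_⟩
        rw [hu.coeff_rep]
        refine ((Fintype.sum_eq_single i fun j hj => ?_).trans ?_).symm <;> simp
        simp [hj]
      | zero => exact ⟨0, by simp [hu.coeff_rep]⟩
      | add f g _ _ hf hg =>
        obtain ⟨ξ, rfl⟩ := hf
        obtain ⟨η, rfl⟩ := hg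
        exact ⟨ξ + η, by simp [hu.coeff_rep, add_mul, add_smul, Finset.sum_add_distrib]⟩
      | smul c f _ hf =>
        obtain ⟨ξ, rfl⟩ := hf
        exact ⟨conj c • ξ, by simp [hu.coeff_rep, Finset.smul_sum, mul_assoc, smul_smul]⟩
    exact this _ (has a)

end DirectSums

/-! ### Semisimplicity and equivariant projections -/

section Semisimple

/-- A module spanned by images of finite-dimensional `*`-representations is semisimple: invariant
subspaces are ranges of equivariant projections. -/
theorem exists_equivariant_projection {R : Type u} [Ring R] [StarRing R] [Algebra ℂ R]
    {P : Type v} [AddCommGroup P] [Module ℂ P] (act : R →ₐ[ℂ] Module.End ℂ P)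
    (hP : ∀ c : P, ∃ (W : Type z) (_ : NormedAddCommGroup W) (_ : InnerProductSpace ℂ W)
      (_ : FiniteDimensional ℂ W) (π : StarRep R W) (f : W →ₗ[ℂ] P),
      (∀ x w, f (π x w) = act x (f w)) ∧ c ∈ LinearMap.range f)
    (D : Submodule ℂ P) (hD : ∀ x, ∀ d ∈ D, act x d ∈ D) :
    ∃ p : P →ₗ[ℂ] P, (∀ c, p c ∈ D) ∧ (∀ d ∈ D, p d = d) ∧ ∀ x c, p (act x c) = act x (p c) := by
  let _ : Module R P := Module.compHom P act.toRingHom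
  have hsmul : ∀ (x : R) (c : P), x • c = act x c := fun _ _ => rfl
  have hss : ∀ c : P, ∃ N : Submodule R P, IsSemisimpleModule R N ∧ c ∈ N := by
    intro c
    obtain ⟨W, _, _, _, π, f, hf, hc⟩ := hP c
    let _ : Module R W := Module.compHom W π.hom.toRingHom
    have hsmul' : ∀ (x : R) (c : W), x • c = π x c := fun _ _ => rfl
    -- The orthogonal complement of an invariant subspace is invariant, since the action is stable
    -- under adjoints.
    have hW : IsSemisimpleModule R W := by
      refine { exists_isCompl := fun N => ?_ }
      let N' : Submodule ℂ W :=
        { carrier := N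
          add_mem' := N.add_mem
          zero_mem' := N.zero_mem
          smul_mem' := fun z w hw => by
            have := N.smul_mem (algebraMap ℂ R z) hw
            rwa [hsmul', AlgHom.commutes, Module.algebraMap_end_apply] at this }
      let M : Submodule R W :=
        { carrier := N'ᗮ
          add_mem' := N'ᗮ.add_mem
          zero_mem' := N'ᗮ.zero_mem
          smul_mem' := fun x w hw => by
            intro v hv
            rw [hsmul', π.inner_hom]
            exact hw _ (N.smul_mem (star x) hv) }
      refine ⟨M, IsCompl.of_eq ?_ ?_⟩
      · refine (Submodule.eq_bot_iff _).mpr fun w hw => ?_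
        exact (Submodule.mem_bot ℂ).mp (N'.inf_orthogonal_eq_bot ▸ (show w ∈ N' ⊓ N'ᗮ from hw))
      · refine Submodule.eq_top_iff'.mpr fun w => ?_
        obtain ⟨a, ha, b, hb, h⟩ := Submodule.mem_sup.mp
          ((Submodule.sup_orthogonal_of_hasOrthogonalProjection (K := N')) ▸
            Submodule.mem_top (x := w))
        exact Submodule.mem_sup.mpr ⟨a, ha, b, hb, h⟩
    let g : W →ₗ[R] P := { f with map_smul' := fun x w => hf x w }
    obtain ⟨w, rfl⟩ := hc
    exact ⟨LinearMap.range g, IsSemisimpleModule.range g, w, rfl⟩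
  choose N hN hc using hss
  -- A sum of semisimple submodules is semisimple; hence `D` has an invariant complement, and the
  -- projection along it is equivariant.
  have : IsSemisimpleModule R P := isSemisimpleModule_of_isSemisimpleModule_submodule' hN
    (Submodule.eq_top_iff'.mpr fun c => Submodule.mem_iSup_of_mem c (hc c))
  let D' : Submodule R P := { D with smul_mem' := fun x d hd => hD x d hd }
  obtain ⟨E, hE⟩ := exists_isCompl D'
  let q := D'.projectionOnto E hE
  let p : P →ₗ[ℂ] P :=
    { toFun := fun c => q c
      map_add' := fun a b => by simp
      map_smul' := fun z c => by
        have := congrArg Subtype.val (q.map_smul (algebraMap ℂ R z) c)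
        rw [Submodule.coe_smul, hsmul, hsmul, AlgHom.commutes, Module.algebraMap_end_apply,
          Module.algebraMap_end_apply] at this
        exact this }
  exact ⟨p, fun c => (q c).2,
    fun d hd => congrArg Subtype.val (Submodule.projectionOnto_apply_left hE (⟨d, hd⟩ : D')),
    fun x c => congrArg Subtype.val (q.map_smul x c)⟩

end Semisimple

/-! ### Support projections of finite-dimensional subcoalgebras -/

section Slices

variable {X : Type u} [AddCommGroup X] [Module ℂ X] [Coalgebra ℂ X]

theorem FullDual.mul_apply_left (f g : FullDual X) (x : X) : (f * g).toFun x =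
    g.toFun (TensorProduct.lid ℂ X (f.toFun.rTensor X (comul x))) := by
  rw [FullDual.mul_apply]
  generalize (comul (R := ℂ) x : X ⊗[ℂ] X) = t
  induction t with
  | zero => simp
  | add a b ha hb => simp only [map_add, ha, hb]
  | tmul a b => simp

/-- On a subcoalgebra, the convolution product depends only on the restrictions of the factors. -/
theorem FullDual.mul_apply_congr {D : Submodule ℂ X} {d : X}
    (hd : comul (R := ℂ) d ∈ LinearMap.range (TensorProduct.map D.subtype D.subtype))
    {f f' g g' : FullDual X} (hf : ∀ d ∈ D, f.toFun d = f'.toFun d)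
    (hg : ∀ d ∈ D, g.toFun d = g'.toFun d) : (f * g).toFun d = (f' * g').toFun d := by
  rw [FullDual.mul_apply, FullDual.mul_apply]
  obtain ⟨t, ht⟩ := hd
  rw [← ht]
  clear ht
  induction t with
  | zero => simp
  | add a b ha hb => simp only [map_add, ha, hb]
  | tmul a b => simp [hf a a.2, hg b b.2]

theorem FullDual.counit_dag [DagCoalgebra X] (x : X) :
    conj (counit (R := ℂ) (dag x)) = counit (R := ℂ) x := by
  rw [← FullDual.one_apply, ← FullDual.star_apply, star_one, FullDual.one_apply]

/-- The range of `f` is a quotient of `V / ker g`, which embeds into `Y`. It is applied with `g` the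
restriction of functionals to a finite-dimensional subspace. -/
theorem finiteDimensional_range_of_ker_le {V W Y : Type*} [AddCommGroup V] [Module ℂ V]
    [AddCommGroup W] [Module ℂ W] [AddCommGroup Y] [Module ℂ Y] [FiniteDimensional ℂ Y]
    (f : V →ₗ[ℂ] W) (g : V →ₗ[ℂ] Y) (h : LinearMap.ker g ≤ LinearMap.ker f) :
    FiniteDimensional ℂ (LinearMap.range f) := by
  have h1 : FiniteDimensional ℂ (V ⧸ LinearMap.ker g) :=
    g.quotKerEquivRange.symm.finiteDimensional
  rw [← Submodule.range_liftQ _ f h]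
  infer_instance

/-- The restriction of functionals to a subspace. -/
def FullDual.restrict (D : Submodule ℂ X) : FullDual X →ₗ[ℂ] Module.Dual ℂ D :=
  LinearMap.lcomp ℂ ℂ D.subtype ∘ₗ FullDual.toFun.toLinearMap

theorem FullDual.mem_ker_restrict {D : Submodule ℂ X} {y : FullDual X} :
    y ∈ LinearMap.ker (FullDual.restrict D) ↔ ∀ d ∈ D, y.toFun d = 0 := by
  rw [LinearMap.mem_ker, LinearMap.ext_iff]
  exact ⟨fun h d hd => h ⟨d, hd⟩, fun h d => h d d.2⟩

/-- The self-adjoint element `p` of the restricted dual is the support projection of the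
finite-dimensional subcoalgebra `D`. -/
structure IsSupport [DagCoalgebra X] (D : Submodule ℂ X) (p : FullDual X) : Prop where
  finite : FiniteDimensional ℂ D
  comul_mem : ∀ c ∈ D, comul (R := ℂ) c ∈ LinearMap.range (TensorProduct.map D.subtype D.subtype)
  mem : p ∈ restrictedDual X
  star_eq : star p = p
  apply_eq : ∀ d ∈ D, p.toFun d = counit (R := ℂ) d
  mul_eq_zero : ∀ y : FullDual X, (∀ d ∈ D, y.toFun d = 0) → p * y = 0
  eq_zero_mul : ∀ y : FullDual X, (∀ d ∈ D, y.toFun d = 0) → y * p = 0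

namespace IsSupport

variable [DagCoalgebra X] {D : Submodule ℂ X} {p : FullDual X}

theorem mul_apply_right (h : IsSupport D p) (y : FullDual X) {d : X} (hd : d ∈ D) :
    (y * p).toFun d = y.toFun d := by
  rw [FullDual.mul_apply_congr (h.comul_mem d hd) (f' := y) (g' := 1) (fun _ _ => rfl)
    (fun d hd => h.apply_eq d hd), mul_one]

theorem mul_apply_left (h : IsSupport D p) (y : FullDual X) {d : X} (hd : d ∈ D) :
    (p * y).toFun d = y.toFun d := by
  rw [FullDual.mul_apply_congr (h.comul_mem d hd) (f' := 1) (g' := y)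
    (fun d hd => h.apply_eq d hd) (fun _ _ => rfl), one_mul]

/-- Both `y p - y` and `p y - y` vanish on `D`, where `p` acts as the counit; multiplying by `p` on
the other side shows `p y = p y p = y p`. So support projections are central. -/
theorem commute (h : IsSupport D p) (y : FullDual X) : y * p = p * y := by
  have h1 := h.mul_eq_zero (y * p - y) fun d hd => by
    rw [map_sub, LinearMap.sub_apply, h.mul_apply_right y hd, sub_self]
  have h2 := h.eq_zero_mul (p * y - y) fun d hd => by
    rw [map_sub, LinearMap.sub_apply, h.mul_apply_left y hd, sub_self]
  rw [mul_sub, sub_eq_zero] at h1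
  rw [sub_mul, sub_eq_zero] at h2
  exact h2.symm.trans ((mul_assoc _ _ _).trans h1)

/-- A criterion for a functional to be a support projection. -/
theorem of_dag_mem (hfin : FiniteDimensional ℂ D)
    (hcomul : ∀ c ∈ D, comul (R := ℂ) c ∈ LinearMap.range (TensorProduct.map D.subtype D.subtype))
    (hdag : ∀ c ∈ D, dag c ∈ D) (hp : ∀ d ∈ D, p.toFun d = counit (R := ℂ) d)
    (hzero : ∀ y : FullDual X, (∀ d ∈ D, y.toFun d = 0) → p * y = 0) : IsSupport D p := by
  -- Since `D` is stable under `†`, the functional `p^* - 1` vanishes on `D`, hence `p p^* = p`. The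
  -- left side is self-adjoint.
  have hstar : star p = p := by
    have h1 : p * (star p - 1) = 0 := hzero _ fun d hd => by
      rw [map_sub, LinearMap.sub_apply, FullDual.star_apply, hp _ (hdag d hd),
        FullDual.counit_dag, FullDual.one_apply, sub_self]
    rw [mul_sub, mul_one, sub_eq_zero] at h1
    have h2 := congrArg star h1
    rw [star_mul, star_star, h1] at h2
    exact h2.symm
  have hzero' : ∀ y : FullDual X, (∀ d ∈ D, y.toFun d = 0) → y * p = 0 := by
    intro y hy
    have h1 := hzero (star y) fun d hd => by rw [FullDual.star_apply, hy _ (hdag d hd), map_zero]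
    rw [← star_star (y * p), star_mul, hstar, h1, star_zero]
  refine ⟨hfin, hcomul, ?_, hstar, hp, hzero, hzero'⟩
  have hpyp : ∀ y, p * y * p = p * y := by
    intro y
    have h1 := hzero (y * p - y) fun d hd => by
      rw [map_sub, LinearMap.sub_apply, FullDual.mul_apply_congr (hcomul d hd) (f' := y) (g' := 1)
        (fun _ _ => rfl) (fun d hd => hp d hd), mul_one, sub_self]
    rwa [mul_sub, sub_eq_zero, ← mul_assoc] at h1
  -- By `p z p = p z`, every `y p z` has the form `w p`. The map `w ↦ w p` kills the functionals
  -- vanishing on `D`, so its range is no larger than the dual of `D`.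
  refine (mem_restrictedDual _).mpr ⟨LinearMap.range (LinearMap.mulRight ℂ p), ?_, fun y z => ?_⟩
  · have h1 : FiniteDimensional ℂ (Module.Dual ℂ D) := inferInstance
    exact finiteDimensional_range_of_ker_le _ (FullDual.restrict D) fun y hy =>
      hzero' y (FullDual.mem_ker_restrict.mp hy)
  · refine ⟨y * (p * z), ?_⟩
    rw [LinearMap.mulRight_apply, mul_assoc, hpyp, mul_assoc]

end IsSupport

/-- Elements of the restricted dual have local units. -/
theorem exists_mul_eq_of_mem_restrictedDual [DagCoalgebra X] {x : FullDual X}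
    (hx : x ∈ restrictedDual X) : ∃ S : Submodule ℂ X, FiniteDimensional ℂ S ∧
      ∀ D p, IsSupport D p → S ≤ D → p * x = x := by
  classical
  let N := Submodule.span ℂ {w | ∃ y z : FullDual X, w = y * x * z}
  have hN : FiniteDimensional ℂ N := hx
  let f : X →ₗ[ℂ] Module.Dual ℂ N := (FullDual.toFun.toLinearMap ∘ₗ N.subtype).flip
  obtain ⟨s, hs⟩ := IsNoetherian.noetherian (LinearMap.range f)
  choose! g hg using fun (φ : Module.Dual ℂ N) (hφ : φ ∈ LinearMap.range f) => hφ
  -- Choose finitely many points of `X` whose evaluations span all evaluations on the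
  -- finite-dimensional space `N`. If `D` contains them, then `p x - x`, an element of `N`, vanishes
  -- at these points and therefore everywhere.
  refine ⟨Submodule.span ℂ (s.image g : Set X), inferInstance, fun D p hp hD => ?_⟩
  have hmem : p * x - x ∈ N := N.sub_mem (Submodule.subset_span ⟨p, 1, by rw [mul_one]⟩)
    (Submodule.subset_span ⟨1, 1, by rw [mul_one, one_mul]⟩)
  rw [← sub_eq_zero]
  refine FullDual.ext fun c => ?_
  have hc : f c ∈ Submodule.span ℂ (s : Set (Module.Dual ℂ N)) := hs ▸ ⟨c, rfl⟩
  have key : ∀ φ ∈ Submodule.span ℂ (s : Set (Module.Dual ℂ N)), φ ⟨_, hmem⟩ = 0 := by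
    intro φ hφ
    induction hφ using Submodule.span_induction with
    | zero => rfl
    | add a b _ _ ha hb => rw [LinearMap.add_apply, ha, hb, add_zero]
    | smul z a _ ha => rw [LinearMap.smul_apply, ha, smul_zero]
    | mem φ hφ =>
      have h1 := hg φ (hs ▸ Submodule.subset_span hφ)
      have h2 : g φ ∈ D := hD (Submodule.subset_span (Finset.mem_coe.mpr
        (Finset.mem_image_of_mem g hφ)))
      rw [← h1]
      change (p * x - x).toFun (g φ) = 0
      rw [map_sub, LinearMap.sub_apply, hp.mul_apply_left x h2, sub_self]
  rw [map_zero]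
  exact key _ hc

end Slices

/-! ### Existence of support projections for `C` -/

section SupportC

variable {U : Type u} [Ring U] [StarRing U] [HopfAlgebra ℂ U] [StarModule ℂ U] [HopfStarAlgebra U]
variable (F : RepFamily.{u, v, w} U) (I : LeftCoideal U)

theorem quotC_ext {c d : quotC F I} (h : ∀ x, evC F I x c = evC F I x d) : c = d :=
  Subtype.ext (LinearMap.ext h)

/-- The left action of `I` on `C`, `(x c)(y) = c(y x)`. -/
def actIC : I.carrier →ₐ[ℂ] Module.End ℂ (quotC F I) :=
  AlgHom.ofLinearMap
    { toFun := fun x => (TensorProduct.rid ℂ (quotC F I)).toLinearMap ∘ₗ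
        (evC F I x).lTensor (quotC F I) ∘ₗ comul
      map_add' := fun x y => by ext1 c; simp [LinearMap.lTensor_add]
      map_smul' := fun z x => by ext1 c; simp [LinearMap.lTensor_smul] }
    (by
      ext1 c
      exact quotC_ext F I fun x => ((pairingC F I).rid_lTensor_comul c x 1).trans
        (by rw [mul_one]; rfl))
    (fun x y => by
      ext1 c
      refine quotC_ext F I fun z => ((pairingC F I).rid_lTensor_comul c z (x * y)).trans ?_
      refine Eq.trans ?_ ((pairingC F I).rid_lTensor_comul _ z x).symm
      refine Eq.trans ?_ ((pairingC F I).rid_lTensor_comul _ (z * x) y).symm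
      rw [mul_assoc])

theorem evC_actIC (x y : I.carrier) (c : quotC F I) :
    evC F I y (actIC F I x c) = evC F I (y * x) c := (pairingC F I).rid_lTensor_comul c y x

/-- The matrix coefficient of a `*`-representation of `U` as an element of `C`. -/
def coeffC {G : Type z} [NormedAddCommGroup G] [InnerProductSpace ℂ G] (ϑ : StarRep U G)
    (hϑ : ∀ ξ η, coeff ϑ ξ η ∈ coeffAlgebra F) (ξ : G) : G →ₗ[ℂ] quotC F I :=
  projC F I ∘ₗ
    { toFun := fun η => ⟨coeff ϑ ξ η, hϑ ξ η⟩
      map_add' := fun a b => Subtype.ext (FullDual.ext fun x => by simp [coeff_apply])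
      map_smul' := fun z a => Subtype.ext (FullDual.ext fun x => by simp [coeff_apply]) }

variable {G : Type z} [NormedAddCommGroup G] [InnerProductSpace ℂ G] (ϑ : StarRep U G)
    (hϑ : ∀ ξ η, coeff ϑ ξ η ∈ coeffAlgebra F)

theorem evC_coeffC (ξ η : G) (x : I.carrier) :
    evC F I x (coeffC F I ϑ hϑ ξ η) = ⟪ξ, ϑ (x : U) η⟫_ℂ := coeff_apply ϑ ξ η x

theorem actIC_coeffC (ξ η : G) (x : I.carrier) :
    actIC F I x (coeffC F I ϑ hϑ ξ η) = coeffC F I ϑ hϑ ξ (ϑ (x : U) η) :=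
  quotC_ext F I fun y => by
    rw [evC_actIC, evC_coeffC, evC_coeffC, MulMemClass.coe_mul, map_mul, Module.End.mul_apply]

theorem dag_coeffC (ξ η : G) : dag (coeffC F I ϑ hϑ ξ η) = coeffC F I ϑ hϑ η ξ :=
  quotC_ext F I fun y => by
    refine (evC_dagMapC F I _ y).trans ?_
    rw [evC_coeffC, evC_coeffC, inner_conj_symm, ϑ.inner_hom]
    rfl

theorem comul_coeffC {ι : Type*} [Fintype ι] (b : OrthonormalBasis ι ℂ G) (ξ η : G) :
    comul (R := ℂ) (coeffC F I ϑ hϑ ξ η) =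
      ∑ k, coeffC F I ϑ hϑ ξ (b k) ⊗ₜ[ℂ] coeffC F I ϑ hϑ (b k) η := by
  refine (pairingC F I).ext₂ fun x y => ?_
  refine (comulC_spec F I _ x y).trans ?_
  simp only [map_sum, TensorProduct.map_tmul, LinearMap.mul'_apply]
  change _ = ∑ k, evC F I x _ * evC F I y _
  simp only [evC_coeffC]
  rw [MulMemClass.coe_mul, map_mul, Module.End.mul_apply, ϑ.inner_hom (x : U),
    ← b.sum_inner_mul_inner]
  simp [ϑ.inner_hom (x : U)]

/-- Lift `c` to a coefficient `⟨ξ, ϑ(-) ζ⟩` of a representation of `U`. Then `c` is the image of `ζ`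
under the `I`-equivariant map `w ↦ ⟨ξ, ϑ(-) w⟩`. This is the hypothesis under which `C` is
semisimple over `I`. -/
theorem exists_coeffC (c : quotC F I) : ∃ (W : Type z) (_ : NormedAddCommGroup W)
    (_ : InnerProductSpace ℂ W) (_ : FiniteDimensional ℂ W) (π : StarRep I.carrier W)
    (f : W →ₗ[ℂ] quotC F I), (∀ x w, f (π x w) = actIC F I x (f w)) ∧ c ∈ LinearMap.range f := by
  obtain ⟨a, rfl⟩ := projC_surjective F I c
  obtain ⟨G, _, _, _, ϑ, ζ, hϑ, h⟩ := exists_rep_of_finite.{u, v, w, z} F {a}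
    (Set.finite_singleton a)
  obtain ⟨ξ, h⟩ := h a rfl
  refine ⟨G, inferInstance, inferInstance, inferInstance, ϑ.comp I.carrier.subtype,
    coeffC F I ϑ hϑ ξ, fun x w => (actIC_coeffC F I ϑ hϑ ξ w x).symm, ζ, ?_⟩
  refine quotC_ext F I fun x => ?_
  rw [evC_projC, evA_apply, h]
  rfl

/-- Every finite-dimensional subspace of `C` is contained in a finite-dimensional subcoalgebra with
a support projection. -/
theorem exists_isSupport (S : Submodule ℂ (quotC F I)) [FiniteDimensional ℂ S] :
    ∃ D p, S ≤ D ∧ IsSupport D p := by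
  classical
  obtain ⟨s, hs⟩ := (Submodule.fg_iff_finiteDimensional S).mpr inferInstance
  choose g hg using projC_surjective F I
  -- One representation carries lifts of a whole generating set of `S`.
  obtain ⟨G, _, _, _, ϑ, ζ, hϑ, h⟩ := exists_rep_of_finite.{u, v, w, 0} F (g '' s)
    (s.finite_toSet.image g)
  let b := stdOrthonormalBasis ℂ G
  -- All coefficients of `ϑ` restricted to `I`, not only those with second vector `ζ`: this makes
  -- `D` stable under the coproduct, under `†` and under `I`.
  let D := Submodule.span ℂ (Set.range fun q : _ × _ => coeffC F I ϑ hϑ (b q.1) (b q.2))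
  have hfin : FiniteDimensional ℂ D := FiniteDimensional.span_of_finite ℂ (Set.finite_range _)
  have hD : ∀ ξ η, coeffC F I ϑ hϑ ξ η ∈ D := by
    intro ξ η
    have h1 : coeffC F I ϑ hϑ ξ η = ∑ i, ∑ j, (⟪ξ, b i⟫_ℂ * ⟪b j, η⟫_ℂ) •
        coeffC F I ϑ hϑ (b i) (b j) := by
      refine quotC_ext F I fun x => ?_
      simp only [map_sum, map_smul, evC_coeffC, smul_eq_mul]
      rw [Finset.sum_comm]
      conv_lhs => rw [← b.sum_repr' η, map_sum, inner_sum]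
      refine Finset.sum_congr rfl fun j _ => ?_
      rw [map_smul, inner_smul_right, ← b.sum_inner_mul_inner ξ, Finset.mul_sum]
      exact Finset.sum_congr rfl fun k _ => by ring
    rw [h1]
    exact sum_mem fun i _ => sum_mem fun j _ => D.smul_mem _ (Submodule.subset_span ⟨(i, j), rfl⟩)
  have hind : ∀ P : quotC F I → Prop, (∀ ξ η, P (coeffC F I ϑ hϑ ξ η)) → P 0 →
      (∀ a b, P a → P b → P (a + b)) → (∀ (z : ℂ) a, P a → P (z • a)) → ∀ d ∈ D, P d := by
    intro P h1 h2 h3 h4 d hd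
    refine Submodule.span_induction (fun d hd => ?_) h2 (fun a b _ _ => h3 a b)
      (fun z a _ => h4 z a) hd
    obtain ⟨q, rfl⟩ := hd
    exact h1 _ _
  have hSD : S ≤ D := by
    rw [← hs, Submodule.span_le]
    intro c hc
    obtain ⟨ξ, hξ⟩ := h (g c) ⟨c, hc, rfl⟩
    have : c = coeffC F I ϑ hϑ ξ ζ := by
      refine quotC_ext F I fun x => ?_
      rw [← hg c, evC_projC, evA_apply, hξ]
      rfl
    rw [this]
    exact hD _ _
  have hcomul : ∀ c ∈ D, comul (R := ℂ) c ∈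
      LinearMap.range (TensorProduct.map D.subtype D.subtype) := by
    refine hind _ (fun ξ η => ?_) (by rw [map_zero]; exact zero_mem _)
      (fun a b ha hb => by rw [map_add]; exact add_mem ha hb)
      (fun z a ha => by rw [map_smul]; exact Submodule.smul_mem _ _ ha)
    rw [comul_coeffC F I ϑ hϑ b]
    exact sum_mem fun k _ => ⟨⟨_, hD ξ (b k)⟩ ⊗ₜ ⟨_, hD (b k) η⟩, rfl⟩
  have hdag : ∀ c ∈ D, dag c ∈ D := by
    refine hind _ (fun ξ η => ?_) (by rw [map_zero]; exact zero_mem _)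
      (fun a b ha hb => by rw [map_add]; exact add_mem ha hb)
      (fun z a ha => by rw [map_smulₛₗ]; exact Submodule.smul_mem _ _ ha)
    rw [dag_coeffC]
    exact hD _ _
  have hact : ∀ x, ∀ c ∈ D, actIC F I x c ∈ D := by
    intro x
    refine hind _ (fun ξ η => ?_) (by rw [map_zero]; exact zero_mem _)
      (fun a b ha hb => by rw [map_add]; exact add_mem ha hb)
      (fun z a ha => by rw [map_smul]; exact Submodule.smul_mem _ _ ha)
    rw [actIC_coeffC]
    exact hD _ _
  obtain ⟨P, hP, hPD, hPact⟩ := exists_equivariant_projection (actIC F I)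
    (exists_coeffC.{u, v, w, 0} F I) D hact
  -- `P` is an `I`-equivariant projection of `C` onto `D`, so `ε ∘ P` extends the counit of `D`.
  let p : FullDual (quotC F I) := FullDual.mk (counit ∘ₗ P)
  have hp : ∀ c, p.toFun c = counit (R := ℂ) (P c) := fun c => by simp [p]
  have hpD : ∀ d ∈ D, p.toFun d = counit (R := ℂ) d := fun d hd => by rw [hp, hPD d hd]
  -- Slicing the second leg of `Δ(c)` with `x ∈ I` gives `x c`, and `ε(P(x c)) = ε(x P(c)) = τ(P(c),
  -- x)`. Hence `(p ⊗ id) Δ(c) = P(c)`.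
  have hpmul : ∀ (z : FullDual (quotC F I)) c, (p * z).toFun c = z.toFun (P c) := by
    intro z c
    rw [FullDual.mul_apply_left]
    congr 1
    refine quotC_ext F I fun x => ?_
    have h1 : ∀ t : quotC F I ⊗[ℂ] quotC F I,
        evC F I x (TensorProduct.lid ℂ (quotC F I) (p.toFun.rTensor _ t)) =
        p.toFun (TensorProduct.rid ℂ (quotC F I) ((evC F I x).lTensor _ t)) := by
      intro t
      induction t with
      | zero => simp
      | add a b ha hb => simp only [map_add, ha, hb]
      | tmul a b => simp [mul_comm]
    rw [h1]
    change p.toFun (actIC F I x c) = _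
    rw [hp, hPact]
    change evC F I 1 (actIC F I x (P c)) = _
    rw [evC_actIC, one_mul]
  have hzero : ∀ y : FullDual (quotC F I), (∀ d ∈ D, y.toFun d = 0) → p * y = 0 := fun y hy =>
    FullDual.ext fun c => by rw [hpmul, hy _ (hP c), map_zero, LinearMap.zero_apply]
  exact ⟨D, p, hSD, .of_dag_mem hfin hcomul hdag hpD hzero⟩

end SupportC

/-! ### Boundedness of operators on pre-Hilbert spaces -/

section Bounded

variable {H : Type z} [NormedAddCommGroup H] [InnerProductSpace ℂ H]

/-- A linear operator on a pre-Hilbert space is bounded. -/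
def IsBdd (T : Module.End ℂ H) : Prop := ∃ C : ℝ, ∀ v, ‖T v‖ ≤ C * ‖v‖

theorem IsBdd.exists_nonneg {T : Module.End ℂ H} (hT : IsBdd T) :
    ∃ C : ℝ, 0 ≤ C ∧ ∀ v, ‖T v‖ ≤ C * ‖v‖ := by
  obtain ⟨C, hC⟩ := hT
  exact ⟨max C 0, le_max_right _ _, fun v => (hC v).trans
    (mul_le_mul_of_nonneg_right (le_max_left _ _) (norm_nonneg _))⟩

theorem IsBdd.zero : IsBdd (0 : Module.End ℂ H) := ⟨0, fun v => by simp⟩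

theorem IsBdd.add {S T : Module.End ℂ H} (hS : IsBdd S) (hT : IsBdd T) : IsBdd (S + T) := by
  obtain ⟨C, hC⟩ := hS
  obtain ⟨D, hD⟩ := hT
  refine ⟨C + D, fun v => (norm_add_le _ _).trans ?_⟩
  rw [add_mul]
  exact add_le_add (hC v) (hD v)

theorem IsBdd.smul {T : Module.End ℂ H} (hT : IsBdd T) (z : ℂ) : IsBdd (z • T) := by
  obtain ⟨C, hC⟩ := hT
  refine ⟨‖z‖ * C, fun v => ?_⟩
  rw [LinearMap.smul_apply, norm_smul, mul_assoc]
  exact mul_le_mul_of_nonneg_left (hC v) (norm_nonneg _)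

theorem IsBdd.mul {S T : Module.End ℂ H} (hS : IsBdd S) (hT : IsBdd T) : IsBdd (S * T) := by
  obtain ⟨C, hC0, hC⟩ := hS.exists_nonneg
  obtain ⟨D, hD⟩ := hT
  refine ⟨C * D, fun v => (hC _).trans ?_⟩
  rw [mul_assoc]
  exact mul_le_mul_of_nonneg_left (hD v) hC0

theorem IsBdd.sum {ι : Type*} (s : Finset ι) {T : ι → Module.End ℂ H} (hT : ∀ i ∈ s, IsBdd (T i)) :
    IsBdd (∑ i ∈ s, T i) := by
  classical
  induction s using Finset.induction_on with
  | empty => exact .zero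
  | insert i s hi h =>
    rw [Finset.sum_insert hi]
    exact (hT i (Finset.mem_insert_self _ _)).add
      (h fun j hj => hT j (Finset.mem_insert_of_mem hj))

variable {R : Type u} [Ring R] [StarRing R] [Algebra ℂ R]

/-- On a pre-Hilbert space the bound is transferred by hand: `‖a^* v‖² = ⟨a a^* v, v⟩ ≤ C ‖a^* v‖
‖v‖`. -/
theorem StarRep.isBdd_star (π : StarRep R H) {a : R} (ha : IsBdd (π a)) : IsBdd (π (star a)) := by
  obtain ⟨C, hC0, hC⟩ := ha.exists_nonneg
  refine ⟨C, fun v => ?_⟩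
  rcases (norm_nonneg (π (star a) v)).eq_or_lt with h | h
  · rw [← h]
    positivity
  · refine le_of_mul_le_mul_right ?_ h
    have h1 : ‖π (star a) v‖ * ‖π (star a) v‖ = ‖⟪π a (π (star a) v), v⟫_ℂ‖ := by
      have h2 := π.inner_hom (star a) (π (star a) v) v
      rw [star_star] at h2
      rw [← h2, inner_self_eq_norm_sq_to_K]
      simp [sq]
    rw [h1]
    calc _ ≤ ‖π a (π (star a) v)‖ * ‖v‖ := norm_inner_le_norm _ _
      _ ≤ C * ‖π (star a) v‖ * ‖v‖ := mul_le_mul_of_nonneg_right (hC _) (norm_nonneg _)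
      _ = _ := by ring

theorem StarRep.norm_sq (π : StarRep R H) (a : R) (v : H) :
    ((‖π a v‖ ^ 2 : ℝ) : ℂ) = ⟪v, π (star a * a) v⟫_ℂ := by
  rw [map_mul, Module.End.mul_apply, π.inner_hom (star a), star_star, inner_self_eq_norm_sq_to_K]
  simp

/-- An element which generates a finite-dimensional ideal acts by a bounded operator in each locally
finite `*`-representation. -/
theorem StarRep.isBdd_of_finiteDimensional (π : StarRep R H)
    (hπ : ∀ v, FiniteDimensional ℂ (π.orbit v)) {a : R} (N : Submodule ℂ R)
    [FiniteDimensional ℂ N] (hN : ∀ x y, x * a * y ∈ N) : IsBdd (π a) := by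
  let y := star a * a
  -- All elements `y q(y)` lie in the finite-dimensional space `N`, while polynomials form an
  -- infinite-dimensional space.
  obtain ⟨q, hq, hq0⟩ : ∃ q : Polynomial ℂ, Polynomial.aeval y (Polynomial.X * q) = 0 ∧ q ≠ 0 := by
    let f : Polynomial ℂ →ₗ[ℂ] N :=
      { toFun := fun q => ⟨Polynomial.aeval y (Polynomial.X * q), by
          rw [map_mul, Polynomial.aeval_X]
          exact hN _ _⟩
        map_add' := fun p q => Subtype.ext (by simp [mul_add])
        map_smul' := fun z q => Subtype.ext (by simp) }
    by_contra! h
    have hinj : Function.Injective f := by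
      rw [injective_iff_map_eq_zero]
      exact fun q hq => h q (congrArg Subtype.val hq)
    have := Module.Finite.of_injective f hinj
    exact Polynomial.not_finite this
  let Q := Polynomial.X * q
  have hQ : Q ≠ 0 := mul_ne_zero Polynomial.X_ne_zero hq0
  -- A bound for the modulus of every root of `Q`; it depends on `a` only and not on the vector.
  let M : ℝ := ∑ r ∈ Q.roots.toFinset, ‖r‖
  have hM : 0 ≤ M := Finset.sum_nonneg fun _ _ => norm_nonneg _
  refine ⟨Real.sqrt M, fun v => ?_⟩
  have := hπ v
  let V := π.orbit v
  -- On the finite-dimensional cyclic subspace, `y` is symmetric and thus diagonalizable in an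
  -- orthonormal basis. Its eigenvalues are roots of `Q`.
  let T : Module.End ℂ V := (π y).restrict fun w hw => π.mem_orbit v y hw
  have hT : T.IsSymmetric := fun w w' => by
    change ⟪π y w, w'⟫_ℂ = ⟪(w : H), π y w'⟫_ℂ
    rw [π.inner_hom]
    simp [y]
  let b := hT.eigenvectorBasis rfl
  have hb : ∀ i, ‖(hT.eigenvalues rfl i : ℂ)‖ ≤ M := by
    intro i
    have h1 := hT.hasEigenvector_eigenvectorBasis rfl i
    have h2 := Module.End.aeval_apply_of_hasEigenvector (p := Q) h1
    have h3 : ∀ p : Polynomial ℂ, ∀ w : V, ((Polynomial.aeval T p w : V) : H) =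
        π (Polynomial.aeval y p) w := by
      intro p w
      induction p using Polynomial.induction_on' generalizing w with
      | add p q hp hq => simp [hp, hq]
      | monomial n z =>
        simp only [Polynomial.aeval_monomial, Module.End.mul_apply, map_mul, AlgHom.commutes,
          Module.algebraMap_end_apply, map_pow, Submodule.coe_smul]
        congr 1
        induction n generalizing w with
        | zero => rfl
        | succ n ih => rw [pow_succ, pow_succ, Module.End.mul_apply, Module.End.mul_apply, ih]; rfl
    have h4 : (Polynomial.aeval T Q) (b i) = 0 := Subtype.ext (by rw [h3, hq]; simp)
    rw [h4] at h2
    have h5 := (smul_eq_zero.mp h2.symm).resolve_right h1.2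
    refine Finset.single_le_sum (f := fun r : ℂ => ‖r‖) (fun _ _ => norm_nonneg _) ?_
    rw [Multiset.mem_toFinset, Polynomial.mem_roots hQ]
    exact h5
  have hTv : ∀ w : V, ‖T w‖ ≤ M * ‖w‖ := by
    intro w
    refine le_of_sq_le_sq ?_ (by positivity)
    rw [← b.sum_sq_norm_inner_right, mul_pow, ← b.sum_sq_norm_inner_right w, Finset.mul_sum]
    refine Finset.sum_le_sum fun i _ => ?_
    rw [← hT, hT.apply_eigenvectorBasis, inner_smul_left, norm_mul, mul_pow]
    gcongr
    simpa using hb i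
  have hv : v ∈ V := ⟨1, by simp⟩
  -- `‖a v‖² = ⟨v, a^* a v⟩`, and `a^* a` is bounded by `M` on the cyclic subspace of `v`.
  have h1 : ‖π a v‖ ^ 2 ≤ M * ‖v‖ ^ 2 := by
    have h2 := π.norm_sq a v
    have h3 : ‖π a v‖ ^ 2 = ‖⟪v, π y v⟫_ℂ‖ := by
      rw [← h2, Complex.norm_real, Real.norm_of_nonneg (by positivity)]
    rw [h3]
    calc _ ≤ ‖v‖ * ‖π y v‖ := norm_inner_le_norm _ _
      _ ≤ ‖v‖ * (M * ‖v‖) := mul_le_mul_of_nonneg_left (hTv ⟨v, hv⟩) (norm_nonneg _)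
      _ = _ := by ring
  rw [← Real.sqrt_sq (norm_nonneg (π a v)), ← Real.sqrt_sq (norm_nonneg v), ← Real.sqrt_mul hM]
  exact Real.sqrt_le_sqrt h1

end Bounded

/-! ### Boundedness of the action of `B` -/

section BoundedB

variable {U : Type u} [Ring U] [StarRing U] [HopfAlgebra ℂ U] [StarModule ℂ U] [HopfStarAlgebra U]
variable (F : RepFamily.{u, v, w} U) (I : LeftCoideal U)
  {H : Type z} [NormedAddCommGroup H] [InnerProductSpace ℂ H]

/-- `u₍₁₎ S(u₍₂₎) = ε(u)` for matrix coefficients of a `*`-representation. -/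
theorem sum_coeff_mul_star_coeff {G : Type w} [NormedAddCommGroup G] [InnerProductSpace ℂ G]
    (ϑ : StarRep U G) (V : Submodule ℂ G) (hV : ∀ x, ∀ w ∈ V, ϑ x w ∈ V)
    {ι : Type*} [Fintype ι] (b : OrthonormalBasis ι ℂ V) (ξ : V) :
    ∑ i, coeff ϑ (ξ : G) (b i : G) * star (coeff ϑ (ξ : G) (b i : G)) =
      ((‖ξ‖ ^ 2 : ℝ) : ℂ) • (1 : FullDual U) := by
  refine FullDual.ext fun x => ?_
  have h : ∀ t : U ⊗[ℂ] U, ∑ i, LinearMap.mul' ℂ ℂ (TensorProduct.map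
      (coeff ϑ (ξ : G) (b i : G)).toFun (star (coeff ϑ (ξ : G) (b i : G))).toFun t) =
      ⟪(ξ : G), ϑ (LinearMap.mul' ℂ U ((antipode ℂ).lTensor U t)) ξ⟫_ℂ := by
    intro t
    induction t with
    | zero => simp
    | add s t hs ht => simp only [map_add, Finset.sum_add_distrib, hs, ht, LinearMap.add_apply,
        inner_add_right]
    | tmul p q =>
      simp only [TensorProduct.map_tmul, LinearMap.mul'_apply, LinearMap.lTensor_tmul,
        FullDual.star_apply, coeff_apply, inner_conj_symm, map_mul, Module.End.mul_apply]
      rw [ϑ.inner_hom p]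
      have h1 := b.sum_inner_mul_inner ⟨_, hV (star p) ξ ξ.2⟩ ⟨_, hV (antipode ℂ q) ξ ξ.2⟩
      simp only [Submodule.coe_inner] at h1
      rw [← h1]
      refine Finset.sum_congr rfl fun i _ => ?_
      rw [hopfDag_apply, ← ϑ.inner_hom p, ← ϑ.inner_hom (antipode ℂ q)]
  simp only [map_sum, LinearMap.sum_apply, FullDual.mul_apply]
  rw [h, mul_antipode_lTensor_comul_apply, AlgHom.commutes, Module.algebraMap_end_apply,
    inner_smul_right, map_smul, LinearMap.smul_apply, FullDual.one_apply,
    inner_self_eq_norm_sq_to_K]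
  simp [mul_comm]

/-- Each element of `B` acts by a bounded operator in each `*`-representation of `B`. -/
theorem isBdd_algB (π : StarRep (algB F I) H) (b : algB F I) : IsBdd (π b) := by
  obtain ⟨G, _, _, _, ϑ, ζ, hϑ, h⟩ := exists_rep_of_finite.{u, v, w, 0} F {b.1}
    (Set.finite_singleton _)
  obtain ⟨ξ, hξ⟩ := h b.1 rfl
  let V := ϑ.orbit ζ
  have hζ : ζ ∈ V := ⟨1, by simp⟩
  let e := stdOrthonormalBasis ℂ V
  -- Replacing `ξ` by its projection does not change coefficients with second vector in the cyclic
  -- space `V`, and places the first vector in `V`, as needed for the sum formula below.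
  let ξ' : V := V.orthogonalProjectionOnto ξ
  have hξ' : ∀ w ∈ V, ⟪(ξ' : G), w⟫_ℂ = ⟪ξ, w⟫_ℂ := by
    intro w hw
    exact Submodule.inner_orthogonalProjectionOnto_eq_of_mem_right (K := V) ⟨w, hw⟩ ξ
  have hV : ∀ x, ∀ w ∈ V, ϑ x w ∈ V := fun x w hw => ϑ.mem_orbit ζ x hw
  -- With `w = ϑ(u) ζ`, the coefficient at `x y` is `b(x y u) = ε(x) b(y u)`. So the coinvariance of
  -- `b` passes to the whole row of coefficients.
  have hB : ∀ w ∈ V, (⟨coeff ϑ ξ' w, hϑ _ _⟩ : coeffAlgebra F) ∈ algB F I := by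
    rintro w ⟨u, rfl⟩
    refine (coinvariant_iff F I _).mpr fun x y => ?_
    have hb := (coinvariant_iff F I b.1).mp b.2 x (y * u)
    rw [hξ, coeff_apply, coeff_apply, ← mul_assoc, map_mul, map_mul, Module.End.mul_apply,
      Module.End.mul_apply] at hb
    refine (coeff_apply ϑ _ _ _).trans (Eq.trans ?_ (congrArg _ (coeff_apply ϑ _ _ _).symm))
    rw [hξ' _ (hV _ _ ⟨u, rfl⟩), hξ' _ (hV _ _ ⟨u, rfl⟩), map_mul]
    rw [map_mul ϑ.hom y u] at hb
    exact hb
  let B : V →ₗ[ℂ] algB F I :=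
    { toFun := fun w => ⟨_, hB w w.2⟩
      map_add' := fun a b => Subtype.ext (Subtype.ext (FullDual.ext fun x => by simp [coeff_apply]))
      map_smul' := fun z a => Subtype.ext (Subtype.ext (FullDual.ext fun x => by
        simp [coeff_apply])) }
  have hb : b = B ⟨ζ, hζ⟩ := by
    refine Subtype.ext (Subtype.ext (hξ.trans (FullDual.ext fun x => ?_)))
    change _ = (coeff ϑ ξ' ζ).toFun x
    rw [coeff_apply, coeff_apply]
    exact (hξ' _ ⟨x, rfl⟩).symm
  -- The antipode identity for the row of `ξ'`: the row is unitary up to the factor `‖ξ'‖²`.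
  have hsum : ∑ i, B (e i) * star (B (e i)) = ((‖ξ'‖ ^ 2 : ℝ) : ℂ) • (1 : algB F I) := by
    refine Subtype.ext (Subtype.ext ?_)
    rw [AddSubmonoidClass.coe_finsetSum, AddSubmonoidClass.coe_finsetSum]
    exact sum_coeff_mul_star_coeff ϑ V hV e ξ'
  have hbd : ∀ i, IsBdd (π (B (e i))) := by
    intro i
    -- The sum formula gives `∑ ‖π(bᵢ^*) v‖² = ‖ξ'‖² ‖v‖²`, which bounds the stars `bᵢ^*`; the bound
    -- is then transferred to `bᵢ`.
    rw [← star_star (B (e i))]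
    refine π.isBdd_star ⟨‖ξ'‖, fun v => ?_⟩
    have h1 : (∑ j, ‖π (star (B (e j))) v‖ ^ 2 : ℝ) = (‖ξ'‖ * ‖v‖) ^ 2 := by
      apply Complex.ofReal_injective
      rw [Complex.ofReal_sum]
      simp only [π.norm_sq, star_star]
      rw [← inner_sum, ← LinearMap.sum_apply, ← map_sum, hsum, map_smul, map_one,
        LinearMap.smul_apply, Module.End.one_apply, inner_smul_right, inner_self_eq_norm_sq_to_K]
      push_cast
      rw [mul_pow]
      rfl
    refine le_of_sq_le_sq ?_ (by positivity)
    rw [← h1]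
    exact Finset.single_le_sum (f := fun j => ‖π (star (B (e j))) v‖ ^ 2)
      (fun j _ => by positivity) (Finset.mem_univ i)
  rw [hb, ← e.sum_repr ⟨ζ, hζ⟩, map_sum, map_sum]
  refine .sum _ fun i _ => ?_
  rw [map_smul, map_smul]
  exact (hbd i).smul _

end BoundedB

/-! ### Comodules as representations of the full dual -/

section ComoduleRep

variable {X : Type u} [AddCommGroup X] [Module ℂ X]
  {H : Type z} [NormedAddCommGroup H] [InnerProductSpace ℂ H]

/-- The slice `(id ⊗ f)(t)` of a tensor. -/
def slice (f : X →ₗ[ℂ] ℂ) : H ⊗[ℂ] X →ₗ[ℂ] H :=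
  (TensorProduct.rid ℂ H).toLinearMap ∘ₗ f.lTensor H

@[simp] theorem slice_tmul (f : X →ₗ[ℂ] ℂ) (v : H) (c : X) : slice f (v ⊗ₜ[ℂ] c) = f c • v := by
  simp [slice]

theorem slice_ext {Y : Type*} (ev : Y → X →ₗ[ℂ] ℂ) (hev : ∀ c : X, (∀ x, ev x c = 0) → c = 0)
    {s t : H ⊗[ℂ] X} (h : ∀ x, slice (ev x) s = slice (ev x) t) : s = t := by
  rw [← sub_eq_zero]
  refine eq_zero_of_lTensor ev hev _ fun x => (TensorProduct.rid ℂ H).injective ?_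
  rw [map_zero]
  refine (map_sub (slice (ev x)) s t).trans ?_
  rw [h, sub_self]

/-- By right exactness of the tensor product, membership in `H ⊗ D` means vanishing in `H ⊗ (X /
D)`, and functionals on `X / D` separate points there. -/
theorem mem_range_lTensor_iff (D : Submodule ℂ X) (t : H ⊗[ℂ] X) :
    t ∈ LinearMap.range (D.subtype.lTensor H) ↔
      ∀ f : X →ₗ[ℂ] ℂ, (∀ d ∈ D, f d = 0) → slice f t = 0 := by
  constructor
  · rintro ⟨s, rfl⟩ f hf
    induction s with
    | zero => simp
    | add a b ha hb => simp only [map_add, ha, hb, add_zero]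
    | tmul v d => simp [hf d d.2]
  · intro h
    have hex := lTensor_exact H (f := D.subtype) (g := D.mkQ)
      (LinearMap.exact_subtype_mkQ D) (Submodule.mkQ_surjective D)
    rw [← LinearMap.exact_iff.mp hex, LinearMap.mem_ker]
    refine eq_zero_of_lTensor (fun f : Module.Dual ℂ (X ⧸ D) => f)
      (fun c hc => (Module.forall_dual_apply_eq_zero_iff ℂ c).mp hc) _ fun f => ?_
    apply (TensorProduct.rid ℂ H).injective
    rw [map_zero, ← LinearMap.comp_apply (f.lTensor H), ← LinearMap.lTensor_comp]
    exact h _ fun d hd => by simp [(Submodule.Quotient.mk_eq_zero D).mpr hd]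

variable [Coalgebra ℂ X] [DagCoalgebra X]

namespace UnitaryComodule

/-- The `*`-representation of the full dual on a unitary comodule, `x v = v₍₀₎ x(v₍₁₎)`. -/
def rep (M : UnitaryComodule X H) : StarRep (FullDual X) H where
  hom := AlgHom.ofLinearMap
    { toFun := fun x => slice x.toFun ∘ₗ M.coact
      map_add' := fun x y => by ext v; simp [slice, LinearMap.lTensor_add]
      map_smul' := fun z x => by ext v; simp [slice, LinearMap.lTensor_smul] }
    (by ext v; exact M.counit_coact v)
    (fun x y => by
      ext v
      change slice (x * y).toFun (M.coact v) = slice x.toFun (M.coact (slice y.toFun (M.coact v)))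
      have h1 : ∀ t : H ⊗[ℂ] X, slice (x * y).toFun t =
          slice (LinearMap.mul' ℂ ℂ ∘ₗ TensorProduct.map x.toFun y.toFun)
            ((comul (R := ℂ)).lTensor H t) := by
        intro t
        induction t with
        | zero => simp
        | add a b ha hb => simp only [map_add, ha, hb]
        | tmul v c => simp [FullDual.mul_apply]
      rw [h1, ← M.coassoc]
      generalize M.coact v = t
      induction t with
      | zero => simp
      | add a b ha hb => simp only [map_add, ha, hb]
      | tmul v c =>
        simp only [LinearMap.rTensor_tmul, slice_tmul, map_smul]
        generalize M.coact v = t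
        induction t with
        | zero => simp
        | add a b ha hb => simp only [map_add, TensorProduct.add_tmul, ha, hb, smul_add]
        | tmul v d => simp [smul_smul, mul_comm])
  inner_hom x v w := by
    change ⟪v, slice x.toFun (M.coact w)⟫_ℂ = ⟪slice (star x).toFun (M.coact v), w⟫_ℂ
    have h1 : ∀ t : H ⊗[ℂ] X, ⟪v, slice x.toFun t⟫_ℂ =
        x.toFun (TensorProduct.lid ℂ X ((innerₛₗ ℂ v).rTensor X t)) := by
      intro t
      induction t with
      | zero => simp
      | add a b ha hb => simp only [map_add, inner_add_right, ha, hb]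
      | tmul v d => simp [mul_comm]
    rw [h1, M.unitary]
    generalize M.coact v = t
    induction t with
    | zero => simp
    | add a b ha hb => simp only [map_add, inner_add_left, ha, hb]
    | tmul v d => simp [FullDual.star_apply]

theorem rep_apply (M : UnitaryComodule X H) (x : FullDual X) (v : H) :
    M.rep x v = TensorProduct.rid ℂ H (x.toFun.lTensor H (M.coact v)) := rfl

/-- This expresses the subspace belonging to `D`, on which local completeness is tested, as a common
kernel of operators from the full dual. -/
theorem mem_range_iff (M : UnitaryComodule X H) (D : Submodule ℂ X) (v : H) :
    M.coact v ∈ LinearMap.range (D.subtype.lTensor H) ↔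
      ∀ x : FullDual X, (∀ d ∈ D, x.toFun d = 0) → M.rep x v = 0 := by
  rw [mem_range_lTensor_iff]
  exact ⟨fun h x hx => h x.toFun hx, fun h f hf => by
    have := h (FullDual.mk f) (by simpa using hf)
    rwa [rep_apply, FullDual.toFun_mk] at this⟩

theorem exists_mem_range (M : UnitaryComodule X H) (v : H) : ∃ S : Submodule ℂ X,
    FiniteDimensional ℂ S ∧ M.coact v ∈ LinearMap.range (S.subtype.lTensor H) := by
  classical
  obtain ⟨T, hT⟩ := TensorProduct.exists_finset (M.coact v)
  refine ⟨Submodule.span ℂ (T.image Prod.snd : Finset X), inferInstance, ?_⟩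
  rw [hT]
  exact sum_mem fun p hp => ⟨p.1 ⊗ₜ ⟨p.2, Submodule.subset_span
    (Finset.mem_coe.mpr (Finset.mem_image_of_mem _ hp))⟩, rfl⟩

theorem rep_support (M : UnitaryComodule X H) {D : Submodule ℂ X} {p : FullDual X}
    (hp : IsSupport D p) {v : H} (hv : M.coact v ∈ LinearMap.range (D.subtype.lTensor H)) :
    M.rep p v = v := by
  have h := (M.mem_range_iff D v).mp hv (p - 1) fun d hd => by
    rw [map_sub, LinearMap.sub_apply, hp.apply_eq d hd, FullDual.one_apply, sub_self]
  rwa [map_sub, map_one, LinearMap.sub_apply, Module.End.one_apply, sub_eq_zero] at h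

/-- Each vector of a comodule has a local unit. -/
theorem exists_rep_eq (M : UnitaryComodule X H) (v : H) : ∃ S : Submodule ℂ X,
    FiniteDimensional ℂ S ∧ ∀ D p, IsSupport D p → S ≤ D → M.rep p v = v := by
  obtain ⟨S, hS, hv⟩ := M.exists_mem_range v
  refine ⟨S, hS, fun D p hp hD => M.rep_support hp ((M.mem_range_iff D v).mpr fun x hx => ?_)⟩
  exact (M.mem_range_iff S v).mp hv x fun d hd => hx d (hD hd)

/-- If `δ(v) ∈ H ⊗ S`, then `x v` depends only on the restriction of `x` to the finite-dimensional
space `S`. -/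
theorem finiteDimensional_orbit (M : UnitaryComodule X H) (v : H) :
    FiniteDimensional ℂ (M.rep.orbit v) := by
  obtain ⟨S, hS, hv⟩ := M.exists_mem_range v
  have h1 : FiniteDimensional ℂ (Module.Dual ℂ S) := inferInstance
  exact finiteDimensional_range_of_ker_le _ (FullDual.restrict S) fun y hy =>
    (M.mem_range_iff S v).mp hv y (FullDual.mem_ker_restrict.mp hy)

theorem isBdd_rep (M : UnitaryComodule X H) {x : FullDual X} (hx : x ∈ restrictedDual X) :
    IsBdd (M.rep x) := by
  obtain ⟨K, hK, h⟩ := (mem_restrictedDual _).mp hx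
  exact M.rep.isBdd_of_finiteDimensional M.finiteDimensional_orbit K h

end UnitaryComodule

end ComoduleRep

/-! ### Representations of the double from representations of its two parts -/

section DoubleLift

variable {B : Type u} {J : Type v} [Ring B] [StarRing B] [Algebra ℂ B] [StarModule ℂ B]
  [Ring J] [StarRing J] [Algebra ℂ J] [StarModule ℂ J] (Φ : J → B → B ⊗[ℂ] J)
  {H : Type z} [NormedAddCommGroup H] [InnerProductSpace ℂ H]

theorem StarRep.ext_inner {R : Type w} [Ring R] [StarRing R] [Algebra ℂ R] {π σ : StarRep R H}
    (h : ∀ a, π a = σ a) : π = σ := by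
  obtain ⟨π, hπ⟩ := π
  obtain ⟨σ, hσ⟩ := σ
  have : π = σ := AlgHom.ext h
  subst this
  rfl

/-- The algebra homomorphism on the free algebra given by representations of `B` and `J`. -/
def freeHom (ρ : StarRep B H) (σ : StarRep J H) : FreeStar B J →ₐ[ℂ] Module.End ℂ H :=
  FreeAlgebra.lift ℂ (Sum.elim ρ.hom σ.hom)

theorem freeHom_left (ρ : StarRep B H) (σ : StarRep J H) (b : B) :
    freeHom ρ σ (FreeStar.left b) = ρ b :=
  FreeAlgebra.lift_ι_apply (Sum.elim ρ.hom σ.hom : B ⊕ J → Module.End ℂ H) (Sum.inl b)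

theorem freeHom_right (ρ : StarRep B H) (σ : StarRep J H) (x : J) :
    freeHom ρ σ (FreeStar.right x) = σ x :=
  FreeAlgebra.lift_ι_apply (Sum.elim ρ.hom σ.hom : B ⊕ J → Module.End ℂ H) (Sum.inr x)

theorem FreeStar.induction {P : FreeStar B J → Prop} (h1 : ∀ z, P (algebraMap ℂ _ z))
    (h2 : ∀ b, P (left b)) (h3 : ∀ x, P (right x)) (h4 : ∀ a b, P a → P b → P (a * b))
    (h5 : ∀ a b, P a → P b → P (a + b)) (a : FreeStar B J) : P a :=
  FreeAlgebra.induction ℂ (B ⊕ J) (motive := P) h1 (fun s => s.rec h2 h3) h4 h5 a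

theorem inner_freeHom (ρ : StarRep B H) (σ : StarRep J H) (a : FreeStar B J) (v w : H) :
    ⟪v, freeHom ρ σ a w⟫_ℂ = ⟪freeHom ρ σ (star a) v, w⟫_ℂ := by
  induction a using FreeStar.induction generalizing v w with
  | h1 z =>
    rw [← algebraMap_star_comm, AlgHom.commutes, AlgHom.commutes]
    simp [mul_comm]
  | h2 b => rw [FreeStar.star_left, freeHom_left, freeHom_left, ρ.inner_hom]
  | h3 x => rw [FreeStar.star_right, freeHom_right, freeHom_right, σ.inner_hom]
  | h4 a b ha hb =>
    rw [star_mul, map_mul, map_mul, Module.End.mul_apply, Module.End.mul_apply, ha, hb]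
  | h5 a b ha hb => simp only [star_add, map_add, LinearMap.add_apply, inner_add_left,
      inner_add_right, ha, hb]

theorem freeHom_rel (ρ : StarRep B H) (σ : StarRep J H)
    (h : ∀ x b, σ x * ρ b = LinearMap.mul' ℂ _
      (TensorProduct.map ρ.hom.toLinearMap σ.hom.toLinearMap (Φ x b)))
    {a a' : FreeStar B J} (haa : DoubleRel B J Φ a a') : freeHom ρ σ a = freeHom ρ σ a' := by
  induction haa with
  | left_add b b' => simp only [map_add, freeHom_left]
  | left_smul z b => simp only [map_smul, freeHom_left]
  | left_mul b b' => simp only [map_mul, freeHom_left]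
  | left_one => simp only [map_one, freeHom_left]
  | right_add b b' => simp only [map_add, freeHom_right]
  | right_smul z b => simp only [map_smul, freeHom_right]
  | right_mul b b' => simp only [map_mul, freeHom_right]
  | right_one => simp only [map_one, freeHom_right]
  | interchange x b n b' x' h' =>
    simp only [map_mul, map_sum, freeHom_left, freeHom_right, h, h', TensorProduct.map_tmul,
      LinearMap.mul'_apply]
    rfl
  -- Starred relations hold automatically: the images of `a^*` and `a'^*` are formal adjoints of
  -- equal operators, and the inner product separates points.
  | star a a' _ ih =>
    ext v
    refine ext_inner_right ℂ fun w => ?_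
    rw [← inner_freeHom, ← inner_freeHom, ih]

/-- The universal property of the double for `*`-representations. -/
def Double.liftRep (ρ : StarRep B H) (σ : StarRep J H)
    (h : ∀ x b, σ x * ρ b = LinearMap.mul' ℂ _
      (TensorProduct.map ρ.hom.toLinearMap σ.hom.toLinearMap (Φ x b))) : StarRep (Double Φ) H where
  hom := RingQuot.liftAlgHom ℂ ⟨freeHom ρ σ, fun _ _ haa => freeHom_rel Φ ρ σ h haa⟩
  inner_hom a v w := by
    obtain ⟨a, rfl⟩ := Double.mk_surjective Φ a
    rw [Double.star_mk]
    unfold Double.mk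
    erw [RingQuot.liftAlgHom_mkAlgHom_apply, RingQuot.liftAlgHom_mkAlgHom_apply]
    exact inner_freeHom ρ σ a v w

theorem Double.liftRep_mk (ρ : StarRep B H) (σ : StarRep J H)
    (h : ∀ x b, σ x * ρ b = LinearMap.mul' ℂ _
      (TensorProduct.map ρ.hom.toLinearMap σ.hom.toLinearMap (Φ x b))) (a : FreeStar B J) :
    Double.liftRep Φ ρ σ h (Double.mk Φ a) = freeHom ρ σ a := by
  unfold Double.mk
  exact RingQuot.liftAlgHom_mkAlgHom_apply ..

theorem Double.liftRep_inclB (ρ : StarRep B H) (σ : StarRep J H)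
    (h : ∀ x b, σ x * ρ b = LinearMap.mul' ℂ _
      (TensorProduct.map ρ.hom.toLinearMap σ.hom.toLinearMap (Φ x b))) (b : B) :
    Double.liftRep Φ ρ σ h (Double.inclB Φ b) = ρ b :=
  (Double.liftRep_mk Φ ρ σ h _).trans (freeHom_left ρ σ b)

theorem Double.liftRep_inclJ (ρ : StarRep B H) (σ : StarRep J H)
    (h : ∀ x b, σ x * ρ b = LinearMap.mul' ℂ _
      (TensorProduct.map ρ.hom.toLinearMap σ.hom.toLinearMap (Φ x b))) (x : J) :
    Double.liftRep Φ ρ σ h (Double.inclJ Φ x) = σ x :=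
  (Double.liftRep_mk Φ ρ σ h _).trans (freeHom_right ρ σ x)

/-- Induction over the double. -/
theorem Double.induction {P : Double Φ → Prop} (h1 : ∀ z, P (algebraMap ℂ _ z))
    (h2 : ∀ b, P (inclB Φ b)) (h3 : ∀ x, P (inclJ Φ x)) (h4 : ∀ a b, P a → P b → P (a * b))
    (h5 : ∀ a b, P a → P b → P (a + b)) (a : Double Φ) : P a := by
  obtain ⟨a, rfl⟩ := Double.mk_surjective Φ a
  induction a using FreeStar.induction with
  | h1 z => rw [AlgHom.commutes]; exact h1 z
  | h2 b => exact h2 b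
  | h3 x => exact h3 x
  | h4 a b ha hb => rw [map_mul]; exact h4 _ _ ha hb
  | h5 a b ha hb => rw [map_add]; exact h5 _ _ ha hb

end DoubleLift

/-! ### The associated Doi–Koppinen module -/

section Association

variable {U : Type u} [Ring U] [StarRing U] [HopfAlgebra ℂ U] [StarModule ℂ U] [HopfStarAlgebra U]
variable {F : RepFamily.{u, v, w} U} {I : LeftCoideal U}
  {H : Type z} [NormedAddCommGroup H] [InnerProductSpace ℂ H]

theorem slice_evC_ext {s t : H ⊗[ℂ] quotC F I}
    (h : ∀ x, slice (evC F I x) s = slice (evC F I x) t) : s = t :=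
  slice_ext (fun x => evC F I x) (pairingC F I).sep h

/-- The tensor is `∑ eₖ ⊗ ⟨eₖ, π(-) v⟩` for an orthonormal basis of the cyclic subspace. The
isometric embedding into an `𝓕`-type representation of `U` shows that these coefficients are
restrictions to `I` of elements of `A`. -/
theorem IsFTypeI.exists_slice {π : StarRep I.carrier H} (hπ : IsFTypeI F π) (v : H) :
    ∃ t : H ⊗[ℂ] quotC F I, ∀ x, slice (evC F I x) t = π x v := by
  obtain ⟨hfin, G, _, _, ϑ, j, hϑ, hj⟩ := hπ v
  let V := π.orbit v
  have hv : v ∈ V := ⟨1, by simp⟩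
  let e := stdOrthonormalBasis ℂ V
  have hjV : ∀ w : V, j w ∈ ϑ.orbit (j ⟨v, hv⟩) := by
    rintro ⟨w, x, rfl⟩
    exact ⟨x, (hj x ⟨v, hv⟩).symm⟩
  have hA : ∀ k, coeff ϑ (j (e k)) (j ⟨v, hv⟩) ∈ coeffAlgebra F := fun k =>
    (hϑ (j ⟨v, hv⟩)).2 _ (hjV _) _ (hjV _)
  refine ⟨∑ k, (e k : H) ⊗ₜ projC F I ⟨_, hA k⟩, fun x => ?_⟩
  have h1 : ∀ k, evC F I x (projC F I ⟨_, hA k⟩) =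
      ⟪e k, (⟨π x v, π.mem_orbit v x hv⟩ : V)⟫_ℂ := by
    intro k
    rw [evC_projC, evA_apply, coeff_apply, ← hj x ⟨v, hv⟩]
    exact j.inner_map_map _ _
  simp only [map_sum, slice_tmul, h1]
  have h2 := congrArg (Subtype.val : V → H) (e.sum_repr' ⟨π x v, π.mem_orbit v x hv⟩)
  simpa using h2

/-- The coaction on a representation of `I` whose vectors have tensors representing their orbits. -/
def coactOf (π : StarRep I.carrier H)
    (hπ : ∀ v, ∃ t : H ⊗[ℂ] quotC F I, ∀ x, slice (evC F I x) t = π x v) :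
    H →ₗ[ℂ] H ⊗[ℂ] quotC F I where
  toFun v := (hπ v).choose
  map_add' v w := slice_evC_ext fun x => by
    rw [map_add, (hπ _).choose_spec, (hπ _).choose_spec, (hπ _).choose_spec, map_add]
  map_smul' z v := slice_evC_ext fun x => by
    rw [map_smul, (hπ _).choose_spec, (hπ _).choose_spec, map_smul, RingHom.id_apply]

theorem slice_coactOf (π : StarRep I.carrier H)
    (hπ : ∀ v, ∃ t : H ⊗[ℂ] quotC F I, ∀ x, slice (evC F I x) t = π x v) (x : I.carrier) (v : H) :
    slice (evC F I x) (coactOf π hπ v) = π x v := (hπ v).choose_spec x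

/-- Tested against a pair `(x, y)`, the two sides become `π(x) π(y) v` and `π(x y) v`; pairs
separate `X ⊗ X`. -/
theorem coassoc_of_slice {X : Type*} [AddCommGroup X] [Module ℂ X] [Coalgebra ℂ X]
    {R : Type*} [Ring R] [StarRing R] [Algebra ℂ R] (ev : R → X →ₗ[ℂ] ℂ)
    (hev : ∀ c : X, (∀ x, ev x c = 0) → c = 0)
    (hmul : ∀ c x y, LinearMap.mul' ℂ ℂ (TensorProduct.map (ev x) (ev y) (comul c)) = ev (x * y) c)
    (π : StarRep R H) (δ : H →ₗ[ℂ] H ⊗[ℂ] X) (hδ : ∀ x v, slice (ev x) (δ v) = π x v) (v : H) :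
    TensorProduct.assoc ℂ H X X (δ.rTensor X (δ v)) = (comul (R := ℂ)).lTensor H (δ v) := by
  refine slice_ext (fun x : R × R => LinearMap.mul' ℂ ℂ ∘ₗ TensorProduct.map (ev x.1) (ev x.2))
    (fun t ht => eq_zero_of_map ev ev hev hev t (fun x y => ht (x, y))) ?_
  rintro ⟨x, y⟩
  have h1 : ∀ t : H ⊗[ℂ] X, slice (LinearMap.mul' ℂ ℂ ∘ₗ TensorProduct.map (ev x) (ev y))
      (TensorProduct.assoc ℂ H _ _ (δ.rTensor _ t)) = π x (slice (ev y) t) := by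
    intro t
    induction t with
    | zero => simp
    | add a b ha hb => simp only [map_add, ha, hb]
    | tmul v c =>
      rw [LinearMap.rTensor_tmul, slice_tmul, map_smul, ← hδ]
      generalize δ v = t
      induction t with
      | zero => simp
      | add a b ha hb => simp only [map_add, TensorProduct.add_tmul, ha, hb, smul_add]
      | tmul v d => simp [smul_smul, mul_comm]
  have h2 : ∀ t : H ⊗[ℂ] X, slice (LinearMap.mul' ℂ ℂ ∘ₗ TensorProduct.map (ev x) (ev y))
        ((comul (R := ℂ)).lTensor H t) = slice (ev (x * y)) t := by
    intro t
    induction t with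
    | zero => simp
    | add a b ha hb => simp only [map_add, ha, hb]
    | tmul v c =>
      rw [LinearMap.lTensor_tmul, slice_tmul, slice_tmul, LinearMap.comp_apply, hmul]
  rw [h1, h2, hδ, hδ, map_mul, Module.End.mul_apply]

/-- The unitary comodule given by an `𝓕`-type `*`-representation of `I`. -/
def comodOf (π : StarRep I.carrier H)
    (hπ : ∀ v, ∃ t : H ⊗[ℂ] quotC F I, ∀ x, slice (evC F I x) t = π x v) :
    UnitaryComodule (quotC F I) H where
  coact := coactOf π hπ
  coassoc v := by
    exact coassoc_of_slice (fun x => evC F I x) (pairingC F I).sep (comulC_spec F I) π _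
      (slice_coactOf π hπ) v
  counit_coact v := (slice_coactOf π hπ 1 v).trans (by simp)
  unitary v w := by
    refine quotC_ext F I fun x => ?_
    have h1 : ∀ t : H ⊗[ℂ] quotC F I,
        evC F I x (TensorProduct.lid ℂ _ ((innerₛₗ ℂ v).rTensor _ t)) =
        ⟪v, slice (evC F I x) t⟫_ℂ := by
      intro t
      induction t with
      | zero => simp
      | add a b ha hb => simp only [map_add, inner_add_right, ha, hb]
      | tmul v d => simp [mul_comm]
    have h2 : ∀ t : H ⊗[ℂ] quotC F I,
        evC F I x (TensorProduct.lid ℂ _ (TensorProduct.map ((innerₛₗ ℂ).flip w) dag t)) =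
        ⟪slice (evC F I (star x)) t, w⟫_ℂ := by
      intro t
      induction t with
      | zero => simp
      | add a b ha hb => simp only [map_add, inner_add_left, ha, hb]
      | tmul v d =>
        rw [TensorProduct.map_tmul, TensorProduct.lid_tmul, slice_tmul, map_smul, inner_smul_left,
          smul_eq_mul, mul_comm]
        rfl
    rw [h1, h2, slice_coactOf, slice_coactOf, π.inner_hom]

theorem UnitaryDKModule.ext' {M N : UnitaryDKModule F I H} (h : ∀ b, M.rep b = N.rep b)
    (h' : ∀ v, M.comod.coact v = N.comod.coact v) : M = N := by
  obtain ⟨⟨δ, _, _, _⟩, ρ, _⟩ := M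
  obtain ⟨⟨δ', _, _, _⟩, ρ', _⟩ := N
  obtain rfl : ρ = ρ' := StarRep.ext_inner h
  obtain rfl : δ = δ' := LinearMap.ext h'
  rfl

/-- The slices of the coaction by `I` are prescribed by `θ`, and `I` separates the points of `C`. -/
theorem IsAssociated.unique {θ : StarRep (DBI F I) H} {M N : UnitaryDKModule F I H}
    (hM : IsAssociated θ M) (hN : IsAssociated θ N) : M = N :=
  UnitaryDKModule.ext' (fun b => LinearMap.ext fun v => (hM.1 b v).trans (hN.1 b v).symm)
    fun v => slice_evC_ext fun x => (hM.2 x v).symm.trans (hN.2 x v)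

/-- Slicing `b₍₀₎ v₍₀₎ ⊗ b₍₁₎ v₍₁₎` by `f` gives `b₍₀₎ (f ◁ b₍₁₎) v`. Leaving `J` and `σ` free lets
one computation serve both `I` and the full dual. -/
theorem slice_map₂ {B J : Type*} [AddCommGroup B] [Module ℂ B] [AddCommGroup J] [Module ℂ J]
    (ρ : B →ₗ[ℂ] Module.End ℂ H) (σ : J →ₗ[ℂ] Module.End ℂ H) (g : coeffAlgebra F →ₗ[ℂ] J)
    (f : quotC F I →ₗ[ℂ] ℂ) (s : H ⊗[ℂ] quotC F I) (v : H)
    (h : ∀ a, slice (f ∘ₗ actC F I a) s = σ (g a) v) (t : B ⊗[ℂ] coeffAlgebra F) :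
    slice f (TensorProduct.map₂ ρ (actC F I) t s) =
      LinearMap.mul' ℂ _ (TensorProduct.map ρ σ (g.lTensor B t)) v := by
  induction t with
  | zero => simp
  | add a b ha hb => simp only [map_add, LinearMap.add_apply, ha, hb]
  | tmul b a =>
    have h1 : ∀ s : H ⊗[ℂ] quotC F I, slice f (TensorProduct.map (ρ b) (actC F I a) s) =
        ρ b (slice (f ∘ₗ actC F I a) s) := by
      intro s
      induction s with
      | zero => simp
      | add a b ha hb => simp only [map_add, ha, hb]
      | tmul v c => simp
    rw [LinearMap.lTensor_tmul, TensorProduct.map_tmul, LinearMap.mul'_apply,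
      Module.End.mul_apply, ← h a]
    exact h1 s

theorem mulMap_eq {B : Type u} {J : Type v} [Ring B] [StarRing B] [Algebra ℂ B] [StarModule ℂ B]
    [Ring J] [StarRing J] [Algebra ℂ J] [StarModule ℂ J] (Φ : J → B → B ⊗[ℂ] J)
    (θ : StarRep (Double Φ) H) (t : B ⊗[ℂ] J) : θ (Double.mulMap Φ t) =
      LinearMap.mul' ℂ _ (TensorProduct.map (θ.comp (Double.inclB Φ)).hom.toLinearMap
        (θ.comp (Double.inclJ Φ)).hom.toLinearMap t) := by
  induction t with
  | zero => simp
  | add a b ha hb => simp only [map_add, ha, hb]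
  | tmul b x =>
    rw [Double.mulMap_tmul, map_mul]
    rfl

/-- The unitary Doi-Koppinen module associated to an `𝓕`-type `*`-representation of `D(B, I)`. -/
def dkModuleOf (θ : StarRep (DBI F I) H)
    (hθ : ∀ v, ∃ t : H ⊗[ℂ] quotC F I, ∀ x, slice (evC F I x) t = θ (inI F I x) v) :
    UnitaryDKModule F I H where
  comod := comodOf (θ.comp (inI F I)) hθ
  rep := θ.comp (inB F I)
  coact_rep b v := slice_evC_ext fun x => by
    -- After slicing by `x ∈ I`, the Doi–Koppinen condition is the relation `x b = τ(b₍₁₎, x₍₋₁₎)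
    -- b₍₀₎ x₍₀₎` applied to `v`.
    refine (slice_coactOf (θ.comp (inI F I)) hθ x _).trans (Eq.trans ?_
      (slice_map₂ (θ.comp (inB F I)).hom.toLinearMap (θ.comp (inI F I)).hom.toLinearMap
        (actI I x ∘ₗ inclLin (coeffAlgebra F)) (evC F I x) _ v
        (fun a => slice_coactOf (θ.comp (inI F I)) hθ (actI I x a) v) (coactB F I b)).symm)
    refine Eq.trans ?_ (congrArg (fun T : Module.End ℂ H => T v)
      (mulMap_eq (interchangeI F I) θ (interchangeI F I x b)))
    rw [← Double.interchange, map_mul]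
    rfl

theorem isAssociated_dkModuleOf (θ : StarRep (DBI F I) H)
    (hθ : ∀ v, ∃ t : H ⊗[ℂ] quotC F I, ∀ x, slice (evC F I x) t = θ (inI F I x) v) :
    IsAssociated θ (dkModuleOf θ hθ) :=
  ⟨fun _ _ => rfl, fun x v => (slice_coactOf (θ.comp (inI F I)) hθ x v).symm⟩

theorem existsUnique_isAssociated {θ : StarRep (DBI F I) H} (hθ : IsFType θ) :
    ∃! M : UnitaryDKModule F I H, IsAssociated θ M :=
  ⟨dkModuleOf θ (IsFTypeI.exists_slice hθ), isAssociated_dkModuleOf θ _,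
    fun _ hM => hM.unique (isAssociated_dkModuleOf θ _)⟩

namespace UnitaryDKModule

variable (M : UnitaryDKModule F I H)

/-- The Doi–Koppinen condition can be sliced by any functional on `C`, so the interchange relation
extends from `I` to the full dual. -/
theorem rep_mul_rep (x : FullDual (quotC F I)) (b : algB F I) :
    M.comod.rep x * M.rep b = LinearMap.mul' ℂ _ (TensorProduct.map M.rep.hom.toLinearMap
      M.comod.rep.hom.toLinearMap (fullInterchange F I x b)) := by
  ext v
  rw [Module.End.mul_apply]
  change slice x.toFun (M.comod.coact (M.rep b v)) = _
  rw [M.coact_rep]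
  refine slice_map₂ _ M.comod.rep.hom.toLinearMap (actDual F I x) x.toFun _ v (fun a => ?_) _
  exact congrArg (fun f => slice f (M.comod.coact v))
    (LinearMap.ext fun c => (actDual_apply F I x a c).symm)

/-- The `*`-representation of the full double on a unitary Doi-Koppinen module. -/
def fullRep : StarRep (FullDBI F I) H :=
  Double.liftRep (fullInterchange F I) M.rep M.comod.rep M.rep_mul_rep

theorem fullRep_fullB (b : algB F I) : M.fullRep (fullB F I b) = M.rep b :=
  Double.liftRep_inclB _ _ _ _ b

theorem fullRep_fullJ (x : FullDual (quotC F I)) : M.fullRep (fullJ F I x) = M.comod.rep x :=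
  Double.liftRep_inclJ _ _ _ _ x

/-- It suffices to bound products `b x`: `b` is bounded by the row argument, and `x` because it
generates a finite-dimensional ideal. -/
theorem isBdd_fullRep (d : RedDouble F I) : IsBdd (M.fullRep d.1) := by
  obtain ⟨d, hd⟩ := d
  change d ∈ prodSpan _ _ at hd
  change IsBdd (M.fullRep d)
  unfold prodSpan at hd
  induction hd using Submodule.span_induction with
  | zero => rw [map_zero]; exact .zero
  | add a b _ _ ha hb => rw [map_add]; exact ha.add hb
  | smul z a _ ha => rw [map_smul]; exact ha.smul z
  | mem a ha =>
    obtain ⟨b, x, hx, rfl⟩ := ha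
    rw [map_mul]
    refine IsBdd.mul ?_ ?_
    · exact M.fullRep_fullB b ▸ isBdd_algB F I M.rep b
    · exact M.fullRep_fullJ x ▸ M.comod.isBdd_rep hx

end UnitaryDKModule

end Association

/-! ### Extension of bounded operators to the completion -/

section Completion

open UniformSpace

variable {H : Type z} [NormedAddCommGroup H] [InnerProductSpace ℂ H]

/-- The extension of a bounded operator to the completion. -/
def complExt (T : Module.End ℂ H) (hT : IsBdd T) : Completion H →L[ℂ] Completion H :=
  (T.mkContinuousOfExistsBound hT).completion

theorem complExt_coe (T : Module.End ℂ H) (hT : IsBdd T) (v : H) :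
    complExt T hT (v : Completion H) = (T v : Completion H) :=
  ContinuousLinearMap.completion_apply_coe _ v

theorem completion_clm_ext {S T : Completion H →L[ℂ] Completion H}
    (h : ∀ v : H, S (v : Completion H) = T (v : Completion H)) : S = T :=
  ContinuousLinearMap.ext fun x => Completion.induction_on x
    (isClosed_eq S.continuous T.continuous) h

theorem complExt_star {S T : Module.End ℂ H} (hS : IsBdd S) (hT : IsBdd T)
    (h : ∀ v w, ⟪v, T w⟫_ℂ = ⟪S v, w⟫_ℂ) : complExt S hS = star (complExt T hT) := by
  rw [ContinuousLinearMap.star_eq_adjoint, ContinuousLinearMap.eq_adjoint_iff]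
  intro x y
  refine Completion.induction_on₂ x y (isClosed_eq ?_ ?_) fun v w => ?_
  · exact ((complExt S hS).continuous.comp continuous_fst).inner continuous_snd
  · exact continuous_fst.inner ((complExt T hT).continuous.comp continuous_snd)
  · rw [complExt_coe, complExt_coe, Completion.inner_coe, Completion.inner_coe, h]

end Completion

/-! ### Passage to the reduced double and uniqueness of intertwined data -/

section Restriction

variable {U : Type u} [Ring U] [StarRing U] [HopfAlgebra ℂ U] [StarModule ℂ U] [HopfStarAlgebra U]
variable {F : RepFamily.{u, v, w} U} {I : LeftCoideal U}

theorem RedDouble.induction {P : RedDouble F I → Prop} (h0 : P 0)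
    (hadd : ∀ a b, P a → P b → P (a + b)) (hsmul : ∀ (c : ℂ) a, P a → P (c • a))
    (h : ∀ b x (hx : x ∈ restrictedDual (quotC F I)), P (redMul F I b x hx)) (d : RedDouble F I) :
    P d := by
  obtain ⟨d, hd⟩ := d
  have hd' : d ∈ prodSpan (fullInterchange F I) (restrictedDual (quotC F I)) := hd
  unfold prodSpan at hd'
  induction hd' using Submodule.span_induction with
  | zero => exact h0
  | add a b ha hb iha ihb => exact hadd ⟨a, ha⟩ ⟨b, hb⟩ (iha ha) (ihb hb)
  | smul z a ha iha => exact hsmul z ⟨a, ha⟩ (iha ha)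
  | mem a ha =>
    obtain ⟨b, x, hx, rfl⟩ := ha
    exact h b x hx

theorem redDouble_hom_ext {A : Type*} [NonUnitalRing A] [StarRing A] [Module ℂ A]
    {π π' : RedDouble F I →⋆ₙₐ[ℂ] A}
    (h : ∀ b x (hx : x ∈ restrictedDual (quotC F I)), π (redMul F I b x hx) =
      π' (redMul F I b x hx)) : π = π' := by
  ext d
  induction d using RedDouble.induction with
  | h0 => rw [map_zero, map_zero]
  | hadd a b ha hb => rw [map_add, map_add, ha, hb]
  | hsmul c a ha => rw [map_smul, map_smul, ha]
  | h b x hx => exact h b x hx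

variable {H : Type z} [NormedAddCommGroup H] [InnerProductSpace ℂ H]

open UniformSpace in
/-- The `*`-representation of the reduced double on the completion of a unitary Doi-Koppinen
module. -/
def UnitaryDKModule.redRep (M : UnitaryDKModule F I H) :
    RedDouble F I →⋆ₙₐ[ℂ] (Completion H →L[ℂ] Completion H) where
  toFun d := complExt (M.fullRep d.1) (M.isBdd_fullRep d)
  map_smul' c d := completion_clm_ext fun v => by
    rw [complExt_coe]
    refine (congrArg (fun T : Module.End ℂ H => ((T v : H) : Completion H))
      (map_smul M.fullRep.hom c d.1)).trans ?_
    refine (UniformSpace.Completion.coe_smul c _).trans ?_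
    exact congrArg (c • ·) (complExt_coe (M.fullRep d.1) (M.isBdd_fullRep d) v).symm
  map_zero' := completion_clm_ext fun v => by
    rw [complExt_coe]
    refine (congrArg (fun T : Module.End ℂ H => ((T v : H) : Completion H))
      (map_zero M.fullRep.hom)).trans ?_
    simp
  map_add' d e := completion_clm_ext fun v => by
    rw [complExt_coe]
    refine (congrArg (fun T : Module.End ℂ H => ((T v : H) : Completion H))
      (map_add M.fullRep.hom d.1 e.1)).trans ?_
    refine (UniformSpace.Completion.coe_add _ _).trans ?_
    exact congrArg₂ (· + ·) (complExt_coe (M.fullRep d.1) (M.isBdd_fullRep d) v).symm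
      (complExt_coe (M.fullRep e.1) (M.isBdd_fullRep e) v).symm
  map_mul' d e := completion_clm_ext fun v => by
    rw [complExt_coe]
    refine (congrArg (fun T : Module.End ℂ H => ((T v : H) : Completion H))
      (M.fullRep.hom.map_mul d.1 e.1)).trans ?_
    simp [complExt_coe]
  map_star' d := complExt_star _ _ fun v w => M.fullRep.inner_hom d.1 v w

theorem UnitaryDKModule.redRep_coe (M : UnitaryDKModule F I H) (d : RedDouble F I) (v : H) :
    M.redRep d (v : UniformSpace.Completion H) = (M.fullRep d.1 v : UniformSpace.Completion H) :=
  complExt_coe _ _ v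

theorem UnitaryDKModule.fullRep_redMul (M : UnitaryDKModule F I H) (b : algB F I)
    (x : FullDual (quotC F I)) (hx : x ∈ restrictedDual (quotC F I)) (v : H) :
    M.fullRep (redMul F I b x hx).1 v = M.rep b (M.comod.rep x v) := by
  refine (congrArg (fun T : Module.End ℂ H => T v)
    (map_mul M.fullRep.hom (fullB F I b) (fullJ F I x))).trans ?_
  exact congrArg₂ (fun S T : Module.End ℂ H => S (T v)) (M.fullRep_fullB b) (M.fullRep_fullJ x)

/-- Each vector of a unitary `C`-comodule is fixed by a support projection. -/
theorem UnitaryComodule.exists_support_eq (M : UnitaryComodule (quotC F I) H) (v : H) :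
    ∃ D p, IsSupport D p ∧ M.rep p v = v := by
  obtain ⟨S, hS, h⟩ := M.exists_rep_eq v
  obtain ⟨D, p, hD, hp⟩ := exists_isSupport F I S
  exact ⟨D, p, hp, h D p hp hD⟩

open UniformSpace in
-- Each vector of the dense subspace `H` is fixed by a support projection and so lies in the image
-- of the reduced double.
theorem UnitaryDKModule.isNondegenerate_redRep (M : UnitaryDKModule F I H) :
    IsNondegenerate M.redRep := by
  refine Dense.mono ?_ (Completion.denseRange_coe (α := H))
  rintro _ ⟨v, rfl⟩
  obtain ⟨D, p, hp, hv⟩ := M.comod.exists_support_eq v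
  refine Submodule.subset_span ⟨redMul F I 1 p hp.mem, v, ?_⟩
  rw [M.redRep_coe, M.fullRep_redMul, hv, map_one, Module.End.one_apply]

open UniformSpace in
-- Uniqueness holds because intertwining prescribes every `π(b x)` on the dense subspace `H`, the
-- coaction being determined by `θ`.
theorem existsUnique_redRep {θ : StarRep (DBI F I) H} (hθ : IsFType θ) :
    ∃! π : RedDouble F I →⋆ₙₐ[ℂ] (Completion H →L[ℂ] Completion H),
      IsNondegenerate π ∧ Intertwines θ π Completion.toComplₗᵢ := by
  obtain ⟨M, hM, -⟩ := existsUnique_isAssociated hθ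
  have key : ∀ b x (hx : x ∈ restrictedDual (quotC F I)) (v : H),
      M.redRep (redMul F I b x hx) (v : Completion H) = (θ (inB F I b) (M.comod.rep x v) : H) := by
    intro b x hx v
    rw [M.redRep_coe, M.fullRep_redMul, hM.1]
  refine ⟨M.redRep, ⟨M.isNondegenerate_redRep, M, hM, key⟩, ?_⟩
  rintro π ⟨-, N, hN, h⟩
  obtain rfl := hN.unique hM
  exact redDouble_hom_ext fun b x hx => completion_clm_ext fun v =>
    (h b x hx v).trans (key b x hx v).symm

variable {H' : Type z} [NormedAddCommGroup H'] [InnerProductSpace ℂ H']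
  {K : Type z} [NormedAddCommGroup K] [InnerProductSpace ℂ K] [CompleteSpace K]

/-- The functional on `C` given by an element of `I`. -/
def evDual (F : RepFamily.{u, v, w} U) (I : LeftCoideal U) (x : I.carrier) :
    FullDual (quotC F I) := FullDual.mk (evC F I x)

theorem IsAssociated.rep_evDual {θ : StarRep (DBI F I) H} {M : UnitaryDKModule F I H}
    (hM : IsAssociated θ M) (x : I.carrier) (v : H) :
    M.comod.rep (evDual F I x) v = θ (inI F I x) v := by
  rw [hM.2, UnitaryComodule.rep_apply, evDual, FullDual.toFun_mk]

/-- The action of `D(B, I)` is determined by an intertwiner into a representation of the reduced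
double. -/
theorem Intertwines.apply_eq {θ : StarRep (DBI F I) H} {θ' : StarRep (DBI F I) H'}
    {π : RedDouble F I →⋆ₙₐ[ℂ] (K →L[ℂ] K)} {j : H →ₗᵢ[ℂ] K} {j' : H' →ₗᵢ[ℂ] K}
    (h : Intertwines θ π j) (h' : Intertwines θ' π j') (d : DBI F I) {v : H} {v' : H'}
    (hv : j v = j' v') : j (θ d v) = j' (θ' d v') := by
  obtain ⟨M, hM, h⟩ := h
  obtain ⟨M', hM', h'⟩ := h'
  change ∀ b x hx v, π (redMul F I b x hx) (j v) = j (θ (inB F I b) (M.comod.rep x v)) at h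
  change ∀ b x hx v, π (redMul F I b x hx) (j' v) = j' (θ' (inB F I b) (M'.comod.rep x v)) at h'
  have h1 : ∀ x hx v, π (redMul F I 1 x hx) (j v) = j (M.comod.rep x v) := fun x hx v => by
    rw [h, map_one, map_one, Module.End.one_apply]
  have h1' : ∀ x hx v, π (redMul F I 1 x hx) (j' v) = j' (M'.comod.rep x v) := fun x hx v => by
    rw [h', map_one, map_one, Module.End.one_apply]
  -- A projection fixing `v` fixes `j v = j' v'` under `π`, hence fixes `v'`. The actions of `b` and
  -- `x` are then those of `b p` and `x p`, which lie in the reduced double and are seen by `π`.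
  have hp : ∀ v v', j v = j' v' → ∃ p ∈ restrictedDual (quotC F I), M.comod.rep p v = v ∧
      M'.comod.rep p v' = v' := by
    intro v v' hv
    obtain ⟨D, p, hp, hpv⟩ := M.comod.exists_support_eq v
    refine ⟨p, hp.mem, hpv, j'.injective ?_⟩
    rw [← h1' p hp.mem, ← hv, h1, hpv]
  induction d using Double.induction generalizing v v' with
  | h1 z =>
    rw [AlgHom.commutes, AlgHom.commutes, Module.algebraMap_end_apply, Module.algebraMap_end_apply,
      map_smul, map_smul, hv]
  | h2 b =>
    obtain ⟨p, hpJ, hpv, hpv'⟩ := hp v v' hv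
    have h2 := h b p hpJ v
    have h2' := h' b p hpJ v'
    rw [hpv] at h2
    rw [hpv', ← hv] at h2'
    exact h2.symm.trans h2'
  | h3 x =>
    obtain ⟨p, hpJ, hpv, hpv'⟩ := hp v v' hv
    have h2 := h1 (evDual F I x * p) (restrictedDual_mul_left _ hpJ) v
    have h2' := h1' (evDual F I x * p) (restrictedDual_mul_left _ hpJ) v'
    rw [map_mul, Module.End.mul_apply, hpv, hM.rep_evDual] at h2
    rw [map_mul, Module.End.mul_apply, hpv', hM'.rep_evDual, ← hv] at h2'
    exact h2.symm.trans h2'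
  | h4 a b ha hb =>
    rw [map_mul, map_mul]
    exact ha (hb hv)
  | h5 a b ha hb =>
    rw [map_add, map_add, LinearMap.add_apply, LinearMap.add_apply, map_add, map_add, ha hv, hb hv]

theorem redMul_one_mul (x y : FullDual (quotC F I)) (hx : x ∈ restrictedDual (quotC F I))
    (hy : y ∈ restrictedDual (quotC F I)) :
    redMul F I 1 x hx * redMul F I 1 y hy = redMul F I 1 (x * y) (restrictedDual_mul_left _ hy) :=
  Subtype.ext (by
    change fullB F I 1 * fullJ F I x * (fullB F I 1 * fullJ F I y) = fullB F I 1 * fullJ F I (x * y)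
    rw [map_one, one_mul, one_mul, one_mul, map_mul])

/-- Elements of the restricted dual are fixed by a support projection. -/
theorem exists_support_mul_eq {x : FullDual (quotC F I)} (hx : x ∈ restrictedDual (quotC F I)) :
    ∃ D p, IsSupport D p ∧ p * x = x := by
  obtain ⟨S, hS, h⟩ := exists_mul_eq_of_mem_restrictedDual hx
  obtain ⟨D, p, hD, hp⟩ := exists_isSupport F I S
  exact ⟨D, p, hp, h D p hp hD⟩

/-- Vectors of `H` lie in the core as they are fixed by support projections. For the converse, a
vector `u = π(x) k` satisfies `π(p) u = u` for a support projection `p` with `p x = x`. If `j vₙ →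
u`, then `j(p vₙ) → u`, and all `p vₙ` lie in the subspace of the subcoalgebra `D` of `p`. Local
completeness makes the image of this subspace closed, so it contains `u`. -/
theorem Intertwines.range_eq_core {θ : StarRep (DBI F I) H} (hθ : IsLocallyComplete θ)
    {π : RedDouble F I →⋆ₙₐ[ℂ] (K →L[ℂ] K)} {j : H →ₗᵢ[ℂ] K} (hj : DenseRange j)
    (h : Intertwines θ π j) : LinearMap.range j.toLinearMap = core π := by
  obtain ⟨M, hM, h⟩ := h
  obtain ⟨M', hM', hc⟩ := hθ
  obtain rfl := hM'.unique hM
  change ∀ b x hx v, π (redMul F I b x hx) (j v) = j (θ (inB F I b) (M'.comod.rep x v)) at h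
  have h1 : ∀ x hx v, π (redMul F I 1 x hx) (j v) = j (M'.comod.rep x v) := fun x hx v => by
    rw [h, map_one, map_one, Module.End.one_apply]
  refine le_antisymm ?_ (Submodule.span_le.mpr ?_)
  · rintro _ ⟨v, rfl⟩
    obtain ⟨D, p, hp, hpv⟩ := M'.comod.exists_support_eq v
    refine Submodule.subset_span ⟨p, hp.mem, j v, ?_⟩
    rw [h1, hpv]
    rfl
  · rintro _ ⟨x, hx, k, rfl⟩
    obtain ⟨D, p, hp, hpx⟩ := exists_support_mul_eq hx
    set u := π (redMul F I 1 x hx) k with hu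
    have hpu : π (redMul F I 1 p hp.mem) u = u := by
      rw [hu, ← mul_apply_eq_comp, ← map_mul, redMul_one_mul]
      simp only [hpx]
    let V := {v : H | M'.comod.coact v ∈ LinearMap.range (D.subtype.lTensor H)}
    have hV : IsComplete V := hc D hp.finite hp.comul_mem
    have hclosed : IsClosed (j '' V) :=
      ((isComplete_image_iff j.isometry.isUniformInducing).mpr hV).isClosed
    have hmem : u ∈ j '' V := by
      rw [← hclosed.closure_eq, ← hpu]
      -- `π(p)` maps `j(H)` into `j(V)`: a functional `y` vanishing on `D` kills `p v`, because `y p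
      -- = 0`.
      refine map_mem_closure (π (redMul F I 1 p hp.mem)).continuous (hj u) ?_
      rintro _ ⟨v, rfl⟩
      refine ⟨M'.comod.rep p v, (M'.comod.mem_range_iff D _).mpr fun y hy => ?_, (h1 _ _ _).symm⟩
      rw [← Module.End.mul_apply, ← map_mul, hp.eq_zero_mul y hy, map_zero, LinearMap.zero_apply]
    obtain ⟨v, -, hv⟩ := hmem
    exact ⟨v, hv⟩

end Restriction

/-! ### Isometric embedding of quotients by polar decomposition -/

section Embedding

variable {R : Type u} [Ring R] [StarRing R] [Algebra ℂ R]

/-- The `*`-representation on a cyclic submodule. -/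
def StarRep.orbitRep {H : Type v} [NormedAddCommGroup H] [InnerProductSpace ℂ H] (π : StarRep R H)
    (ξ : H) : StarRep R (π.orbit ξ) where
  hom := AlgHom.ofLinearMap
    { toFun := fun a => (π a).restrict fun _ hv => π.mem_orbit ξ a hv
      map_add' := fun a b => by ext v; simp
      map_smul' := fun z a => by ext v; simp }
    (by ext v; simp) (fun a b => by ext v; simp)
  inner_hom a v w := π.inner_hom a v w

/-- A finite-dimensional quotient of a finite-dimensional `*`-representation embeds isometrically
into it. -/
theorem exists_isometry_of_surjective {M : Type v} [NormedAddCommGroup M] [InnerProductSpace ℂ M]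
    [FiniteDimensional ℂ M] {V : Type w} [NormedAddCommGroup V] [InnerProductSpace ℂ V]
    [FiniteDimensional ℂ V] (μ : StarRep R M) (ν : StarRep R V) (q : M →ₗ[ℂ] V)
    (hq : Function.Surjective q) (h : ∀ x m, q (μ x m) = ν x (q m)) :
    ∃ j : V →ₗᵢ[ℂ] M, ∀ x v, j (ν x v) = μ x (j v) := by
  -- The adjoint of an equivariant map between `*`-representations is equivariant. It is injective
  -- because `q` is surjective, and its polar part is the isometry sought.
  let r := LinearMap.adjoint q
  have hr : ∀ x v, r (ν x v) = μ x (r v) := fun x v => by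
    refine ext_inner_left ℂ fun m => ?_
    rw [LinearMap.adjoint_inner_right, ν.inner_hom, ← h, ← LinearMap.adjoint_inner_right,
      ← μ.inner_hom]
  let T : Module.End ℂ V := q ∘ₗ r
  have hT : T.IsPositive := LinearMap.isPositive_self_comp_adjoint q
  have hinj : Function.Injective T := by
    rw [← LinearMap.ker_eq_bot, LinearMap.ker_eq_bot']
    intro v hv
    have h1 : r v = 0 := by
      rw [← inner_self_eq_zero (𝕜 := ℂ), LinearMap.adjoint_inner_left]
      change ⟪v, T v⟫_ℂ = 0
      rw [hv, inner_zero_right]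
    obtain ⟨m, rfl⟩ := hq v
    rw [← inner_self_eq_zero (𝕜 := ℂ), ← LinearMap.adjoint_inner_left]
    change ⟪r (q m), m⟫_ℂ = 0
    rw [h1, inner_zero_left]
  obtain ⟨s, hs, hsT, hsc⟩ := exists_sqrt
    ((Module.End.isUnit_iff T).mpr ⟨hinj, LinearMap.surjective_of_injective hinj⟩).unit hT
  have hsT' : ∀ v, s.1 (s.1 v) = q (r v) := fun v =>
    LinearMap.congr_fun (congrArg Units.val hsT) v
  have hsi : ∀ v, s.1 (s⁻¹.1 v) = v := fun v => LinearMap.congr_fun s.mul_inv v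
  have hsi' : ∀ v, s⁻¹.1 (s.1 v) = v := fun v => LinearMap.congr_fun s.inv_mul v
  have hc : ∀ x v, s⁻¹.1 (ν x v) = ν x (s⁻¹.1 v) := fun x v => by
    have h1 : Commute (ν x) s.1 := hsc _ <| LinearMap.ext fun v => by
      change ν x (q (r v)) = q (r (ν x v))
      rw [hr, h]
    have h2 := LinearMap.congr_fun h1.eq (s⁻¹.1 v)
    rw [Module.End.mul_apply, Module.End.mul_apply, hsi] at h2
    rw [h2, hsi']
  -- With `s² = q q^*`, the map `q^* s⁻¹` is isometric, as `⟨s⁻¹ v, q q^* s⁻¹ v⟩ = ⟨v, v⟩`. It is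
  -- equivariant because `s` commutes with everything commuting with `q q^*`.
  refine ⟨⟨r ∘ₗ s⁻¹.1, fun v => ?_⟩, fun x v => ?_⟩
  · rw [← sq_eq_sq₀ (norm_nonneg _) (norm_nonneg _)]
    have : ((‖(r ∘ₗ s⁻¹.1) v‖ : ℂ)) ^ 2 = (‖v‖ : ℂ) ^ 2 := by
      have h1 := inner_self_eq_norm_sq_to_K (𝕜 := ℂ) ((r ∘ₗ s⁻¹.1) v)
      have h2 := inner_self_eq_norm_sq_to_K (𝕜 := ℂ) v
      refine h1.symm.trans (Eq.trans ?_ h2)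
      rw [LinearMap.comp_apply, LinearMap.adjoint_inner_left, ← hsT', hsi, ← hs, hsi]
    exact_mod_cast this
  · change r (s⁻¹.1 (ν x v)) = μ x (r (s⁻¹.1 v))
    rw [hc, hr]

end Embedding

/-! ### Recognition of `𝓕`-type representations -/

section FType

variable {U : Type u} [Ring U] [StarRing U] [HopfAlgebra ℂ U] [StarModule ℂ U] [HopfStarAlgebra U]
variable {F : RepFamily.{u, v, w} U} {I : LeftCoideal U}
variable {H : Type z} [NormedAddCommGroup H] [InnerProductSpace ℂ H]

/-- The restriction to `I` of a `*`-representation of `U`. -/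
def StarRep.restrictI {G : Type z} [NormedAddCommGroup G] [InnerProductSpace ℂ G]
    (ϑ : StarRep U G) (I : LeftCoideal U) : StarRep I.carrier G :=
  ϑ.comp I.carrier.subtype

/-- A `*`-representation of `I` with coefficients in `C` is of `𝓕`-type. -/
theorem isFTypeI_of_slice {π : StarRep I.carrier H}
    (hπ : ∀ v, ∃ t : H ⊗[ℂ] quotC F I, ∀ x, slice (evC F I x) t = π x v) : IsFTypeI F π := by
  classical
  intro ξ
  obtain ⟨t, ht⟩ := hπ ξ
  obtain ⟨S, hS⟩ := TensorProduct.exists_finset t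
  choose g hg using projC_surjective F I
  obtain ⟨G, _, _, _, ϑ, ζ, hϑ, hc⟩ := exists_rep_of_finite.{u, v, w, z} F
    (g '' (Prod.snd '' (S : Set (H × quotC F I)))) ((S.finite_toSet.image _).image _)
  have hc' : ∀ p : S, ∃ η, (g p.1.2 : FullDual U) = coeff ϑ η ζ := fun p =>
    hc _ ⟨_, ⟨p, p.2, rfl⟩, rfl⟩
  choose η hη using hc'
  -- If `t = ∑ h ⊗ c` with each `c` the coefficient of some `η` and the common vector `ζ`, then `w ↦
  -- ∑ ⟨η, w⟩ h` sends `ϑ(x) ζ` to `π(x) ξ`.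
  let T : G →ₗ[ℂ] H := ∑ p : S, (innerₛₗ ℂ (η p)).smulRight p.1.1
  have hT : ∀ x : I.carrier, T (ϑ (x : U) ζ) = π x ξ := fun x => by
    rw [← ht, hS, map_sum, ← Finset.sum_coe_sort S, LinearMap.sum_apply]
    refine Finset.sum_congr rfl fun p _ => ?_
    rw [slice_tmul, ← hg p.1.2, evC_projC, evA_apply, hη, coeff_apply]
    rfl
  let μ := ϑ.restrictI I
  -- Equivariance is only available on the cyclic subspace of `ζ` under `I`. This suffices, since
  -- that subspace maps onto the cyclic subspace of `ξ`, which therefore embeds isometrically into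
  -- it.
  have hT' : ∀ (x : I.carrier), ∀ m ∈ μ.orbit ζ, T (μ x m) = π x (T m) := by
    rintro x _ ⟨y, rfl⟩
    change T (μ x (μ y ζ)) = π x (T (ϑ (y : U) ζ))
    rw [hT, ← Module.End.mul_apply, ← map_mul, ← Module.End.mul_apply, ← map_mul]
    exact hT (x * y)
  have hmem : ∀ m ∈ μ.orbit ζ, T m ∈ π.orbit ξ := by
    rintro _ ⟨y, rfl⟩
    exact ⟨y, (hT y).symm⟩
  let q : μ.orbit ζ →ₗ[ℂ] π.orbit ξ := T.restrict hmem
  have hq : Function.Surjective q := by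
    rintro ⟨_, y, rfl⟩
    exact ⟨⟨μ y ζ, y, rfl⟩, Subtype.ext (hT y)⟩
  have hfin : FiniteDimensional ℂ (π.orbit ξ) := Module.Finite.of_surjective q hq
  obtain ⟨j, hj⟩ := exists_isometry_of_surjective (μ.orbitRep ζ) (π.orbitRep ξ) q hq
    fun x m => Subtype.ext (hT' x m m.2)
  exact ⟨hfin, G, _, _, ϑ, (μ.orbit ζ).subtypeₗᵢ.comp j,
    fun ξ => ⟨inferInstance, fun v _ w _ => hϑ v w⟩, fun x v => congrArg Subtype.val (hj x v)⟩

end FType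

/-! ### The full double acts on the core -/

section Core

variable {U : Type u} [Ring U] [StarRing U] [HopfAlgebra ℂ U] [StarModule ℂ U] [HopfStarAlgebra U]
variable {F : RepFamily.{u, v, w} U} {I : LeftCoideal U}

/-- The reduced double is a right ideal: `B` on the right is moved past `𝓘` by the interchange
relation, and `𝓘` is stable under the action of `A` and is an ideal of the full dual. -/
theorem mul_mem_reducedDouble (z : FullDBI F I) {d : FullDBI F I} (hd : d ∈ reducedDouble F I) :
    d * z ∈ reducedDouble F I := by
  induction z using Double.induction generalizing d with
  | h1 c =>
    rw [Algebra.algebraMap_eq_smul_one, mul_smul_comm, mul_one]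
    exact (reducedDouble F I).smul_mem c hd
  | h2 b =>
    change d ∈ prodSpan (fullInterchange F I) (restrictedDual (quotC F I)) at hd
    change d * _ ∈ prodSpan (fullInterchange F I) (restrictedDual (quotC F I))
    unfold prodSpan at hd
    induction hd using Submodule.span_induction with
    | zero => rw [zero_mul]; exact zero_mem _
    | add d d' _ _ hd hd' => rw [add_mul]; exact add_mem hd hd'
    | smul z d _ hd => rw [smul_mul_assoc]; exact Submodule.smul_mem _ _ hd
    | mem d hd =>
      obtain ⟨b', x, hx, rfl⟩ := hd
      rw [mul_assoc, Double.interchange]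
      exact inclB_mul_mem _ _ (mulMap_act_mem F I hx b)
  | h3 y => exact mul_inclJ_mem _ (fun x hx y => restrictedDual_mul_right y hx) y hd
  | h4 a b ha hb => rw [← mul_assoc]; exact hb (ha hd)
  | h5 a b ha hb => rw [mul_add]; exact add_mem (ha hd) (hb hd)

/-- The product `d z` of an element of the reduced double and an element of the full double. -/
def RedDouble.mulRight (d : RedDouble F I) (z : FullDBI F I) : RedDouble F I :=
  ⟨d.1 * z, mul_mem_reducedDouble z d.2⟩

/-- The product `z d` of an element of the full double and an element of the reduced double. -/
def RedDouble.mulLeft (z : FullDBI F I) (d : RedDouble F I) : RedDouble F I :=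
  ⟨z * d.1, by
    -- A right ideal stable under `*` is also a left ideal.
    have h := star_mem (mul_mem_reducedDouble (star z) (star_mem d.2))
    rwa [star_mul, star_star, star_star] at h⟩

/-- For `d = b x` this is the local unit of `x`, moved to the right by centrality. The subspace `S`,
rather than one projection, is recorded so that finitely many elements share a unit. -/
theorem RedDouble.exists_mul_eq (d : RedDouble F I) : ∃ S : Submodule ℂ (quotC F I),
    FiniteDimensional ℂ S ∧ ∀ D p, IsSupport D p → S ≤ D → d.1 * fullJ F I p = d.1 := by
  induction d using RedDouble.induction with
  | h0 => exact ⟨⊥, inferInstance, fun _ _ _ _ => zero_mul _⟩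
  | hadd a b ha hb =>
    obtain ⟨S, hS, hS'⟩ := ha
    obtain ⟨T, hT, hT'⟩ := hb
    refine ⟨S ⊔ T, inferInstance, fun D p hp h => ?_⟩
    change (a.1 + b.1) * _ = a.1 + b.1
    rw [add_mul, hS' D p hp (le_sup_left.trans h), hT' D p hp (le_sup_right.trans h)]
  | hsmul c a ha =>
    obtain ⟨S, hS, hS'⟩ := ha
    refine ⟨S, hS, fun D p hp h => ?_⟩
    change (c • a.1) * _ = c • a.1
    rw [smul_mul_assoc, hS' D p hp h]
  | h b x hx =>
    obtain ⟨S, hS, h⟩ := exists_mul_eq_of_mem_restrictedDual hx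
    refine ⟨S, hS, fun D p hp hD => ?_⟩
    change fullB F I b * fullJ F I x * fullJ F I p = fullB F I b * fullJ F I x
    have hxp : x * p = x := (hp.commute x).trans (h D p hp hD)
    rw [mul_assoc]
    exact congrArg (fullB F I b * ·)
      ((map_mul (fullJ F I) x p).symm.trans (congrArg (fullJ F I) hxp))

theorem RedDouble.star_redMul_one {p : FullDual (quotC F I)} (hp : p ∈ restrictedDual (quotC F I))
    (h : star p = p) : star (redMul F I 1 p hp) = redMul F I 1 p hp := Subtype.ext <| by
  change star (fullB F I 1 * fullJ F I p) = fullB F I 1 * fullJ F I p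
  rw [map_one, one_mul, ← map_star, h]

theorem RedDouble.exists_support_mul_eq (d : RedDouble F I) : ∃ S : Submodule ℂ (quotC F I),
    FiniteDimensional ℂ S ∧ ∀ D p (hp : IsSupport D p), S ≤ D → redMul F I 1 p hp.mem * d = d := by
  obtain ⟨S, hS, h⟩ := (star d).exists_mul_eq
  refine ⟨S, hS, fun D p hp hD => star_injective ?_⟩
  rw [star_mul, RedDouble.star_redMul_one hp.mem hp.star_eq]
  refine Subtype.ext (Eq.trans ?_ (h D p hp hD))
  change (star d).1 * (fullB F I 1 * fullJ F I p) = _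
  rw [map_one, one_mul]

variable {K : Type z} [NormedAddCommGroup K] [InnerProductSpace ℂ K] [CompleteSpace K]
  {π : RedDouble F I →⋆ₙₐ[ℂ] (K →L[ℂ] K)}

theorem inner_redRep (d : RedDouble F I) (v w : K) : ⟪v, π d w⟫_ℂ = ⟪π (star d) v, w⟫_ℂ := by
  rw [map_star, ContinuousLinearMap.star_eq_adjoint, ContinuousLinearMap.adjoint_inner_left]

theorem map_mul_redRep (d e : RedDouble F I) (v : K) : π (d * e) v = π d (π e v) := by
  rw [map_mul]
  rfl

/-- Elements of the reduced double have left local units in `𝓘`, so `π(d) v = π(p) π(d) v` for some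
`p ∈ 𝓘`. -/
theorem redRep_mem_core (d : RedDouble F I) (v : K) : π d v ∈ core π := by
  obtain ⟨S, hS, h⟩ := d.exists_support_mul_eq
  obtain ⟨D, p, hD, hp⟩ := exists_isSupport F I S
  rw [← h D p hp hD, map_mul_redRep]
  exact Submodule.subset_span ⟨p, hp.mem, _, rfl⟩

theorem dense_core (hπ : IsNondegenerate π) : Dense (core π : Set K) := by
  refine Dense.mono (SetLike.coe_subset_coe.mpr (Submodule.span_le.mpr ?_)) hπ
  rintro _ ⟨d, v, rfl⟩
  exact redRep_mem_core d v

/-- A vector killed by the reduced double is orthogonal to its image, which is total. This makes an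
element of the core determined by the vectors `π(d) v`, so all identities of the action below are
checked after applying `π(d)`. -/
theorem eq_of_redRep_eq (hπ : IsNondegenerate π) {v v' : K} (h : ∀ d, π d v = π d v') :
    v = v' := by
  rw [← sub_eq_zero]
  refine hπ.eq_zero_of_inner_left ℂ fun w hw => ?_
  induction hw using Submodule.span_induction with
  | zero => exact inner_zero_right _
  | add a b _ _ ha hb => rw [inner_add_right, ha, hb, add_zero]
  | smul c a _ ha => rw [inner_smul_right, ha, mul_zero]
  | mem a ha =>
    obtain ⟨d, k, rfl⟩ := ha
    rw [inner_redRep, map_sub, h, sub_self, inner_zero_left]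

/-- Each vector of the core is fixed by all large support projections. -/
theorem exists_support_redRep_eq {v : K} (hv : v ∈ core π) : ∃ S : Submodule ℂ (quotC F I),
    FiniteDimensional ℂ S ∧
      ∀ D p (hp : IsSupport D p), S ≤ D → π (redMul F I 1 p hp.mem) v = v := by
  unfold core at hv
  induction hv using Submodule.span_induction with
  | zero => exact ⟨⊥, inferInstance, fun _ _ _ _ => map_zero _⟩
  | add a b _ _ ha hb =>
    obtain ⟨S, hS, hS'⟩ := ha
    obtain ⟨T, hT, hT'⟩ := hb
    refine ⟨S ⊔ T, inferInstance, fun D p hp h => ?_⟩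
    rw [map_add, hS' D p hp (le_sup_left.trans h), hT' D p hp (le_sup_right.trans h)]
  | smul c a _ ha =>
    obtain ⟨S, hS, hS'⟩ := ha
    refine ⟨S, hS, fun D p hp h => ?_⟩
    rw [map_smul, hS' D p hp h]
  | mem a ha =>
    obtain ⟨x, hx, k, rfl⟩ := ha
    obtain ⟨S, hS, h⟩ := (redMul F I 1 x hx).exists_support_mul_eq
    exact ⟨S, hS, fun D p hp hD => by rw [← map_mul_redRep, h D p hp hD]⟩

theorem exists_isSupport_redRep_eq {v : K} (hv : v ∈ core π) (S : Submodule ℂ (quotC F I))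
    [FiniteDimensional ℂ S] : ∃ D p, ∃ hp : IsSupport D p, S ≤ D ∧
      π (redMul F I 1 p hp.mem) v = v := by
  obtain ⟨T, hT, h⟩ := exists_support_redRep_eq hv
  obtain ⟨D, p, hD, hp⟩ := exists_isSupport F I (S ⊔ T)
  exact ⟨D, p, hp, le_sup_left.trans hD, h D p hp (le_sup_right.trans hD)⟩

/-- If `q` fixes `v`, then `u = π(z q) v` satisfies `π(d) u = π(d z) v` for all `d`. -/
theorem redRep_mulLeft (z : FullDBI F I) (q d : RedDouble F I) {v : K} (hq : π q v = v) :
    π d (π (q.mulLeft z) v) = π (d.mulRight z) v := by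
  conv_rhs => rw [← hq]
  rw [← map_mul_redRep, ← map_mul_redRep]
  exact congrArg (fun e => π e v) (Subtype.ext (mul_assoc d.1 z q.1).symm)

/-- If `q` fixes `v`, then `π(z q) v` has the required property; the characterization does not
mention `q`, so the choice of local unit is irrelevant. -/
theorem exists_redRep_mulRight (z : FullDBI F I) (v : core π) :
    ∃ u : core π, ∀ d, π d (u : K) = π (d.mulRight z) (v : K) := by
  obtain ⟨D, p, hp, -, h⟩ := exists_isSupport_redRep_eq v.2 ⊥
  exact ⟨⟨_, redRep_mem_core _ _⟩, fun d => redRep_mulLeft z _ d h⟩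

/-- The vector `z v`, for `z` in the full double and `v` in the core. -/
def coreAct (z : FullDBI F I) (v : core π) : core π := (exists_redRep_mulRight z v).choose

theorem redRep_coreAct (z : FullDBI F I) (v : core π) (d : RedDouble F I) :
    π d (coreAct z v : K) = π (d.mulRight z) (v : K) := (exists_redRep_mulRight z v).choose_spec d

theorem coreAct_eq (hπ : IsNondegenerate π) {z : FullDBI F I} {v u : core π}
    (h : ∀ d, π d (u : K) = π (d.mulRight z) (v : K)) : coreAct z v = u :=
  Subtype.ext (eq_of_redRep_eq hπ fun d => (redRep_coreAct z v d).trans (h d).symm)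

theorem coreAct_eq_mulLeft (hπ : IsNondegenerate π) (z : FullDBI F I) {v : core π}
    {q : RedDouble F I} (hq : π q (v : K) = v) : (coreAct z v : K) = π (q.mulLeft z) v :=
  congrArg Subtype.val (coreAct_eq hπ (u := ⟨_, redRep_mem_core _ _⟩)
    fun d => redRep_mulLeft z q d hq)

/-- The `*`-representation of the full double on the core. -/
def coreRep (hπ : IsNondegenerate π) : StarRep (FullDBI F I) (core π) where
  hom := AlgHom.ofLinearMap
    { toFun := fun z =>
        { toFun := coreAct z
          map_add' := fun v w => coreAct_eq hπ fun d => by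
            rw [Submodule.coe_add, Submodule.coe_add, map_add, map_add, redRep_coreAct,
              redRep_coreAct]
          map_smul' := fun c v => coreAct_eq hπ fun d => by
            rw [RingHom.id_apply, Submodule.coe_smul, Submodule.coe_smul, map_smul, map_smul,
              redRep_coreAct] }
      map_add' := fun y z => LinearMap.ext fun v => coreAct_eq hπ fun d => by
        change π d ((coreAct y v : K) + (coreAct z v : K)) = _
        rw [map_add, redRep_coreAct, redRep_coreAct, ← add_apply, ← map_add]
        exact congrArg (fun e => π e (v : K)) (Subtype.ext (mul_add d.1 y z).symm)
      map_smul' := fun c z => LinearMap.ext fun v => coreAct_eq hπ fun d => by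
        change π d (c • (coreAct z v : K)) = _
        rw [map_smul, redRep_coreAct, ← smul_apply, ← map_smul]
        exact congrArg (fun e => π e (v : K)) (Subtype.ext (mul_smul_comm c d.1 z).symm) }
    (LinearMap.ext fun v => coreAct_eq hπ fun d =>
      congrArg (fun e => π e (v : K)) (Subtype.ext (mul_one d.1).symm))
    (fun y z => LinearMap.ext fun v => coreAct_eq hπ fun d => by
      change π d (coreAct y (coreAct z v) : K) = _
      rw [redRep_coreAct, redRep_coreAct]
      exact congrArg (fun e => π e (v : K)) (Subtype.ext (mul_assoc d.1 y z)))
  inner_hom z v w := by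
    change ⟪(v : K), (coreAct z w : K)⟫_ℂ = ⟪(coreAct (star z) v : K), (w : K)⟫_ℂ
    -- With a self-adjoint unit `q` fixing `v`, both sides become statements about the reduced
    -- double: `⟨v, z w⟩ = ⟨v, π(q z) w⟩` and `(q z)^* = z^* q`.
    obtain ⟨D, p, hp, -, h⟩ := exists_isSupport_redRep_eq v.2 ⊥
    set q := redMul F I 1 p hp.mem
    have hq : star q = q := RedDouble.star_redMul_one hp.mem hp.star_eq
    rw [coreAct_eq_mulLeft hπ (star z) h]
    conv_lhs => rw [← h, ← hq, ← inner_redRep, redRep_coreAct, inner_redRep]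
    congr 2
    refine congrArg π (Subtype.ext ?_)
    change star (q.1 * z) = star z * q.1
    rw [star_mul]
    exact congrArg (star z * ·) (congrArg Subtype.val hq)

theorem coreRep_apply (hπ : IsNondegenerate π) (d : RedDouble F I) (v : core π) :
    (coreRep hπ d.1 v : K) = π d (v : K) :=
  congrArg Subtype.val (coreAct_eq hπ (u := ⟨π d v, redRep_mem_core d _⟩)
    fun e => (map_mul_redRep e d (v : K)).symm)

end Core

/-! ### The representation of `D(B, I)` on the core -/

section Restricted

variable {U : Type u} [Ring U] [StarRing U] [HopfAlgebra ℂ U] [StarModule ℂ U] [HopfStarAlgebra U]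
variable {F : RepFamily.{u, v, w} U} {I : LeftCoideal U}

theorem evDual_one : evDual F I 1 = 1 := FullDual.ext fun c => by
  rw [evDual, FullDual.toFun_mk, FullDual.one_apply]
  rfl

theorem evDual_smul (z : ℂ) (x : I.carrier) : evDual F I (z • x) = z • evDual F I x :=
  FullDual.ext fun c => by simp [evDual]

theorem evDual_mul (x y : I.carrier) : evDual F I (x * y) = evDual F I x * evDual F I y :=
  FullDual.ext fun c => by
    rw [FullDual.mul_apply, evDual, evDual, evDual, FullDual.toFun_mk, FullDual.toFun_mk,
      FullDual.toFun_mk, comulC_spec]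

theorem evDual_star (x : I.carrier) : evDual F I (star x) = star (evDual F I x) :=
  FullDual.ext fun c => by
    rw [FullDual.star_apply, evDual, evDual, FullDual.toFun_mk, FullDual.toFun_mk, evC_apply,
      evC_apply, dagC_apply, Complex.conj_conj]

variable (F I) in
/-- The `*`-homomorphism from `I` to the full dual of `C`. -/
def evDualHom : I.carrier →⋆ₐ[ℂ] FullDual (quotC F I) where
  toFun := evDual F I
  map_one' := evDual_one
  map_mul' := evDual_mul
  map_zero' := FullDual.ext fun c => by simp [evDual]
  map_add' x y := FullDual.ext fun c => by simp [evDual]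
  commutes' z := (congrArg (evDual F I) (Algebra.algebraMap_eq_smul_one z)).trans
    ((evDual_smul z 1).trans ((congrArg (z • ·) evDual_one).trans
      (Algebra.algebraMap_eq_smul_one z).symm))
  map_star' := evDual_star

theorem actDual_evDual (x : I.carrier) (a : coeffAlgebra F) :
    actDual F I (evDual F I x) a = evDual F I (actI I x (a : FullDual U)) :=
  FullDual.ext fun c => by
    rw [actDual_apply, evDual, evDual, FullDual.toFun_mk, FullDual.toFun_mk]
    rfl

variable {H : Type z} [NormedAddCommGroup H] [InnerProductSpace ℂ H]

theorem mul'_map_lTensor_congr {E A B J J' : Type*} [Ring E] [Algebra ℂ E] [AddCommGroup A]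
    [Module ℂ A] [AddCommGroup B] [Module ℂ B] [AddCommGroup J] [Module ℂ J] [AddCommGroup J']
    [Module ℂ J'] (ρ : B →ₗ[ℂ] E) (σ : J →ₗ[ℂ] E) (σ' : J' →ₗ[ℂ] E) (g : A →ₗ[ℂ] J)
    (g' : A →ₗ[ℂ] J') (h : ∀ a, σ (g a) = σ' (g' a)) (t : B ⊗[ℂ] A) :
    LinearMap.mul' ℂ E (TensorProduct.map ρ σ (g.lTensor B t)) =
      LinearMap.mul' ℂ E (TensorProduct.map ρ σ' (g'.lTensor B t)) := by
  induction t with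
  | zero => simp
  | add a b ha hb => simp only [map_add, ha, hb]
  | tmul b a => simp [h]

/-- On functionals coming from `I`, the action of `A` on the full dual is `x ↦ τ(a, x₍₋₁₎) x₍₀₎`. So
the interchange relation of the full double specializes to that of `D(B, I)`. -/
theorem rep_evDual_mul_rep (Θ : StarRep (FullDBI F I) H) (x : I.carrier) (b : algB F I) :
    ((Θ.comp (fullJ F I)).comp (evDualHom F I)) x * (Θ.comp (fullB F I)) b = LinearMap.mul' ℂ _
      (TensorProduct.map (Θ.comp (fullB F I)).hom.toLinearMap
        ((Θ.comp (fullJ F I)).comp (evDualHom F I)).hom.toLinearMap (interchangeI F I x b)) := by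
  have h1 : Θ (fullJ F I (evDual F I x)) * Θ (fullB F I b) =
      Θ (Double.mulMap _ (fullInterchange F I (evDual F I x) b)) :=
    (map_mul Θ.hom _ _).symm.trans (congrArg Θ.hom (Double.interchange _ _ _))
  refine h1.trans ((mulMap_eq _ Θ _).trans ?_)
  refine mul'_map_lTensor_congr _ _ _ (actDual F I (evDual F I x))
    ((actI I x) ∘ₗ inclLin (coeffAlgebra F)) (fun a => ?_) (coactB F I b)
  exact congrArg (Θ.comp (fullJ F I)).hom (actDual_evDual x a)

/-- The restriction to `D(B, I)` of a `*`-representation of the full double. -/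
def restrictRep (Θ : StarRep (FullDBI F I) H) : StarRep (DBI F I) H :=
  Double.liftRep (interchangeI F I) (Θ.comp (fullB F I))
    ((Θ.comp (fullJ F I)).comp (evDualHom F I)) (rep_evDual_mul_rep Θ)

theorem restrictRep_inB (Θ : StarRep (FullDBI F I) H) (b : algB F I) :
    restrictRep Θ (inB F I b) = Θ (fullB F I b) := Double.liftRep_inclB _ _ _ _ b

theorem restrictRep_inI (Θ : StarRep (FullDBI F I) H) (x : I.carrier) :
    restrictRep Θ (inI F I x) = Θ (fullJ F I (evDual F I x)) := Double.liftRep_inclJ _ _ _ _ x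

/-- A vector whose orbit map factors through the dual of a finite-dimensional space of functionals
has a coaction. -/
theorem exists_slice_of_restrict {X : Type u} [AddCommGroup X] [Module ℂ X] [Coalgebra ℂ X]
    (D : Submodule ℂ X) [FiniteDimensional ℂ D] (g : FullDual X →ₗ[ℂ] H)
    (hg : ∀ y, (∀ d ∈ D, y.toFun d = 0) → g y = 0) :
    ∃ t : H ⊗[ℂ] X, ∀ y, slice y.toFun t = g y := by
  classical
  obtain ⟨P, hP⟩ := D.subtype.exists_leftInverse_of_injective (Submodule.ker_subtype D)
  let e := Module.finBasis ℂ D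
  -- The canonical tensor of a basis of `D` and its dual basis. The projection `P` extends the
  -- coordinates to all of `X`; the hypothesis on `g` makes the choice of extension harmless.
  refine ⟨∑ i, g (FullDual.mk (e.coord i ∘ₗ P)) ⊗ₜ[ℂ] (e i : X), fun y => ?_⟩
  have h : ∀ d ∈ D, (y - ∑ i, y.toFun (e i : X) • FullDual.mk (e.coord i ∘ₗ P)).toFun d = 0 := by
    intro d hd
    have h1 : P d = ⟨d, hd⟩ := LinearMap.congr_fun hP ⟨d, hd⟩
    have h2 := congrArg y.toFun (congrArg Subtype.val (e.sum_repr ⟨d, hd⟩))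
    simp only [Submodule.coe_sum, Submodule.coe_smul, map_sum, map_smul] at h2
    rw [map_sub, LinearMap.sub_apply, sub_eq_zero, ← h2, map_sum, LinearMap.sum_apply]
    refine Finset.sum_congr rfl fun i _ => ?_
    rw [map_smul, LinearMap.smul_apply, FullDual.toFun_mk, LinearMap.comp_apply, h1, smul_eq_mul,
      smul_eq_mul, mul_comm]
    rfl
  have h3 := hg _ h
  rw [map_sub, sub_eq_zero, map_sum] at h3
  rw [h3, map_sum]
  exact Finset.sum_congr rfl fun i _ => by rw [slice_tmul, map_smul]

variable {K : Type z} [NormedAddCommGroup K] [InnerProductSpace ℂ K] [CompleteSpace K]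
  {π : RedDouble F I →⋆ₙₐ[ℂ] (K →L[ℂ] K)}

theorem coreRep_fullJ (hπ : IsNondegenerate π) {x : FullDual (quotC F I)}
    (hx : x ∈ restrictedDual (quotC F I)) (v : core π) :
    (coreRep hπ (fullJ F I x) v : K) = π (redMul F I 1 x hx) (v : K) := by
  rw [← coreRep_apply hπ]
  change _ = (coreRep hπ (fullB F I 1 * fullJ F I x) v : K)
  rw [map_one, one_mul]

/-- If `p` fixes `v`, then `y v = (y p) v`, which is zero when `y` vanishes on the subcoalgebra of
`p`. So the orbit map has finite-dimensional support, and a coaction can be reconstructed from it.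
-/
theorem exists_slice_coreRep (hπ : IsNondegenerate π) (v : core π) :
    ∃ t : core π ⊗[ℂ] quotC F I, ∀ y : FullDual (quotC F I),
      slice y.toFun t = coreRep hπ (fullJ F I y) v := by
  obtain ⟨D, p, hp, -, h⟩ := exists_isSupport_redRep_eq v.2 ⊥
  have := hp.finite
  have hv : coreRep hπ (fullJ F I p) v = v := Subtype.ext <| by rw [coreRep_fullJ hπ hp.mem, h]
  refine exists_slice_of_restrict D (LinearMap.applyₗ v ∘ₗ
    ((coreRep hπ).comp (fullJ F I)).hom.toLinearMap) fun y hy => ?_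
  change coreRep hπ (fullJ F I y) v = 0
  rw [← hv, ← Module.End.mul_apply, ← map_mul, ← map_mul, hp.eq_zero_mul y hy, map_zero, map_zero,
    LinearMap.zero_apply]

theorem exists_slice_restrictRep (hπ : IsNondegenerate π) (v : core π) :
    ∃ t : core π ⊗[ℂ] quotC F I, ∀ x, slice (evC F I x) t =
      restrictRep (coreRep hπ) (inI F I x) v := by
  obtain ⟨t, ht⟩ := exists_slice_coreRep hπ v
  refine ⟨t, fun x => ?_⟩
  rw [restrictRep_inI, ← ht, evDual, FullDual.toFun_mk]

/-- The coaction of `M` is known only through `I`. A tensor representing the action of the entire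
full dual has the same slices by `I`, and these determine it. -/
theorem rep_eq_coreRep (hπ : IsNondegenerate π) {M : UnitaryDKModule F I (core π)}
    (hM : IsAssociated (restrictRep (coreRep hπ)) M) (y : FullDual (quotC F I)) (v : core π) :
    M.comod.rep y v = coreRep hπ (fullJ F I y) v := by
  obtain ⟨t, ht⟩ := exists_slice_coreRep hπ v
  have : M.comod.coact v = t := slice_evC_ext fun x => by
    refine (hM.2 x v).symm.trans ?_
    rw [restrictRep_inI, ← ht, evDual, FullDual.toFun_mk]
  rw [← ht, ← this]
  rfl

theorem isFType_restrictRep (hπ : IsNondegenerate π) : IsFType (restrictRep (coreRep hπ)) :=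
  isFTypeI_of_slice (exists_slice_restrictRep hπ)

theorem intertwines_restrictRep (hπ : IsNondegenerate π) :
    Intertwines (restrictRep (coreRep hπ)) π (core π).subtypeₗᵢ := by
  have hM := isAssociated_dkModuleOf (restrictRep (coreRep hπ)) (exists_slice_restrictRep hπ)
  refine ⟨_, hM, fun b x hx v => ?_⟩
  have h := congrArg Subtype.val (rep_eq_coreRep hπ hM x v)
  change π _ (v : K) = (restrictRep (coreRep hπ) (inB F I b)
    ((dkModuleOf (restrictRep (coreRep hπ)) _).comod.rep x v) : K)
  rw [rep_eq_coreRep hπ hM, restrictRep_inB, ← Module.End.mul_apply, ← map_mul, ← coreRep_apply hπ]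
  rfl

/-- The subspace belonging to `D` is cut out inside the complete space `K` by equations between
bounded operators, so it is closed. -/
theorem isLocallyComplete_restrictRep (hπ : IsNondegenerate π) :
    IsLocallyComplete (restrictRep (coreRep hπ)) := by
  have hM := isAssociated_dkModuleOf (restrictRep (coreRep hπ)) (exists_slice_restrictRep hπ)
  refine ⟨_, hM, fun D hD _ => ?_⟩
  obtain ⟨D', p, hDD', hp⟩ := exists_isSupport F I D
  rw [← isComplete_image_iff (core π).subtypeₗᵢ.isometry.isUniformInducing]
  refine IsClosed.isComplete ?_
  -- A functional `y` vanishing on `D` need not act on `K`, but `y p ∈ 𝓘` does, with `p` the support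
  -- projection of a subcoalgebra containing `D`. The equation `π(p) k = k` also forces `k` into the
  -- core.
  have hset : (core π).subtypeₗᵢ '' {v | (dkModuleOf (restrictRep (coreRep hπ))
        (exists_slice_restrictRep hπ)).comod.coact v ∈ LinearMap.range (D.subtype.lTensor _)} =
      {k | π (redMul F I 1 p hp.mem) k = k} ∩ ⋂ y : {y : FullDual (quotC F I) // ∀ d ∈ D,
        y.toFun d = 0}, {k | π (redMul F I 1 (y.1 * p)
          (restrictedDual_mul_left _ hp.mem)) k = 0} := by
    have hyp : ∀ y (v : core π), coreRep hπ (fullJ F I p) v = v → (coreRep hπ (fullJ F I y) v : K) =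
        π (redMul F I 1 (y * p) (restrictedDual_mul_left _ hp.mem)) (v : K) := by
      intro y v hv
      rw [← coreRep_fullJ hπ, map_mul, map_mul, Module.End.mul_apply, hv]
    ext k
    constructor
    · rintro ⟨v, hv, rfl⟩
      have h1 := UnitaryComodule.rep_support _ hp
        (v := v) (((UnitaryComodule.mem_range_iff _ D' v).mpr fun y hy =>
          (UnitaryComodule.mem_range_iff _ D v).mp hv y fun d hd => hy d (hDD' hd)))
      rw [rep_eq_coreRep hπ hM] at h1
      refine ⟨(coreRep_fullJ hπ hp.mem v).symm.trans (congrArg Subtype.val h1),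
        Set.mem_iInter.mpr fun y => ?_⟩
      refine (hyp y.1 v h1).symm.trans (congrArg Subtype.val (?_ : _ = (0 : core π)))
      rw [← rep_eq_coreRep hπ hM]
      exact (UnitaryComodule.mem_range_iff _ D v).mp hv y.1 y.2
    · rintro ⟨hk, hk'⟩
      have hkc : k ∈ core π := hk ▸ redRep_mem_core _ _
      have h1 : coreRep hπ (fullJ F I p) ⟨k, hkc⟩ = ⟨k, hkc⟩ :=
        Subtype.ext ((coreRep_fullJ hπ hp.mem _).trans hk)
      refine ⟨⟨k, hkc⟩, (UnitaryComodule.mem_range_iff _ D _).mpr fun y hy => ?_, rfl⟩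
      rw [rep_eq_coreRep hπ hM]
      exact Subtype.ext ((hyp y _ h1).trans (Set.mem_iInter.mp hk' ⟨y, hy⟩))
  rw [hset]
  refine (isClosed_eq (ContinuousLinearMap.continuous _) continuous_id).inter
    (isClosed_iInter fun y => isClosed_eq (ContinuousLinearMap.continuous _) continuous_const)

theorem existsUnique_restrictRep (hπ : IsNondegenerate π) : ∃! θ : StarRep (DBI F I) (core π),
    IsFType θ ∧ IsLocallyComplete θ ∧ Intertwines θ π (core π).subtypeₗᵢ :=
  ⟨restrictRep (coreRep hπ), ⟨isFType_restrictRep hπ, isLocallyComplete_restrictRep hπ,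
    intertwines_restrictRep hπ⟩, fun _ hθ => StarRep.ext_inner fun d => LinearMap.ext fun _ =>
      Subtype.ext (hθ.2.2.apply_eq (intertwines_restrictRep hπ) d rfl)⟩

end Restricted

/-! ### Bijection of unitary equivalence classes -/

section Correspondence

variable {U : Type u} [Ring U] [StarRing U] [HopfAlgebra ℂ U] [StarModule ℂ U] [HopfStarAlgebra U]
variable {F : RepFamily.{u, v, w} U} {I : LeftCoideal U}

/-- There is an intertwining isometry with dense range from `V` to `W`. -/
def Corresponds (V : LocCompleteRep.{u, v, w, z} F I) (W : NondegRep.{u, v, w, z} F I) : Prop :=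
  ∃ j : V.space →ₗᵢ[ℂ] W.space, DenseRange j ∧ Intertwines V.rep W.rep j

theorem exists_corresponds_right (V : LocCompleteRep.{u, v, w, z} F I) :
    ∃ W : NondegRep.{u, v, w, z} F I, Corresponds V W := by
  obtain ⟨π, ⟨hπ, h⟩, -⟩ := existsUnique_redRep V.isFType
  exact ⟨⟨UniformSpace.Completion V.space, π, hπ⟩, _, UniformSpace.Completion.denseRange_coe, h⟩

theorem exists_corresponds_left (W : NondegRep.{u, v, w, z} F I) :
    ∃ V : LocCompleteRep.{u, v, w, z} F I, Corresponds V W := by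
  obtain ⟨θ, ⟨h1, h2, h3⟩, -⟩ := existsUnique_restrictRep W.nondegenerate
  refine ⟨⟨core W.rep, θ, h1, h2⟩, _, ?_, h3⟩
  exact denseRange_subtype_val.mpr (dense_core W.nondegenerate)

/-- Both Hilbert spaces are completions of the same pre-Hilbert space; the identity extends to a
unitary, which intertwines by density and continuity. -/
theorem Corresponds.equiv_right {V : LocCompleteRep.{u, v, w, z} F I}
    {W W' : NondegRep.{u, v, w, z} F I} (h : Corresponds V W) (h' : Corresponds V W') : W ≈ W' := by
  obtain ⟨j, hj, M, hM, h⟩ := h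
  obtain ⟨j', hj', M', hM', h'⟩ := h'
  obtain rfl := hM.unique hM'
  let e : W.space ≃ₗᵢ[ℂ] W'.space := (LinearEquiv.refl ℂ V.space).extendOfIsometry j.toLinearMap
    j'.toLinearMap hj hj' fun x => (j'.norm_map x).trans (j.norm_map x).symm
  have he : ∀ v, e (j v) = j' v := LinearEquiv.extendOfIsometry_eq _ _ _ _ _ _
  refine ⟨e, fun d v => ?_⟩
  induction d using RedDouble.induction generalizing v with
  | h0 =>
    rw [map_zero, map_zero]
    exact map_zero e
  | hadd a b ha hb =>
    rw [map_add, map_add]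
    exact (map_add e _ _).trans (congrArg₂ (· + ·) (ha v) (hb v))
  | hsmul c a ha =>
    rw [map_smul, map_smul]
    exact (map_smul e _ _).trans (congrArg (c • ·) (ha v))
  | h b x hx =>
    refine hj.induction_on v (isClosed_eq ?_ ?_) fun v => ?_
    · exact e.continuous.comp (W.rep _).continuous
    · exact (W'.rep _).continuous.comp e.continuous
    · rw [h, he, he, h']

/-- Both isometries have the core as range, so `j'⁻¹ j` is a unitary. It intertwines since `π`
determines the action of `D(B, I)`. -/
theorem Corresponds.equiv_left {V V' : LocCompleteRep.{u, v, w, z} F I}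
    {W : NondegRep.{u, v, w, z} F I} (h : Corresponds V W) (h' : Corresponds V' W) : V ≈ V' := by
  obtain ⟨j, hj, h⟩ := h
  obtain ⟨j', hj', h'⟩ := h'
  let e : V.space ≃ₗᵢ[ℂ] V'.space := j.equivRange.trans ((LinearIsometryEquiv.ofEq _ _
    ((h.range_eq_core V.isLocallyComplete hj).trans
      (h'.range_eq_core V'.isLocallyComplete hj').symm)).trans j'.equivRange.symm)
  have he : ∀ v, j' (e v) = j v := fun v =>
    congrArg Subtype.val (j'.equivRange.apply_symm_apply (LinearIsometryEquiv.ofEq _ _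
      ((h.range_eq_core V.isLocallyComplete hj).trans
        (h'.range_eq_core V'.isLocallyComplete hj').symm) (j.equivRange v)))
  exact ⟨e, fun d v => j'.injective ((he _).trans (h.apply_eq h' d (he v).symm))⟩

theorem Corresponds.congr_right {V : LocCompleteRep.{u, v, w, z} F I}
    {W W' : NondegRep.{u, v, w, z} F I} (h : Corresponds V W) (hW : W ≈ W') : Corresponds V W' := by
  obtain ⟨j, hj, M, hM, h⟩ := h
  obtain ⟨e, he⟩ := hW
  refine ⟨e.toLinearIsometry.comp j, e.surjective.denseRange.comp hj e.continuous, M, hM,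
    fun b x hx v => ?_⟩
  exact (he _ _).symm.trans (congrArg e (h b x hx v))

/-- A map commuting with `I` commutes with the coactions, since these are determined by the slices
along `I`; slices by arbitrary functionals are then preserved too. -/
theorem IsAssociated.map_slice {H H' : Type z} [NormedAddCommGroup H] [InnerProductSpace ℂ H]
    [NormedAddCommGroup H'] [InnerProductSpace ℂ H'] {θ : StarRep (DBI F I) H}
    {θ' : StarRep (DBI F I) H'} {M : UnitaryDKModule F I H} {M' : UnitaryDKModule F I H'}
    (hM : IsAssociated θ M) (hM' : IsAssociated θ' M') (e : H →ₗ[ℂ] H')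
    (he : ∀ d v, e (θ d v) = θ' d (e v)) (f : quotC F I →ₗ[ℂ] ℂ) (v : H) :
    e (slice f (M.comod.coact v)) = slice f (M'.comod.coact (e v)) := by
  have h : ∀ (f : quotC F I →ₗ[ℂ] ℂ) (t : H ⊗[ℂ] quotC F I),
      slice f (e.rTensor _ t) = e (slice f t) := by
    intro f t
    induction t with
    | zero => simp
    | add a b ha hb => simp only [map_add, ha, hb]
    | tmul a b => simp
  rw [← h]
  refine congrArg (slice f) (slice_evC_ext fun x => ?_)
  rw [h]
  exact (congrArg e (hM.2 x v).symm).trans ((he _ v).trans (hM'.2 x (e v)))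

theorem Corresponds.congr_left {V V' : LocCompleteRep.{u, v, w, z} F I}
    {W : NondegRep.{u, v, w, z} F I} (h : Corresponds V W) (hV : V' ≈ V) : Corresponds V' W := by
  obtain ⟨j, hj, M, hM, h⟩ := h
  obtain ⟨e, he⟩ := hV
  obtain ⟨M', hM', -⟩ := existsUnique_isAssociated V'.isFType
  refine ⟨j.comp e.toLinearIsometry, hj.comp e.surjective.denseRange j.continuous, M', hM',
    fun b x hx v => (h b x hx (e v)).trans (congrArg j ?_)⟩
  refine Eq.trans ?_ (he _ _).symm
  exact congrArg (V.rep (inB F I b))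
    (hM'.map_slice hM e.toLinearEquiv.toLinearMap he x.toFun v).symm

/-- The correspondence is a bijection on unitary equivalence classes. -/
theorem exists_equiv_corresponds : ∃ e : Quotient (LocCompleteRep.setoid.{u, v, w, z} F I) ≃
    Quotient (NondegRep.setoid.{u, v, w, z} F I), ∀ V W, e ⟦V⟧ = ⟦W⟧ ↔ Corresponds V W := by
  choose W hW using exists_corresponds_right (F := F) (I := I)
  -- Completion as a map on classes. It is injective because `W` determines `V` up to equivalence,
  -- and surjective by restriction to the core.
  let f : Quotient (LocCompleteRep.setoid.{u, v, w, z} F I) →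
      Quotient (NondegRep.setoid.{u, v, w, z} F I) :=
    Quotient.lift (fun V => ⟦W V⟧) fun V V' h =>
      Quotient.sound ((hW V).equiv_right ((hW V').congr_left h))
  have hf : ∀ V W', f ⟦V⟧ = ⟦W'⟧ ↔ Corresponds V W' := fun V W' =>
    ⟨fun h => (hW V).congr_right (Quotient.exact h),
      fun h => Quotient.sound ((hW V).equiv_right h)⟩
  refine ⟨Equiv.ofBijective f ⟨?_, ?_⟩, hf⟩
  · intro q q' h
    induction q, q' using Quotient.inductionOn₂ with
    | _ V V' => exact Quotient.sound (((hf V _).mp h).equiv_left (hW V'))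
  · intro q
    induction q using Quotient.inductionOn with
    | _ W' =>
      obtain ⟨V, h⟩ := exists_corresponds_left W'
      exact ⟨⟦V⟧, (hf V W').mpr h⟩

end Correspondence

end DrinfeldCoideal

end

/-! ### The main theorem -/

theorem mainTheorem3 {U : Type u} [Ring U] [StarRing U] [HopfAlgebra ℂ U] [StarModule ℂ U]
    [HopfStarAlgebra U] (F : RepFamily.{u, v, w} U) (I : LeftCoideal U) :
    -- an `𝓕`-type `*`-representation has exactly one associated unitary Doi-Koppinen module
    (∀ (H : Type z) [NormedAddCommGroup H] [InnerProductSpace ℂ H] (θ : StarRep (DBI F I) H),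
      IsFType θ → ∃! M : UnitaryDKModule F I H, IsAssociated θ M) ∧
    -- from `D(B, I)` to the reduced double, by completion
    (∀ V : LocCompleteRep.{u, v, w, z} F I,
      ∃! π : RedDouble F I →⋆ₙₐ[ℂ]
          (UniformSpace.Completion V.space →L[ℂ] UniformSpace.Completion V.space),
        IsNondegenerate π ∧ Intertwines V.rep π UniformSpace.Completion.toComplₗᵢ) ∧
    -- from the reduced double to `D(B, I)`, by restriction to the dense subspace `π(𝓘) K`
    (∀ W : NondegRep.{u, v, w, z} F I, Dense (core W.rep : Set W.space) ∧
      ∃! θ : StarRep (DBI F I) (core W.rep),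
        IsFType θ ∧ IsLocallyComplete θ ∧ Intertwines θ W.rep (core W.rep).subtypeₗᵢ) ∧
    -- the two constructions are mutually inverse
    (∀ (V : LocCompleteRep.{u, v, w, z} F I) (W : NondegRep.{u, v, w, z} F I)
      (j : V.space →ₗᵢ[ℂ] W.space), DenseRange j → Intertwines V.rep W.rep j →
        LinearMap.range j.toLinearMap = core W.rep) ∧
    ∃ e : Quotient (LocCompleteRep.setoid.{u, v, w, z} F I) ≃
        Quotient (NondegRep.setoid.{u, v, w, z} F I),
      ∀ (V : LocCompleteRep.{u, v, w, z} F I) (W : NondegRep.{u, v, w, z} F I),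
        e ⟦V⟧ = ⟦W⟧ ↔
          ∃ j : V.space →ₗᵢ[ℂ] W.space, DenseRange j ∧ Intertwines V.rep W.rep j :=
  ⟨fun _ _ _ _ hθ => existsUnique_isAssociated hθ, fun V => existsUnique_redRep V.isFType,
    fun W => ⟨dense_core W.nondegenerate, existsUnique_restrictRep W.nondegenerate⟩,
    fun V _ _ hj h => h.range_eq_core V.isLocallyComplete hj, exists_equiv_corresponds⟩
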